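/- **Particles and flavour.** Let $k\ge 1$, $a\ge 0$, $n=2k+a$. The particles are $k$ pairs $(f_j,\bar f_j)$ of fundamental/anti-fundamental states and $a$ adjoint states. Give $f_j$ the flavour $+\phi_j$, $\bar f_j$ the flavour $-\phi_j$ ($\phi_1,\dots,\phi_k$ independent symbols) and adjoint states the flavour $0$. For a set $I$ of particles put $\vartheta_I=1$ ($I$ is *allowed*) if the total flavour of $I$ is $0$ or a single term $\pm\phi_j$ (in the latter case $I$ is a *matter* state), and $\vartheta_I=0$ otherwise. **Kinematic space.** Fix real constants $b_I$. $\mathcal K_n^k$ is the affine space of all real families $(s_I)_I$, $I$ running over the sets of particles, such that $s_{\bar I}=s_I$ for complements $\bar I$; $s_I=0$ if $|I|\in\{0,1,n-1,n\}$; $s_I=b_I$ if $\vartheta_I=0$; and $s_{I_1\cup I_2}+s_{I_2\cup I_3}+s_{I_1\cup I_3}=s_{I_1}+s_{I_2}+s_{I_3}+s_{I_4}$ for every partition of the particles into four non-empty allowed sets $I_1,\dots,I_4$ that are not all matter states. **Orderings.** A *block* is an adjoint particle $g$ (then $l_B=r_B=g$, with no sub-blocks) or a word $B=(l_B,B_1,\dots,B_s,r_B)$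 with $(l_B,r_B)=(f_j,\bar f_j)$ and $B_1,\dots,B_s$ ($s\ge0$) blocks, $\mathrm{sub}[B]=\{B_1,\dots,B_s\}$. A *Melia ordering* is a word $\alpha=[B_1,B_2,\dots,B_m]$ containing every particle once, where $B_1=(l_1,r_1)$ is a pair without sub-blocks (the pair fixed in the Melia basis) and $B_2,\dots,B_m$ are blocks. Write $s_{J,K}=s_{J\cup K}$. **Inverse-soft constraints.** $\pmb H[\alpha]$ is a set of Mandelstam variables, each of which is set equal to minus a constant. Set $\pmb H[(l_1,r_1)]=\emptyset$ and, for $\beta=[(l_1,r_1),B_2,\dots,B_{m-1}]$, let $\pmb H[\beta,B_m]$ be the union of $\pmb H[\beta]$ and the following sets: * $C_1=\{s_{B_m,l_i},\,s_{B_m,r_i},\,s_{B_m,J} : 1\le i\le m-1,\ J\in\mathrm{sub}[B_i]\}\setminus\{s_{B_m,l_1},\,s_{B_m,r_{m-1}}\}$; * if $B_m$ is not an adjoint particle, $C_2=\{s_{B_i,r_m}: 2\le i\le m-1\}$; * if $B_m=(l_m,B_{m_1},\dots,B_{m_s},r_m)$ with $s\ge1$, also $\{s_{l_m,r_m}\}\cup\{s_{B_{m_i},r_m}:1\le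 i\le s-1\}$, $\{s_{B_i,B_{m_j}}:2\le i\le m-1,\ 1\le j\le s\}$ and $\pmb H[(-L_m,l_m),B_{m_1},\dots,B_{m_s}]$, where $L_m$ is the total momentum of $B_m$ without $r_m$ (the state $-L_m$ occurs in no constraint). **Extra constraints.** For particles $u,v$, the diagonal $(u,v)$ of the polygon dual to $\alpha$ *crosses the flavour line* of a pair if exactly one member of the pair is among the particles of $\alpha$ from the earlier one of $u,v$ (included) to the later one (excluded). $\pmb H^A[\alpha]$ consists of, for (sub-)blocks $B,B'$ of $\alpha$ at any level other than $B_1$: * $s_{B,B'}$ if $B\cap B'=\emptyset$ and $(l_B,l_{B'})$ crosses at least two flavour lines; * $s_{B,r_{B'}}$ if $B'$ is not an adjoint particle, $B\cap B'=\emptyset$ or $B\subsetneq B'$, and $(l_B,r_{B'})$ crosses at least one flavour line other than that of $(l_{B'},r_{B'})$. Given real constants $c_I$, let $H^T[\alpha]\subseteq\mathcal K_n^k$ be the affine subspace $-s_I=c_I$ for all $s_I\in\pmb H[\alpha]\cup\pmb H^A[\alpha]$, and assume that it is non-empty. **Graph differentials.** Let $g$ be a cubic tree graph with the $n$ particles as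 external legs and $\kappa$ a cyclic ordering of the legs for which $g$ is planar. Each internal edge of $g$ gives a channel $I$ (up to complement). Let $W(g|\kappa)=\mathrm{sign}(g|\kappa)\bigwedge_{I\in g}ds_I$, a constant $(n-3)$-form on $\mathcal K_n^k$, where the signs are fixed, up to one overall sign, by the rules: flipping a vertex (exchanging two branches at it) changes the sign of $W$; a mutation that replaces a propagator $S$ by $T$ with the ordering kept replaces $W$ by $-W|_{dS\to dT}$. If $g$ is planar for both $\kappa$ and $\alpha$, $\mathrm{flip}(\kappa,\alpha)$ is the number of vertex flips that turn the planar drawing of $g$ with ordering $\kappa$ into the one with ordering $\alpha$. **Theorem.** For every Melia ordering $\alpha$, the differentials on $H^T[\alpha]$ of the $\alpha$-planar Mandelstam variables span an $(n-3)$-dimensional space, and there is a non-zero volume form $dV[\alpha]$ in them (the wedge product of a basis of this span) such that, for all $(g|\kappa)$, $$W(g|\kappa)\big|_{H^T[\alpha]}=\begin{cases}(-1)^{\mathrm{flip}(\kappa,\alpha)}\,dV[\alpha] & \text{if } g \text{ is planar with respect to } \alpha \text{ and all its propagators are allowed},\\ 0 & \text{if } g \text{ is not planar with respect to } \alpha.\end{cases}$$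 Consequently, let $N(g|\kappa)$ be any numerators (functions on $\mathcal K_n^k$ with values in a real vector space, for instance colour factors) that change sign under each vertex flip. The scattering form $\Omega_n^k[N]=\sum_{g}N(g|\alpha_g)\,W(g|\alpha_g)\prod_{I\in g}\vartheta_I/s_I$, the sum being over all cubic graphs with any choice of compatible orderings $\alpha_g$, satisfies $$\Omega_n^k[N]\big|_{H^T[\alpha]}=M_n[N;\alpha]\,dV[\alpha],\qquad M_n[N;\alpha]=\sum_{g\ \alpha\text{-planar}}N(g|\alpha)\prod_{I\in g}\frac{\vartheta_I}{s_I},$$ so the pullback of $\Omega_n^k[N]$ to $H^T[\alpha]$ yields the colour-ordered amplitude $M_n[N;\alpha]$, the coefficient of $\alpha$ in the Melia-basis colour decomposition. -/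

import Mathlib

open scoped BigOperators

noncomputable section

namespace BiColour

/-! ### External states and flavour -/

/-- The external states: `k` pairs `f j`, `af j` of scalars in the fundamental and anti-fundamental
representation, the two members of a pair carrying opposite flavour and different pairs different
flavours, and `a` adjoint scalars. The number of particles is `n = 2 * k + a`. -/
inductive Particle (k a : ℕ)
  | f (j : Fin k)
  | af (j : Fin k)
  | adj (i : Fin a)
  deriving DecidableEq, Fintype

variable {k a : ℕ}

/-- A fixed numbering of the particles, `(0,1), (2,3), …` being the pairs. It only enters an
overall sign convention. -/
def Particle.code : Particle k a → ℕ
  | .f j => 2 * (j : ℕ)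
  | .af j => 2 * (j : ℕ) + 1
  | .adj i => 2 * k + (i : ℕ)

theorem Particle.code_injective : Function.Injective (Particle.code : Particle k a → ℕ) := by
  rintro (i | i | i) (j | j | j) h <;> simp only [Particle.code] at h <;>
    first
      | (congr 1; ext; omega)
      | (exfalso; omega)

/-- The coefficient of the flavour symbol `f_r` in the total flavour of `I`. -/
def charge (I : Finset (Particle k a)) (r : Fin k) : ℤ :=
  (if Particle.f r ∈ I then 1 else 0) - (if Particle.af r ∈ I then 1 else 0)

/-- The total flavour of `I` vanishes: `I` is in an adjoint channel. -/
def IsNeutral (I : Finset (Particle k a)) : Prop := ∀ r, charge I r = 0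

/-- The total flavour of `I` is a single term `± f_r`: `I` is in an (anti-)fundamental channel. -/
def IsMatter (I : Finset (Particle k a)) : Prop :=
  ∃ r, (charge I r = 1 ∨ charge I r = -1) ∧ ∀ r', r' ≠ r → charge I r' = 0

/-- The channel `I` is allowed by flavour conservation. -/
def IsAllowed (I : Finset (Particle k a)) : Prop := IsNeutral I ∨ IsMatter I

open Classical in
/-- `ϑ_I`. -/
def theta (I : Finset (Particle k a)) : ℝ := if IsAllowed I then 1 else 0

/-! ### Kinematic space -/

/-- A value `s_I` for every set `I` of particles. -/
abbrev Mandelstam (k a : ℕ) := Finset (Particle k a) → ℝ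

/-- `I₁ ∪ I₂ ∪ I₃ ∪ I₄` is a partition of the particles into four states (each of them adjoint
or (anti-)fundamental) that are not all (anti-)fundamental. -/
def IsFourPartition (I₁ I₂ I₃ I₄ : Finset (Particle k a)) : Prop :=
  (I₁.Nonempty ∧ I₂.Nonempty ∧ I₃.Nonempty ∧ I₄.Nonempty) ∧
  (Disjoint I₁ I₂ ∧ Disjoint I₁ I₃ ∧ Disjoint I₁ I₄ ∧ Disjoint I₂ I₃ ∧ Disjoint I₂ I₄ ∧
    Disjoint I₃ I₄) ∧
  I₁ ∪ I₂ ∪ I₃ ∪ I₄ = Finset.univ ∧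
  (IsAllowed I₁ ∧ IsAllowed I₂ ∧ IsAllowed I₃ ∧ IsAllowed I₄) ∧
  ¬ (IsMatter I₁ ∧ IsMatter I₂ ∧ IsMatter I₃ ∧ IsMatter I₄)

/-- The (anti-)fundamental small kinematic space `K_n^k`, with the values `b_I` of the Mandelstam
variables that are forbidden by flavour conservation. -/
def kinSpace (b : Mandelstam k a) : AffineSubspace ℝ (Mandelstam k a) where
  carrier := {s |
    (∀ I, s Iᶜ = s I) ∧
    (∀ I, I.card ≤ 1 ∨ 2 * k + a ≤ I.card + 1 → s I = 0) ∧
    (∀ I, ¬ IsAllowed I → s I = b I) ∧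
    (∀ I₁ I₂ I₃ I₄, IsFourPartition I₁ I₂ I₃ I₄ →
      s (I₁ ∪ I₂) + s (I₂ ∪ I₃) + s (I₁ ∪ I₃) = s I₁ + s I₂ + s I₃ + s I₄)}
  smul_vsub_vadd_mem' := by
    rintro c p q r ⟨p1, p2, p3, p4⟩ ⟨q1, q2, q3, q4⟩ ⟨r1, r2, r3, r4⟩
    refine ⟨fun I => ?_, fun I h => ?_, fun I h => ?_, fun I₁ I₂ I₃ I₄ h => ?_⟩ <;>
      simp only [vsub_eq_sub, vadd_eq_add, Pi.add_apply, Pi.smul_apply, Pi.sub_apply, smul_eq_mul]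
    · rw [p1, q1, r1]
    · rw [p2 I h, q2 I h, r2 I h]; ring
    · rw [p3 I h, q3 I h, r3 I h]; ring
    · linear_combination c * p4 _ _ _ _ h - c * q4 _ _ _ _ h + r4 _ _ _ _ h

/-- The points at which `- s_I = c_I` for all `I ∈ C`. -/
def constraintSpace (C : Set (Finset (Particle k a))) (c : Mandelstam k a) :
    AffineSubspace ℝ (Mandelstam k a) where
  carrier := {s | ∀ I ∈ C, - s I = c I}
  smul_vsub_vadd_mem' := by
    intro t p q r hp hq hr I hI
    have h1 := hp I hI
    have h2 := hq I hI
    have h3 := hr I hI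
    simp only [vsub_eq_sub, vadd_eq_add, Pi.add_apply, Pi.smul_apply, Pi.sub_apply, smul_eq_mul]
    linear_combination t * h1 - t * h2 + h3

/-! ### Blocks and Melia orderings -/

/-- A (possibly empty) sequence of blocks. `adj g rest` is the single adjoint particle `g` followed
by `rest`; `pair j sub rest` is the block `(f j, sub, af j)`, with the sequence `sub` of sub-blocks
enclosed by the pair `j`, followed by `rest`. -/
inductive Blocks (k a : ℕ)
  | nil
  | adj (g : Fin a) (rest : Blocks k a)
  | pair (j : Fin k) (sub rest : Blocks k a)

/-- The sequence of particles of a sequence of blocks. -/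
def Blocks.word : Blocks k a → List (Particle k a)
  | .nil => []
  | .adj g rest => .adj g :: rest.word
  | .pair j sub rest => .f j :: (sub.word ++ .af j :: rest.word)

/-- A single block: an adjoint particle, or a pair with its sub-blocks. -/
inductive Block (k a : ℕ)
  | adj (g : Fin a)
  | pair (j : Fin k) (sub : Blocks k a)

/-- The list of the blocks of a sequence (at the top level only). -/
def Blocks.toList : Blocks k a → List (Block k a)
  | .nil => []
  | .adj g rest => .adj g :: rest.toList
  | .pair j sub rest => .pair j sub :: rest.toList

/-- The list of all the blocks and sub-blocks of a sequence, at every level. -/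
def Blocks.all : Blocks k a → List (Block k a)
  | .nil => []
  | .adj g rest => .adj g :: rest.all
  | .pair j sub rest => .pair j sub :: (sub.all ++ rest.all)

/-- The set of particles of a block. -/
def Block.particles : Block k a → Finset (Particle k a)
  | .adj g => {.adj g}
  | .pair j sub => insert (.f j) (insert (.af j) sub.word.toFinset)

/-- `l_B`; the particle itself if `B` is an adjoint particle. -/
def Block.left : Block k a → Particle k a
  | .adj g => .adj g
  | .pair j _ => .f j

/-- `r_B`; the particle itself if `B` is an adjoint particle. -/
def Block.right : Block k a → Particle k a
  | .adj g => .adj g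
  | .pair j _ => .af j

/-- `sub[B]`, the immediate sub-blocks of `B`. -/
def Block.sub : Block k a → List (Block k a)
  | .adj _ => []
  | .pair _ sub => sub.toList

/-- An ordering `α = [(l₁, r₁), B₂, …, B_m]` of all the particles in the Melia basis: the pair
`first` is in front, and the other particles form a sequence of blocks. -/
structure MeliaOrdering (k a : ℕ) where
  first : Fin k
  rest : Blocks k a
  nodup : (Particle.f first :: Particle.af first :: rest.word).Nodup
  complete : ∀ p, p ∈ Particle.f first :: Particle.af first :: rest.word

/-- The particles in the order `α`. -/
def MeliaOrdering.word (α : MeliaOrdering k a) : List (Particle k a) :=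
  .f α.first :: .af α.first :: α.rest.word

/-- The first particle of `α`. -/
def MeliaOrdering.root (α : MeliaOrdering k a) : Particle k a := .f α.first

/-! ### The inverse-soft constraints `H_n[α]`

A constraint `-s_I = c_I` is recorded by the set `I`, and `s_{J,K,…}` is `s_{J ∪ K ∪ …}`. In
`[B₁, …, B_{m-1}]` the first block is `B₁ = (l₁, r₁)`, and `β` is the list `B₂, …, B_{m-1}`.
The state `l₁` never occurs in a constraint, and it may be off shell. -/

/-- `r_{m-1}`. -/
def lastRight (r₁ : Particle k a) (β : List (Block k a)) : Particle k a :=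
  match β.getLast? with
  | none => r₁
  | some B => B.right

/-- `C₁[[(l₁, r₁), β], q]`, where `q` is the momentum of a set of particles. The variable
`s_{q,l₁}`, which the definition of `C₁` excludes, has been left out from the start. -/
def C1 (r₁ : Particle k a) (β : List (Block k a)) (q : Finset (Particle k a)) :
    Set (Finset (Particle k a)) :=
  ({insert r₁ q} ∪
    {I | ∃ B ∈ β, I = insert B.left q ∨ I = insert B.right q ∨
      ∃ D ∈ B.sub, I = q ∪ D.particles}) \ {insert (lastRight r₁ β) q}

/-- `C₂[[(l₁, r₁), β], (L, r)]`. -/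
def C2 (β : List (Block k a)) (r : Particle k a) : Set (Finset (Particle k a)) :=
  {I | ∃ B ∈ β, I = insert r B.particles}

/-- `C₃ᵃ[B]` for the block `B = (f j, sub, af j)`. -/
def C3a (j : Fin k) (sub : List (Block k a)) : Set (Finset (Particle k a)) :=
  {{.f j, .af j}} ∪ {I | ∃ D ∈ sub.dropLast, I = insert (.af j) D.particles}

/-- `C₃ᵇ[[(l₁, r₁), β], B]` for a block `B` with the sub-blocks `sub`. -/
def C3b (β sub : List (Block k a)) : Set (Finset (Particle k a)) :=
  {I | ∃ B ∈ β, ∃ D ∈ sub, I = B.particles ∪ D.particles}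

/-- The constraints that are added when the blocks of a sequence are appended, one after the
other, to the ordering `[(l₁, r₁), β]`. For a block `(f j, sub, af j)` with sub-blocks they include
those of the ordering `[(-L, f j), sub]`, where `L` is the total momentum of the block without
`af j`. -/
def softConstraints (r₁ : Particle k a) (β : List (Block k a)) :
    Blocks k a → Set (Finset (Particle k a))
  | .nil => ∅
  | .adj g rest =>
      C1 r₁ β {.adj g} ∪ softConstraints r₁ (β ++ [.adj g]) rest
  | .pair j .nil rest =>
      C1 r₁ β (Block.pair j .nil).particles ∪ C2 β (.af j) ∪
        softConstraints r₁ (β ++ [.pair j .nil]) rest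
  | .pair j sub rest =>
      C1 r₁ β (Block.pair j sub).particles ∪ C2 β (.af j) ∪
        (C3a j sub.toList ∪ C3b β sub.toList) ∪ softConstraints (.f j) [] sub ∪
        softConstraints r₁ (β ++ [.pair j sub]) rest

/-- The constraints `H_n[α]`. -/
def MeliaOrdering.H (α : MeliaOrdering k a) : Set (Finset (Particle k a)) :=
  softConstraints (.af α.first) [] α.rest

/-! ### The extra constraints `H_n^A[α]` -/

/-- The particles `u, …, v-` (or `v, …, u-`) on one side of the diagonal `(u, v)` of the polygon
dual to `α`: the one that comes first is included, the other one is not. -/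
def MeliaOrdering.segment (α : MeliaOrdering k a) (u v : Particle k a) :
    Finset (Particle k a) :=
  Finset.univ.filter fun p =>
    min (α.word.idxOf u) (α.word.idxOf v) ≤ α.word.idxOf p ∧
      α.word.idxOf p < max (α.word.idxOf u) (α.word.idxOf v)

/-- The flavour lines that the diagonal `(u, v)` crosses: those of the pairs which it separates. -/
def MeliaOrdering.crossed (α : MeliaOrdering k a) (u v : Particle k a) : Finset (Fin k) :=
  Finset.univ.filter fun r => charge (α.segment u v) r ≠ 0

/-- The constraints `H_n^A[α]`: `s_{B,B'}` for disjoint (sub-)blocks such that the diagonal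
`(l_B, l_{B'})` crosses at least two flavour lines, and `s_{B,r_{B'}}` for (sub-)blocks `B` and
`B'` (the latter a pair `j`, and `B` disjoint from it or inside it) such that the diagonal
`(l_B, r_{B'})` crosses a flavour line other than that of `B'`. -/
def MeliaOrdering.HA (α : MeliaOrdering k a) : Set (Finset (Particle k a)) :=
  {I | ∃ B ∈ α.rest.all, ∃ B' ∈ α.rest.all, Disjoint B.particles B'.particles ∧
      2 ≤ (α.crossed B.left B'.left).card ∧ I = B.particles ∪ B'.particles} ∪
  {I | ∃ B ∈ α.rest.all, ∃ (j : Fin k) (sub : Blocks k a), Block.pair j sub ∈ α.rest.all ∧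
      (Disjoint B.particles (Block.pair j sub).particles ∨
        B.particles ⊂ (Block.pair j sub).particles) ∧
      (∃ r ∈ α.crossed B.left (.af j), r ≠ j) ∧ I = insert (.af j) B.particles}

/-- The subspace `H_n^T[α]` of `K_n^k`, cut out by the constraints `H_n[α] ∪ H_n^A[α]`. -/
def MeliaOrdering.HT (α : MeliaOrdering k a) (b c : Mandelstam k a) :
    AffineSubspace ℝ (Mandelstam k a) :=
  kinSpace b ⊓ constraintSpace (α.H ∪ α.HA) c

theorem MeliaOrdering.HT_le (α : MeliaOrdering k a) (b c : Mandelstam k a) :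
    α.HT b c ≤ kinSpace b := inf_le_left

/-! ### Differential forms -/

/-- The values at a point of the differential forms on an affine space `A`: the exterior algebra
of the cotangent space. -/
abbrev Forms (A : AffineSubspace ℝ (Mandelstam k a)) :=
  ExteriorAlgebra ℝ (Module.Dual ℝ A.direction)

/-- `ds_I` on `A`. -/
def ds (A : AffineSubspace ℝ (Mandelstam k a)) (I : Finset (Particle k a)) :
    Module.Dual ℝ A.direction :=
  (LinearMap.proj I : Mandelstam k a →ₗ[ℝ] ℝ) ∘ₗ A.direction.subtype

/-- The pullback of forms to an affine subspace. -/
def pullback {A B : AffineSubspace ℝ (Mandelstam k a)} (h : B ≤ A) : Forms A →ₐ[ℝ] Forms B :=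
  ExteriorAlgebra.map (Submodule.inclusion (AffineSubspace.direction_le h)).dualMap

/-! ### Cubic graphs -/

/-- Plane binary trees with leaves labelled by particles. Such a tree, together with one more
external leg attached to its root, is a pair `(g|κ)` of a cubic graph `g` drawn in the plane and
the (cyclic) ordering `κ` of its external legs, written so that it starts with the extra leg. -/
inductive PlaneTree (k a : ℕ)
  | leaf (p : Particle k a)
  | node (l r : PlaneTree k a)

namespace PlaneTree

/-- The leaves from left to right. -/
def leaves : PlaneTree k a → List (Particle k a)
  | leaf p => [p]
  | node l r => l.leaves ++ r.leaves

/-- The set of leaves. -/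
def leafSet (t : PlaneTree k a) : Finset (Particle k a) := t.leaves.toFinset

/-- The channels of the internal edges of the tree, and of its root edge if this is not a leaf. -/
def channels : PlaneTree k a → Finset (Finset (Particle k a))
  | leaf _ => ∅
  | node l r => insert (node l r).leafSet (l.channels ∪ r.channels)

/-- The propagators of the graph. They determine the graph. -/
def props : PlaneTree k a → Finset (Finset (Particle k a))
  | leaf _ => ∅
  | node l r => l.channels ∪ r.channels

/-- The tree, with the leg `root` attached to its root, has every particle as a leg exactly
once. -/
def IsGraph (root : Particle k a) (t : PlaneTree k a) : Prop :=
  (root :: t.leaves).Nodup ∧ ∀ p, p ∈ root :: t.leaves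

/-- `Flips t t' m`: the tree `t'` is obtained from `t` by flipping `m` of its vertices. -/
inductive Flips : PlaneTree k a → PlaneTree k a → ℕ → Prop
  | leaf (p : Particle k a) : Flips (leaf p) (leaf p) 0
  | keep {l l' r r' : PlaneTree k a} {i j : ℕ} (hl : Flips l l' i) (hr : Flips r r' j) :
      Flips (node l r) (node l' r') (i + j)
  | flip {l l' r r' : PlaneTree k a} {i j : ℕ} (hl : Flips l l' i) (hr : Flips r r' j) :
      Flips (node l r) (node r' l') (i + j + 1)

/-- `Mutation t t' S T`: the tree `t'` has the same ordering as `t` and is obtained from it by a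
mutation, which replaces the propagator `S` by `T`. -/
inductive Mutation : PlaneTree k a → PlaneTree k a →
    Finset (Particle k a) → Finset (Particle k a) → Prop
  | rotate (x y z : PlaneTree k a) :
      Mutation (node (node x y) z) (node x (node y z)) (node x y).leafSet (node y z).leafSet
  | left {l l' : PlaneTree k a} {S T : Finset (Particle k a)} (r : PlaneTree k a)
      (h : Mutation l l' S T) : Mutation (node l r) (node l' r) S T
  | right {r r' : PlaneTree k a} {S T : Finset (Particle k a)} (l : PlaneTree k a)
      (h : Mutation r r' S T) : Mutation (node l r) (node l r') S T

/-- The number of pairs `(p, q)`, `p` from the first list and `q` from the second, in the wrong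
order. -/
def inversions (u v : List (Particle k a)) : ℕ :=
  (u.map fun p => v.countP fun q => decide (q.code < p.code)).sum

/-- The contribution of a vertex to `sign(g|κ)`. -/
def vertexSign (l r : PlaneTree k a) : ℝ :=
  (-1) ^ (inversions l.leaves r.leaves + l.leaves.length + 1)

section

variable {M : Type*} [AddCommGroup M] [Module ℝ M]

/-- The wedge product of the one-forms `e I`, for all the channels of the tree in pre-order, with
its sign. -/
def branchForm (e : Finset (Particle k a) → M) : PlaneTree k a → ExteriorAlgebra ℝ M
  | leaf _ => 1
  | node l r => vertexSign l r •
      (ExteriorAlgebra.ι ℝ (e (node l r).leafSet) * (l.branchForm e * r.branchForm e))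

/-- The wedge product of the one-forms `e I`, for all the propagators of the graph, multiplied by
`sign(g|κ)`. -/
def graphForm (e : Finset (Particle k a) → M) : PlaneTree k a → ExteriorAlgebra ℝ M
  | leaf _ => 1
  | node l r => vertexSign l r • (l.branchForm e * r.branchForm e)

theorem neg_one_pow_of_even {m n : ℕ} (h : Even (m + n)) : (-1 : ℝ) ^ m = (-1) ^ n := by
  rcases Nat.even_or_odd n with hn | hn
  · rw [hn.neg_one_pow, ((Nat.even_add.mp h).mpr hn).neg_one_pow]
  · have hm : Odd m := by
      rw [← Nat.not_even_iff_odd] at hn ⊢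
      exact fun hm => hn ((Nat.even_add.mp h).mp hm)
    rw [hn.neg_one_pow, hm.neg_one_pow]

theorem Flips.perm {t t' : PlaneTree k a} {m : ℕ} (h : Flips t t' m) :
    t'.leaves.Perm t.leaves := by
  induction h with
  | leaf p => exact List.Perm.refl _
  | keep hl hr il ir => exact il.append ir
  | flip hl hr il ir => exact List.perm_append_comm.trans (il.append ir)

theorem inversions_perm {u u' v v' : List (Particle k a)} (hu : u'.Perm u) (hv : v'.Perm v) :
    inversions u' v' = inversions u v := by
  unfold inversions
  rw [(hu.map _).sum_eq]
  simp only [hv.countP_eq]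

theorem inversions_swap {u v : List (Particle k a)} (h : List.Disjoint u v) :
    inversions u v + inversions v u = u.length * v.length := by
  induction u with
  | nil => simp [inversions]
  | cons p u ih =>
    have ih := ih (fun x hx => h (List.mem_cons_of_mem _ hx))
    have hp : p ∉ v := h List.mem_cons_self
    have h1 : inversions (p :: u) v =
        v.countP (fun q => decide (q.code < p.code)) + inversions u v := by
      simp [inversions]
    have h2 : ∀ w : List (Particle k a), p ∉ w → inversions w (p :: u) +
        w.countP (fun q => decide (q.code < p.code)) = w.length + inversions w u := by
      intro w hw
      induction w with
      | nil => simp [inversions]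
      | cons q w iw =>
        have iw := iw (fun hx => hw (List.mem_cons_of_mem _ hx))
        have hne : p.code ≠ q.code := fun hh =>
          hw (by rw [Particle.code_injective hh]; exact List.mem_cons_self)
        have h4 : inversions (q :: w) (p :: u) =
            (u.countP (fun x => decide (x.code < q.code)) + if p.code < q.code then 1 else 0) +
              inversions w (p :: u) := by
          simp [inversions, List.countP_cons]
        have h5 : inversions (q :: w) u =
            u.countP (fun x => decide (x.code < q.code)) + inversions w u := by
          simp [inversions]
        rw [h4, h5, List.countP_cons, List.length_cons]
        rcases lt_or_gt_of_ne hne with hlt | hlt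
        · simp [hlt, not_lt.mpr hlt.le]; omega
        · simp [hlt, not_lt.mpr hlt.le]; omega
    have h3 := h2 v hp
    rw [h1, List.length_cons, Nat.succ_mul]
    omega

theorem vertexSign_flips {l l' r r' : PlaneTree k a} {i j : ℕ} (hl : Flips l l' i)
    (hr : Flips r r' j) : vertexSign l' r' = vertexSign l r := by
  unfold vertexSign
  rw [inversions_perm hl.perm hr.perm, hl.perm.length_eq]

theorem vertexSign_swap {l r : PlaneTree k a} (h : List.Disjoint l.leaves r.leaves) :
    vertexSign r l * (-1) ^ ((l.leaves.length + 1) * (r.leaves.length + 1)) =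
      - vertexSign l r := by
  unfold vertexSign
  have hs := inversions_swap h
  rw [← pow_add, ← neg_one_mul ((-1 : ℝ) ^ _), ← pow_succ']
  apply neg_one_pow_of_even
  generalize inversions l.leaves r.leaves = x at *
  generalize inversions r.leaves l.leaves = y at *
  generalize l.leaves.length = p at *
  generalize r.leaves.length = q at *
  have : y + q + 1 + (p + 1) * (q + 1) + (x + p + 1 + 1) = 2 * (p * q + p + q + 2) := by
    linear_combination hs
  exact ⟨p * q + p + q + 2, by rw [this]; ring⟩

theorem branchForm_mul_ι (e : Finset (Particle k a) → M) (t : PlaneTree k a) (v : M) :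
    t.branchForm e * ExteriorAlgebra.ι ℝ v =
      (-1 : ℝ) ^ (t.leaves.length + 1) • (ExteriorAlgebra.ι ℝ v * t.branchForm e) := by
  induction t with
  | leaf p => simp [branchForm, leaves]
  | node l r hl hr =>
    simp only [branchForm, smul_mul_assoc, mul_smul_comm, leaves, List.length_append]
    rw [mul_assoc, mul_assoc, hr, mul_smul_comm, ← mul_assoc (l.branchForm e), hl,
      smul_mul_assoc, ← mul_assoc, ← mul_assoc, mul_smul_comm, mul_smul_comm]
    have hc : ExteriorAlgebra.ι ℝ (e (node l r).leafSet) * ExteriorAlgebra.ι ℝ v =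
        - (ExteriorAlgebra.ι ℝ v * ExteriorAlgebra.ι ℝ (e (node l r).leafSet)) :=
      eq_neg_of_add_eq_zero_left (ExteriorAlgebra.ι_add_mul_swap _ _)
    simp only [← mul_assoc]
    rw [hc]
    simp only [neg_mul, smul_neg, ← smul_assoc, smul_eq_mul, mul_assoc, pow_add, pow_one]
    rw [← neg_smul]
    congr 1
    ring

theorem branchForm_comm (e : Finset (Particle k a) → M) (l r : PlaneTree k a) :
    l.branchForm e * r.branchForm e =
      (-1 : ℝ) ^ ((l.leaves.length + 1) * (r.leaves.length + 1)) •
        (r.branchForm e * l.branchForm e) := by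
  induction r with
  | leaf p =>
    have h : Even ((l.leaves.length + 1) * ([p].length + 1)) := by simp
    simp only [branchForm, leaves, h.neg_one_pow, one_smul, mul_one, one_mul]
  | node x y hx hy =>
    simp only [branchForm, smul_mul_assoc, mul_smul_comm, leaves, List.length_append]
    rw [← mul_assoc, branchForm_mul_ι, smul_mul_assoc, mul_assoc, ← mul_assoc (l.branchForm e), hx,
      smul_mul_assoc, mul_assoc (x.branchForm e), hy]
    simp only [mul_smul_comm, ← smul_assoc, smul_eq_mul, mul_assoc]
    congr 1
    rw [← pow_add, ← pow_add, mul_comm]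
    congr 1
    apply neg_one_pow_of_even
    generalize l.leaves.length = p
    generalize x.leaves.length = q
    generalize y.leaves.length = s
    exact ⟨(p + 1) * (q + s + 2), by ring⟩

theorem branchForm_flips (e : Finset (Particle k a) → M) {t t' : PlaneTree k a} {m : ℕ}
    (h : Flips t t' m) (ht : t.leaves.Nodup) :
    t'.branchForm e = (-1 : ℝ) ^ m • t.branchForm e := by
  induction h with
  | leaf p => simp
  | @keep l l' r r' i j hl hr il ir =>
    have hd := List.nodup_append'.mp ht
    have hs : (node l' r').leafSet = (node l r).leafSet :=
      List.toFinset_eq_of_perm _ _ (Flips.keep hl hr).perm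
    simp only [branchForm, hs, vertexSign_flips hl hr, il hd.1, ir hd.2.1, smul_mul_assoc,
      mul_smul_comm, ← smul_assoc, smul_eq_mul]
    congr 1
    ring
  | @flip l l' r r' i j hl hr il ir =>
    have hd := List.nodup_append'.mp ht
    have hs : (node r' l').leafSet = (node l r).leafSet :=
      List.toFinset_eq_of_perm _ _ (Flips.flip hl hr).perm
    simp only [branchForm, hs, vertexSign_flips hr hl, il hd.1, ir hd.2.1, smul_mul_assoc,
      mul_smul_comm, ← smul_assoc, smul_eq_mul]
    have hc := branchForm_comm e r l
    rw [hc, mul_smul_comm, ← smul_assoc, smul_eq_mul]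
    congr 1
    have hv := vertexSign_swap hd.2.2
    rw [mul_comm (r.leaves.length + 1)]
    linear_combination (-1) ^ i * (-1) ^ j * hv

/-- A vertex flip changes the sign of `W(g|κ)`. -/
theorem graphForm_flips (e : Finset (Particle k a) → M) {t t' : PlaneTree k a} {m : ℕ}
    (h : Flips t t' m) (ht : t.leaves.Nodup) :
    t'.graphForm e = (-1 : ℝ) ^ m • t.graphForm e := by
  cases h with
  | leaf p => simp
  | @keep l l' r r' i j hl hr =>
    have hd := List.nodup_append'.mp ht
    simp only [graphForm, vertexSign_flips hl hr, branchForm_flips e hl hd.1,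
      branchForm_flips e hr hd.2.1, smul_mul_assoc, mul_smul_comm, ← smul_assoc, smul_eq_mul]
    congr 1
    ring
  | @flip l l' r r' i j hl hr =>
    have hd := List.nodup_append'.mp ht
    simp only [graphForm, vertexSign_flips hr hl, branchForm_flips e hl hd.1,
      branchForm_flips e hr hd.2.1, smul_mul_assoc, mul_smul_comm, ← smul_assoc, smul_eq_mul]
    rw [branchForm_comm e r l, ← smul_assoc, smul_eq_mul]
    congr 1
    have hv := vertexSign_swap hd.2.2
    rw [mul_comm (r.leaves.length + 1)]
    linear_combination (-1) ^ i * (-1) ^ j * hv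

theorem Mutation.leaves_eq {t t' : PlaneTree k a} {S T : Finset (Particle k a)}
    (h : Mutation t t' S T) : t'.leaves = t.leaves := by
  induction h with
  | rotate x y z => simp [leaves]
  | left r h ih => simp [leaves, ih]
  | right l h ih => simp [leaves, ih]

theorem inversions_append_left (u v w : List (Particle k a)) :
    inversions (u ++ v) w = inversions u w + inversions v w := by
  simp [inversions]

theorem inversions_append_right (u v w : List (Particle k a)) :
    inversions u (v ++ w) = inversions u v + inversions u w := by
  simp [inversions, List.sum_map_add]

theorem rotate_aux (e : Finset (Particle k a) → M) (x y z : PlaneTree k a) :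
    ∃ p q : ExteriorAlgebra ℝ M,
      (node (node x y) z).graphForm e = p * ExteriorAlgebra.ι ℝ (e (node x y).leafSet) * q ∧
      (node x (node y z)).graphForm e =
        -(p * ExteriorAlgebra.ι ℝ (e (node y z).leafSet) * q) := by
  refine ⟨1, (vertexSign (node x y) z * vertexSign x y) •
    (x.branchForm e * y.branchForm e * z.branchForm e), ?_, ?_⟩
  · simp only [graphForm, branchForm, one_mul, smul_mul_assoc, mul_smul_comm, ← smul_assoc,
      smul_eq_mul, mul_assoc]
  · simp only [graphForm, branchForm, one_mul, mul_smul_comm, ← smul_assoc, smul_eq_mul]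
    rw [← mul_assoc (x.branchForm e), branchForm_mul_ι, smul_mul_assoc, ← smul_assoc, ← neg_smul,
      mul_assoc (ExteriorAlgebra.ι ℝ _), mul_assoc (x.branchForm e)]
    congr 1
    simp only [vertexSign, leaves, inversions_append_left, inversions_append_right,
      List.length_append, smul_eq_mul]
    rw [← pow_add, ← pow_add, ← pow_add, ← neg_one_mul ((-1 : ℝ) ^ _), ← pow_succ']
    apply neg_one_pow_of_even
    exact ⟨inversions x.leaves y.leaves + inversions x.leaves z.leaves +
      inversions y.leaves z.leaves + 2 * x.leaves.length + y.leaves.length + 3, by ring⟩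

theorem branchForm_mutation (e : Finset (Particle k a) → M) {t t' : PlaneTree k a}
    {S T : Finset (Particle k a)} (h : Mutation t t' S T) :
    ∃ x y : ExteriorAlgebra ℝ M, t.branchForm e = x * ExteriorAlgebra.ι ℝ (e S) * y ∧
      t'.branchForm e = -(x * ExteriorAlgebra.ι ℝ (e T) * y) := by
  induction h with
  | rotate x y z =>
    obtain ⟨p, q, h1, h2⟩ := rotate_aux e x y z
    have hs : (node x (node y z)).leafSet = (node (node x y) z).leafSet := by
      simp [leafSet, leaves]
    refine ⟨ExteriorAlgebra.ι ℝ (e (node (node x y) z).leafSet) * p, q, ?_, ?_⟩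
    · rw [branchForm, ← mul_smul_comm, ← graphForm, h1]; simp only [mul_assoc]
    · rw [branchForm, ← mul_smul_comm, ← graphForm, h2, hs]; simp only [mul_assoc, mul_neg]
  | @left l l' S T r h ih =>
    obtain ⟨p, q, h1, h2⟩ := ih
    have hs : (node l' r).leafSet = (node l r).leafSet := by
      simp [leafSet, leaves, h.leaves_eq]
    refine ⟨vertexSign l r • (ExteriorAlgebra.ι ℝ (e (node l r).leafSet) * p),
      q * r.branchForm e, ?_, ?_⟩
    · simp only [branchForm, h1, smul_mul_assoc, mul_assoc]
    · have hv : vertexSign l' r = vertexSign l r := by simp [vertexSign, h.leaves_eq]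
      simp only [branchForm, h2, hs, hv, smul_mul_assoc, mul_assoc, mul_neg, neg_mul, smul_neg]
  | @right r r' S T l h ih =>
    obtain ⟨p, q, h1, h2⟩ := ih
    have hs : (node l r').leafSet = (node l r).leafSet := by
      simp [leafSet, leaves, h.leaves_eq]
    refine ⟨vertexSign l r • (ExteriorAlgebra.ι ℝ (e (node l r).leafSet) *
      (l.branchForm e * p)), q, ?_, ?_⟩
    · simp only [branchForm, h1, smul_mul_assoc, mul_assoc]
    · have hv : vertexSign l r' = vertexSign l r := by simp [vertexSign, h.leaves_eq]
      simp only [branchForm, h2, hs, hv, smul_mul_assoc, mul_assoc, mul_neg, smul_neg]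

/-- A mutation replaces a factor `dS` of `W(g|κ)` by `dT` and changes the sign. -/
theorem graphForm_mutation (e : Finset (Particle k a) → M) {t t' : PlaneTree k a}
    {S T : Finset (Particle k a)} (h : Mutation t t' S T) :
    ∃ x y : ExteriorAlgebra ℝ M, t.graphForm e = x * ExteriorAlgebra.ι ℝ (e S) * y ∧
      t'.graphForm e = -(x * ExteriorAlgebra.ι ℝ (e T) * y) := by
  cases h with
  | rotate x y z => exact rotate_aux e x y z
  | @left l l' S T r h =>
    obtain ⟨p, q, h1, h2⟩ := branchForm_mutation e h
    have hv : vertexSign l' r = vertexSign l r := by simp [vertexSign, h.leaves_eq]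
    refine ⟨vertexSign l r • p, q * r.branchForm e, ?_, ?_⟩
    · simp only [graphForm, h1, smul_mul_assoc, mul_assoc]
    · simp only [graphForm, h2, hv, smul_mul_assoc, mul_assoc, neg_mul, smul_neg]
  | @right r r' S T l h =>
    obtain ⟨p, q, h1, h2⟩ := branchForm_mutation e h
    have hv : vertexSign l r' = vertexSign l r := by simp [vertexSign, h.leaves_eq]
    refine ⟨vertexSign l r • (l.branchForm e * p), q, ?_, ?_⟩
    · simp only [graphForm, h1, smul_mul_assoc, mul_assoc]
    · simp only [graphForm, h2, hv, smul_mul_assoc, mul_assoc, mul_neg, smul_neg]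

end

/-- The differential `W(g|κ)` on `A`. -/
def W (A : AffineSubspace ℝ (Mandelstam k a)) (t : PlaneTree k a) : Forms A :=
  t.graphForm (ds A)

/-- `N` is a kinematic numerator: for every graph and every ordering compatible with it a function
`N(g|κ)` on `K_n^k`, with values in a vector space `V`, that changes sign under vertex flips. -/
def IsNumerator {V : Type*} [AddCommGroup V] [Module ℝ V] (root : Particle k a)
    (b : Mandelstam k a) (N : PlaneTree k a → Mandelstam k a → V) : Prop :=
  ∀ (t t' : PlaneTree k a) (m : ℕ), t.IsGraph root → Flips t t' m →
    ∀ x ∈ kinSpace b, N t' x = (-1 : ℝ) ^ m • N t x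

end PlaneTree

open Classical in
/-- All cubic graphs with the given particles as external legs, as sets of propagators. The
channel of a propagator is the side that does not contain `root`. -/
def cubicGraphs (root : Particle k a) : Finset (Finset (Finset (Particle k a))) :=
  Finset.univ.filter fun g => ∃ t : PlaneTree k a, t.IsGraph root ∧ t.props = g

/-- A choice, for every cubic graph `g`, of an ordering `α_g` that is compatible with it. -/
def IsOrderingChoice (root : Particle k a)
    (t : Finset (Finset (Particle k a)) → PlaneTree k a) : Prop :=
  ∀ g ∈ cubicGraphs root, (t g).IsGraph root ∧ (t g).props = g

/-- `∏_{I ∈ g} ϑ_I / s_I` at the point `x`. -/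
def propagators (g : Finset (Finset (Particle k a))) (x : Mandelstam k a) : ℝ :=
  ∏ I ∈ g, theta I / x I

open scoped TensorProduct

/-- The scattering form `∑_g N(g|α_g) W(g|α_g) ∏_{I ∈ g} ϑ_I / s_I` on `A` at the point `x`. -/
def scatteringForm {V : Type*} [AddCommGroup V] [Module ℝ V] (root : Particle k a)
    (A : AffineSubspace ℝ (Mandelstam k a))
    (t : Finset (Finset (Particle k a)) → PlaneTree k a)
    (N : PlaneTree k a → Mandelstam k a → V) (x : Mandelstam k a) : V ⊗[ℝ] Forms A :=
  ∑ g ∈ cubicGraphs root, (propagators g x • N (t g) x) ⊗ₜ[ℝ] (t g).W A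

/-- The tree `t`, with the first particle of `α` attached to its root, is drawn in the plane with
the ordering `α` of its legs. -/
def MeliaOrdering.Draws (α : MeliaOrdering k a) (t : PlaneTree k a) : Prop :=
  α.root :: t.leaves = α.word

open Classical in
/-- The colour-ordered amplitude `M_n[N;α] = ∑_g N(g|α) ∏_{I ∈ g} ϑ_I / s_I` at the point `x`, the
sum being over the cubic graphs that are compatible with `α`. -/
def MeliaOrdering.amplitude {V : Type*} [AddCommGroup V] [Module ℝ V] (α : MeliaOrdering k a)
    (N : PlaneTree k a → Mandelstam k a → V) (x : Mandelstam k a) : V :=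
  ∑ g ∈ cubicGraphs α.root,
    if h : ∃ t : PlaneTree k a, α.Draws t ∧ t.props = g then propagators g x • N h.choose x else 0

/-- The channel `I` is planar with respect to `α`. -/
def MeliaOrdering.IsPlanar (α : MeliaOrdering k a) (I : Finset (Particle k a)) : Prop :=
  ∃ u : List (Particle k a), u <:+: α.word ∧ I = u.toFinset

/-- `dV` is a volume form, of degree `n - 3`, in the differentials of the `α`-planar Mandelstam
variables on `H_n^T[α]`, that is, the wedge product of a basis of their span. -/
def MeliaOrdering.IsVolumeForm (α : MeliaOrdering k a) (b c : Mandelstam k a)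
    (dV : Forms (α.HT b c)) : Prop :=
  ∃ e : Fin (2 * k + a - 3) → Module.Dual ℝ (α.HT b c).direction,
    LinearIndependent ℝ e ∧
    Submodule.span ℝ (Set.range e) = Submodule.span ℝ (ds (α.HT b c) '' {I | α.IsPlanar I}) ∧
    dV = ExteriorAlgebra.ιMulti ℝ (2 * k + a - 3) e

end BiColour

end

open BiColour
open scoped TensorProduct

open scoped BigOperators

noncomputable section

set_option linter.unusedSectionVars false

namespace BiColour

variable {k a : ℕ}

/-! ### Words of blocks -/

/-! The relations of kinematic space say that the polarization ds_{X∪Y} - ds_X - ds_Y (`polar`)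
behaves like 2 p_X·p_Y: it is additive as long as one of the three sets involved is neutral and the
others, with their union, are allowed. `Soft` isolates this property, together with the vanishing on
sets of at most one element and on the constraints; most of the argument concerns an arbitrary
`Soft` family of vectors.

The recursively defined constraints H ∪ H^A have a description by positions in α alone (`Cons`,
`mem_constraints_iff`). They concern two disjoint blocks that are not siblings, a block and a
particle that are not adjacent, or the non-adjacent ends of a pair. What is left free is one planar
channel for every two consecutive positions, with differential `gapVec`. Cutting neutral intervals
into blocks, and blocks into ends and interior, gives by induction on the length
(`Soft.link_bal_lt`, `Soft.spanLT`): the vector of a neutral interval lies in the span `E` of the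
gaps inside it, and the polarization of two disjoint neutral intervals is, modulo the gaps inside
them, the vector of the gap between them if they touch, and zero otherwise (`Link`).

This decides the wedge products vertex by vertex (`branchForm_node_mul`). Where branches L and R
meet, ds_{L∪R} = ds_L + ds_R + polarization; the wedge product of L annihilates ds_L and that of R
annihilates ds_R, and likewise the gaps inside them. If L and R are neighbours, only the gap between
them survives, so a planar branch yields, up to sign, the wedge product `Z` of all its gaps; the
signs combine to the parity of the ordering of the leaves and are the same for all graphs drawn with
α (`drawn_value`). If L and R are not neighbours, the product vanishes (`Branch.vanish`).

Flavour complicates this. The polarization is not additive for three charged sets, so a branch with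
the flavour of some f_j is controlled only after multiplication by the gaps up to its partner. Its
polarization with later channels is computed from the way it is built from f_j by attaching neutral
branches (`Comb`, `Comb.polar_mem`). The branch with all particles but the root has the flavour of
r₁ and is treated in the same way.

The gaps are independent because of an explicit model s_I = ∑ x_{pq} over pairs in I, in which the
relations hold without any condition. Every constraint and every gap has a leading pair, and the
resulting system is triangular, so the values on the gaps can be prescribed (`exists_soft`). On H^T
the vector of all particles but the root vanishes; this expresses the first gap by the n - 3 others,
whose wedge product is the volume form. The same vanishing makes the form of the whole branch
useless for the graph, so the factor is divided out in an enlarged model where it does not vanish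
(`Soft.graphForm_eq`). Finally, numerators and graph forms change by the same sign under flips,
which gives the amplitude term by term. -/

/-- The sequence of particles of a block. -/
def Block.word : Block k a → List (Particle k a)
  | .adj g => [.adj g]
  | .pair j sub => .f j :: (sub.word ++ [.af j])

theorem Blocks.word_eq_flatMap (bs : Blocks k a) : bs.word = bs.toList.flatMap Block.word := by
  induction bs with
  | nil => rfl
  | adj g rest ih => simp [Blocks.word, Blocks.toList, Block.word, ih]
  | pair j sub rest _ ih => simp [Blocks.word, Blocks.toList, Block.word, ih]

theorem Block.mem_particles_iff (B : Block k a) (p : Particle k a) :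
    p ∈ B.particles ↔ p ∈ B.word := by
  cases B <;> simp [Block.particles, Block.word]
  tauto

theorem Blocks.toList_subset_all (bs : Blocks k a) : ∀ B ∈ bs.toList, B ∈ bs.all := by
  induction bs with
  | nil => simp [Blocks.toList]
  | adj g rest ih => simp only [Blocks.toList, Blocks.all, List.mem_cons]; grind
  | pair j sub rest _ ih => simp only [Blocks.toList, Blocks.all, List.mem_cons]; grind

theorem Blocks.sub_all_subset (bs : Blocks k a) {j : Fin k} {sub : Blocks k a}
    (h : Block.pair j sub ∈ bs.all) : ∀ B ∈ sub.all, B ∈ bs.all := by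
  induction bs with
  | nil => simp [Blocks.all] at h
  | adj g rest ih => simp only [Blocks.all, List.mem_cons] at *; grind
  | pair i s rest ih1 ih2 =>
    simp only [Blocks.all, List.mem_cons, List.mem_append] at *
    grind

theorem Blocks.exists_word_eq (bs : Blocks k a) {B : Block k a} (h : B ∈ bs.all) :
    ∃ x y, bs.word = x ++ (B.word ++ y) := by
  induction bs with
  | nil => simp [Blocks.all] at h
  | adj g rest ih =>
    simp only [Blocks.all, List.mem_cons] at h
    rcases h with rfl | h
    · exact ⟨[], rest.word, rfl⟩
    · obtain ⟨x, y, e⟩ := ih h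
      exact ⟨.adj g :: x, y, by simp [Blocks.word, e]⟩
  | pair j sub rest ih1 ih2 =>
    simp only [Blocks.all, List.mem_cons, List.mem_append] at h
    rcases h with rfl | h | h
    · exact ⟨[], rest.word, by simp [Blocks.word, Block.word]⟩
    · obtain ⟨x, y, e⟩ := ih1 h
      exact ⟨.f j :: x, y ++ .af j :: rest.word, by simp [Blocks.word, e]⟩
    · obtain ⟨x, y, e⟩ := ih2 h
      exact ⟨.f j :: (sub.word ++ .af j :: x), y, by simp [Blocks.word, e]⟩

theorem Blocks.f_mem_word_iff (bs : Blocks k a) (j : Fin k) :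
    Particle.f j ∈ bs.word ↔ Particle.af j ∈ bs.word := by
  induction bs with
  | nil => simp [Blocks.word]
  | adj g rest ih => simp [Blocks.word, ih]
  | pair i sub rest ih1 ih2 => simp [Blocks.word, ih1, ih2]; tauto

theorem Block.f_mem_word_iff (B : Block k a) (j : Fin k) :
    Particle.f j ∈ B.word ↔ Particle.af j ∈ B.word := by
  cases B with
  | adj g => simp [Block.word]
  | pair i sub => simp [Block.word, sub.f_mem_word_iff, or_comm]

theorem Blocks.exists_pair (bs : Blocks k a) {j : Fin k} (h : Particle.f j ∈ bs.word) :
    ∃ sub, Block.pair j sub ∈ bs.all := by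
  induction bs with
  | nil => simp [Blocks.word] at h
  | adj g rest ih =>
    simp only [Blocks.word, List.mem_cons, reduceCtorEq, false_or] at h
    obtain ⟨s, hs⟩ := ih h
    exact ⟨s, by simp [Blocks.all, hs]⟩
  | pair i sub rest ih1 ih2 =>
    simp only [Blocks.word, List.mem_cons, List.mem_append, reduceCtorEq, false_or,
      Particle.f.injEq] at h
    rcases h with rfl | h | h
    · exact ⟨sub, by simp [Blocks.all]⟩
    · obtain ⟨s, hs⟩ := ih1 h
      exact ⟨s, by simp [Blocks.all, hs]⟩
    · obtain ⟨s, hs⟩ := ih2 h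
      exact ⟨s, by simp [Blocks.all, hs]⟩

theorem Blocks.exists_adj (bs : Blocks k a) {g : Fin a} (h : Particle.adj g ∈ bs.word) :
    Block.adj g ∈ bs.all := by
  induction bs with
  | nil => simp [Blocks.word] at h
  | adj g' rest ih =>
    simp only [Blocks.word, List.mem_cons, Particle.adj.injEq] at h
    rcases h with rfl | h <;> simp [Blocks.all, *]
  | pair i sub rest ih1 ih2 =>
    simp only [Blocks.word, List.mem_cons, List.mem_append, reduceCtorEq, false_or] at h
    rcases h with h | h <;> simp [Blocks.all, *]

theorem Blocks.f_mem_of_pair (bs : Blocks k a) {j : Fin k} {sub : Blocks k a}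
    (h : Block.pair j sub ∈ bs.all) : Particle.f j ∈ bs.word := by
  obtain ⟨x, y, e⟩ := bs.exists_word_eq h
  simp [e, Block.word]

theorem Blocks.sub_unique (bs : Blocks k a) (hn : bs.word.Nodup) {j : Fin k} {s s' : Blocks k a}
    (h : Block.pair j s ∈ bs.all) (h' : Block.pair j s' ∈ bs.all) : s = s' := by
  induction bs with
  | nil => simp [Blocks.all] at h
  | adj g rest ih =>
    simp only [Blocks.all, List.mem_cons, reduceCtorEq, false_or] at h h'
    exact ih (List.nodup_cons.mp hn).2 h h'
  | pair i sub rest ih1 ih2 =>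
    simp only [Blocks.all, List.mem_cons, List.mem_append, Block.pair.injEq] at h h'
    simp only [Blocks.word, List.nodup_cons, List.nodup_append', List.mem_append, List.mem_cons,
      List.disjoint_cons_right] at hn
    have m1 : ∀ {s}, Block.pair j s ∈ sub.all → Particle.f j ∈ sub.word := sub.f_mem_of_pair
    have m2 : ∀ {s}, Block.pair j s ∈ rest.all → Particle.f j ∈ rest.word := rest.f_mem_of_pair
    have hd : Particle.f j ∈ sub.word → Particle.f j ∉ rest.word := fun x y => hn.2.2.2.2 x y
    rcases h with ⟨rfl, rfl⟩ | h | h <;> rcases h' with ⟨h1, h2⟩ | h' | h'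
    · exact h2.symm
    · exact absurd (m1 h') (by tauto)
    · exact absurd (m2 h') (by tauto)
    · exact absurd (m1 h) (by rw [h1]; tauto)
    · exact ih1 hn.2.1 h h'
    · exact absurd (m2 h') (hd (m1 h))
    · exact absurd (m2 h) (by rw [h1]; tauto)
    · exact absurd (m2 h) (hd (m1 h'))
    · exact ih2 hn.2.2.1.2 h h'

/-- The bridge from words to positions: in a word without repetitions a factor is an interval of
indices. Nesting and adjacency of blocks thereby become linear inequalities. -/
theorem idxOf_mem_infix {β : Type*} [DecidableEq β] {w x u y : List β} (hw : w.Nodup)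
    (h : w = x ++ (u ++ y)) {p : β} (hp : p ∈ w) :
    p ∈ u ↔ x.length ≤ w.idxOf p ∧ w.idxOf p < x.length + u.length := by
  subst h
  rw [List.nodup_append'] at hw
  obtain ⟨hx, huy, hd⟩ := hw
  rw [List.nodup_append'] at huy
  simp only [List.mem_append] at hp
  by_cases h1 : p ∈ x
  · have : p ∉ u := fun h2 => hd h1 (by simp [h2])
    rw [List.idxOf_append_of_mem h1]
    have := List.idxOf_lt_length_iff.mpr h1
    simp only [*, false_iff]
    omega
  · rw [List.idxOf_append_of_notMem h1]
    by_cases h2 : p ∈ u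
    · rw [List.idxOf_append_of_mem h2]
      have := List.idxOf_lt_length_iff.mpr h2
      simp only [h2, true_iff]; omega
    · rw [List.idxOf_append_of_notMem h2]
      simp only [h2, false_iff]; omega

theorem idxOf_append_cons {β : Type*} [DecidableEq β] {w x y : List β} {p : β} (hw : w.Nodup)
    (h : w = x ++ p :: y) : w.idxOf p = x.length := by
  have := (idxOf_mem_infix (u := [p]) hw (by simpa using h) (p := p) (by simp [h])).1 (by simp)
  simp at this
  omega

namespace MeliaOrdering
variable (α : MeliaOrdering k a)

/-! ### Positions -/

/-- The position of a particle in `α`. -/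
def pos (p : Particle k a) : ℕ := α.word.idxOf p

/-- The position of the left end of a pair. -/
def l (j : Fin k) : ℕ := α.pos (.f j)

/-- The position of the right end of a pair. -/
def r (j : Fin k) : ℕ := α.pos (.af j)

theorem word_nodup : α.word.Nodup := α.nodup

theorem mem_word (p : Particle k a) : p ∈ α.word := α.complete p

theorem length_word : α.word.length = 2 * k + a := by
  have h1 : α.word.toFinset = Finset.univ := by
    ext p; simp [α.mem_word]
  have h2 : Fintype.card (Particle k a) = 2 * k + a := by
    let e : Particle k a ≃ (Fin k ⊕ Fin k) ⊕ Fin a :=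
      { toFun := fun p => match p with
          | .f j => .inl (.inl j)
          | .af j => .inl (.inr j)
          | .adj g => .inr g
        invFun := fun p => match p with
          | .inl (.inl j) => .f j
          | .inl (.inr j) => .af j
          | .inr g => .adj g
        left_inv := by rintro (_ | _ | _) <;> rfl
        right_inv := by rintro ((_ | _) | _) <;> rfl }
    rw [Fintype.card_congr e]
    simp; ring
  rw [← h2, ← Finset.card_univ, ← h1, List.toFinset_card_of_nodup α.word_nodup]

theorem pos_lt (p : Particle k a) : α.pos p < 2 * k + a := by
  rw [← α.length_word]
  exact List.idxOf_lt_length_iff.mpr (α.mem_word p)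

theorem pos_inj {p q : Particle k a} : α.pos p = α.pos q ↔ p = q :=
  List.idxOf_inj (α.mem_word p)

theorem getElem_pos (p : Particle k a) :
    α.word[α.pos p]'(List.idxOf_lt_length_iff.mpr (α.mem_word p)) = p := List.getElem_idxOf _

theorem pos_getElem {i : ℕ} (h : i < α.word.length) : α.pos α.word[i] = i :=
  α.word_nodup.idxOf_getElem i h

theorem exists_pos {i : ℕ} (h : i < 2 * k + a) : ∃ p, α.pos p = i :=
  ⟨α.word[i]'(by rw [α.length_word]; exact h), α.pos_getElem _⟩

@[simp] theorem l_first : α.l α.first = 0 := by simp [l, pos, word]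

@[simp] theorem r_first : α.r α.first = 1 := by
  simp [r, pos, word]

theorem pos_root : α.pos α.root = 0 := α.l_first

theorem exists_pair {j : Fin k} (hj : j ≠ α.first) : ∃ sub, Block.pair j sub ∈ α.rest.all := by
  apply Blocks.exists_pair
  have := α.complete (.f j)
  simpa [hj] using this

theorem exists_adj (g : Fin a) : Block.adj g ∈ α.rest.all := by
  apply Blocks.exists_adj
  have := α.complete (.adj g)
  simpa using this

theorem rest_nodup : α.rest.word.Nodup :=
  (List.nodup_cons.mp (List.nodup_cons.mp α.nodup).2).2

theorem ne_first {j : Fin k} {sub : Blocks k a} (h : Block.pair j sub ∈ α.rest.all) :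
    j ≠ α.first := by
  rintro rfl
  have := α.nodup
  simp only [List.nodup_cons, List.mem_cons, reduceCtorEq, false_or] at this
  exact this.1 (Blocks.f_mem_of_pair _ h)

theorem sub_unique {j : Fin k} {s s' : Blocks k a} (h : Block.pair j s ∈ α.rest.all)
    (h' : Block.pair j s' ∈ α.rest.all) : s = s' :=
  α.rest.sub_unique α.rest_nodup h h'

theorem exists_word_eq {B : Block k a} (h : B ∈ α.rest.all) :
    ∃ x y, α.word = x ++ (B.word ++ y) := by
  obtain ⟨x, y, e⟩ := α.rest.exists_word_eq h
  exact ⟨.f α.first :: .af α.first :: x, y, by simp [word, e]⟩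

theorem mem_block_iff {B : Block k a} (h : B ∈ α.rest.all) (p : Particle k a) :
    p ∈ B.particles ↔ α.pos B.left ≤ α.pos p ∧ α.pos p ≤ α.pos B.right := by
  obtain ⟨x, y, e⟩ := α.exists_word_eq h
  rw [B.mem_particles_iff, idxOf_mem_infix α.word_nodup e (α.mem_word p)]
  have h1 : α.pos B.left = x.length := by
    cases B with
    | adj g => exact idxOf_append_cons α.word_nodup (by simpa [Block.word, Block.left] using e)
    | pair j sub =>
      exact idxOf_append_cons α.word_nodup (by simpa [Block.word, Block.left] using e)
  have h2 : α.pos B.right + 1 = x.length + B.word.length := by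
    cases B with
    | adj g =>
      simpa [Block.word, Block.left, Block.right] using h1
    | pair j sub =>
      have : α.pos (Block.pair j sub).right = (x ++ .f j :: sub.word).length :=
        idxOf_append_cons α.word_nodup (y := y) (by simpa [Block.word, Block.right] using e)
      rw [this]; simp [Block.word]; omega
  rw [h1]
  change _ ∧ α.pos p < _ ↔ _ ∧ α.pos p ≤ _
  change _ ≤ α.pos p ∧ _ ↔ _
  omega

theorem l_lt_r (j : Fin k) : α.l j < α.r j := by
  by_cases hj : j = α.first
  · simp [hj]
  · obtain ⟨s, hs⟩ := α.exists_pair hj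
    have h1 := (α.mem_block_iff hs (.f j)).1 (by simp [Block.particles])
    have h2 : α.l j ≠ α.r j := by simp [l, r, α.pos_inj]
    exact lt_of_le_of_ne h1.2 h2

/-- The interval `[x, y)` of positions contains with every particle of a pair the other one. -/
def Bal (x y : ℕ) : Prop := ∀ j, (x ≤ α.l j ∧ α.l j < y) ↔ (x ≤ α.r j ∧ α.r j < y)

/-- Pairs are nested like brackets and never cross. For the first pair this has to be checked
directly at the positions 0 and 1, since it is not a block of `rest`. -/
theorem bal_pair (j : Fin k) : α.Bal (α.l j) (α.r j + 1) := by
  intro i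
  by_cases hj : j = α.first
  · subst hj
    by_cases hi : i = α.first
    · subst hi; simp
    · have h1 : α.l i ≠ 0 := by
        rw [← α.l_first]; simpa [l, α.pos_inj] using hi
      have h2 : α.l i ≠ 1 := by
        rw [← α.r_first]; simp [l, r, α.pos_inj]
      have := α.l_lt_r i
      simp; omega
  · obtain ⟨s, hs⟩ := α.exists_pair hj
    have h1 := α.mem_block_iff hs (.f i)
    have h2 := α.mem_block_iff hs (.af i)
    rw [Block.mem_particles_iff] at h1 h2
    have h3 := Block.f_mem_word_iff (Block.pair j s) i
    simp only [Block.left, Block.right] at h1 h2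
    simp only [l, r]
    rw [h1, h2] at h3
    omega

theorem two_le_l {j : Fin k} (hj : j ≠ α.first) : 2 ≤ α.l j := by
  have h1 : α.l j ≠ 0 := by
    rw [← α.l_first]; simpa [l, α.pos_inj] using hj
  have h2 : α.l j ≠ 1 := by
    rw [← α.r_first]; simp [l, r, α.pos_inj]
  omega

theorem two_le_adj (g : Fin a) : 2 ≤ α.pos (.adj g) := by
  have h1 : α.pos (.adj g) ≠ 0 := by
    rw [← α.l_first]; simp [l, α.pos_inj]
  have h2 : α.pos (.adj g) ≠ 1 := by
    rw [← α.r_first]; simp [r, α.pos_inj]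
  omega

theorem l_inj {i j : Fin k} : α.l i = α.l j ↔ i = j := by simp [l, α.pos_inj]
theorem r_inj {i j : Fin k} : α.r i = α.r j ↔ i = j := by simp [r, α.pos_inj]
theorem l_ne_r (i j : Fin k) : α.l i ≠ α.r j := by simp [l, r, α.pos_inj]
theorem l_ne_adj (i : Fin k) (g : Fin a) : α.l i ≠ α.pos (.adj g) := by simp [l, α.pos_inj]
theorem r_ne_adj (i : Fin k) (g : Fin a) : α.r i ≠ α.pos (.adj g) := by simp [r, α.pos_inj]

/-- The particles at the positions in `[x, y)`. -/
def Iv (x y : ℕ) : Finset (Particle k a) := Finset.univ.filter fun p => x ≤ α.pos p ∧ α.pos p < y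

@[simp] theorem mem_Iv {x y : ℕ} {p : Particle k a} :
    p ∈ α.Iv x y ↔ x ≤ α.pos p ∧ α.pos p < y := by simp [Iv]

/-- One past the position of the last particle of the block that starts at `p`. -/
def endPos : Particle k a → ℕ
  | .f j => α.r j + 1
  | .af j => α.r j + 1
  | .adj g => α.pos (.adj g) + 1

/-- The block that starts at `p`. -/
def head (p : Particle k a) : Finset (Particle k a) := α.Iv (α.pos p) (α.endPos p)

/-- `p` is the first particle of a block. -/
def IsStart (p : Particle k a) : Prop := p ≠ α.root ∧ ∀ j, p ≠ .af j

/-- Blocks can follow `p` on its own level or one level below. -/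
def IsOpen (p : Particle k a) : Prop := p ≠ α.root ∧ ∀ j ≠ α.first, p ≠ .af j

/-- The constraints, in terms of positions. -/
inductive Cons : Finset (Particle k a) → Prop
  | apart {u v : Particle k a} (hu : α.IsStart u) (hv : α.IsStart v) (h : α.endPos u ≤ α.pos v)
      (hb : ¬ α.Bal (α.endPos u) (α.pos v)) : Cons (α.head u ∪ α.head v)
  | right {u : Particle k a} {j : Fin k} (hu : α.IsStart u) (hj : j ≠ α.first)
      (hn : Particle.af j ∉ α.head u) (h1 : α.endPos u ≠ α.r j) (h2 : α.pos u ≠ α.r j + 1) :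
      Cons (insert (.af j) (α.head u))
  | left {w u : Particle k a} (hw : α.IsOpen w) (hu : α.IsStart u) (h : α.pos w + 1 < α.pos u)
      (hb : (α.endPos w ≤ α.pos u ∧ α.Bal (α.endPos w) (α.pos u)) ∨
        α.Bal (α.pos w + 1) (α.pos u)) : Cons (insert w (α.head u))
  | pair {j : Fin k} (hj : j ≠ α.first) (h : α.r j ≠ α.l j + 1) : Cons {.f j, .af j}

theorem IsStart.isOpen {α : MeliaOrdering k a} {p : Particle k a} (h : α.IsStart p) :
    α.IsOpen p := ⟨h.1, fun j _ => h.2 j⟩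

theorem IsStart.cases {α : MeliaOrdering k a} {p : Particle k a} (h : α.IsStart p) :
    (∃ j, j ≠ α.first ∧ p = .f j) ∨ ∃ g, p = .adj g := by
  cases p with
  | f j => exact .inl ⟨j, fun e => h.1 (by rw [e]; rfl), rfl⟩
  | af j => exact absurd rfl (h.2 j)
  | adj g => exact .inr ⟨g, rfl⟩

theorem isStart_f {j : Fin k} (h : j ≠ α.first) : α.IsStart (.f j) :=
  ⟨by simpa [root] using h, by simp⟩

theorem isStart_adj (g : Fin a) : α.IsStart (.adj g) := ⟨by simp [root], by simp⟩

theorem IsStart.two_le {α : MeliaOrdering k a} {p : Particle k a} (h : α.IsStart p) :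
    2 ≤ α.pos p := by
  rcases h.cases with ⟨j, hj, rfl⟩ | ⟨g, rfl⟩
  · exact α.two_le_l hj
  · exact α.two_le_adj g

theorem pos_lt_endPos (p : Particle k a) : α.pos p < α.endPos p := by
  cases p with
  | f j => exact (α.l_lt_r j).trans (Nat.lt_succ_self _)
  | af j => exact Nat.lt_succ_self _
  | adj j => exact Nat.lt_succ_self _

theorem endPos_le (p : Particle k a) : α.endPos p ≤ 2 * k + a := by
  cases p with
  | f j => exact α.pos_lt (.af j)
  | af j => exact α.pos_lt _
  | adj j => exact α.pos_lt _

theorem IsStart.bal {α : MeliaOrdering k a} {p : Particle k a} (h : α.IsStart p) :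
    α.Bal (α.pos p) (α.endPos p) := by
  rcases h.cases with ⟨j, hj, rfl⟩ | ⟨g, rfl⟩
  · exact α.bal_pair j
  · intro i
    have h1 := α.l_ne_adj i g
    have h2 := α.r_ne_adj i g
    simp only [endPos]
    omega

variable {α}

theorem Bal.append {x y z : ℕ} (h1 : α.Bal x y) (h2 : α.Bal y z) (hxy : x ≤ y) (hyz : y ≤ z) :
    α.Bal x z := by
  intro j
  have := h1 j
  have := h2 j
  omega

theorem Bal.of_append_left {x y z : ℕ} (h : α.Bal x z) (h1 : α.Bal x y) (hxy : x ≤ y)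
    (_ : y ≤ z) : α.Bal y z := by
  intro j
  have := h1 j
  have := h j
  omega

theorem Bal.of_append_right {x y z : ℕ} (h : α.Bal x z) (h1 : α.Bal y z) (hxy : x ≤ y)
    (hyz : y ≤ z) : α.Bal x y := by
  intro j
  have := h1 j
  have := h j
  omega

theorem Bal.self (x : ℕ) : α.Bal x x := by intro j; omega

/-- A balanced interval starts with a block. -/
theorem Bal.exists_start {x y : ℕ} (h : α.Bal x y) (hx : 2 ≤ x) (hxy : x < y)
    (hy : y ≤ 2 * k + a) : ∃ u, α.IsStart u ∧ α.pos u = x ∧ α.endPos u ≤ y ∧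
      α.Bal (α.endPos u) y := by
  obtain ⟨p, hp⟩ := α.exists_pos (hxy.trans_le hy)
  have hs : α.IsStart p := by
    refine ⟨?_, ?_⟩
    · rintro rfl
      rw [α.pos_root] at hp; omega
    · rintro j rfl
      have := h j
      have := α.l_lt_r j
      change α.r j = x at hp
      omega
  have h3 : α.endPos p ≤ y := by
    rcases hs.cases with ⟨j, hj, rfl⟩ | ⟨g, rfl⟩
    · have := h j
      change α.l j = x at hp
      simp only [endPos]; omega
    · simp only [endPos]; omega
  have h4 := α.pos_lt_endPos p
  refine ⟨p, hs, hp, h3, h.of_append_left ?_ (by omega) h3⟩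
  rw [← hp]; exact hs.bal

theorem bal_interior (α : MeliaOrdering k a) (j : Fin k) : α.Bal (α.l j + 1) (α.r j) := by
  intro i
  have h := α.bal_pair j i
  have h1 := α.l_ne_r i j
  have h2 := α.l_ne_r j i
  by_cases hij : i = j
  · subst hij; omega
  · have h3 : α.l i ≠ α.l j := by rwa [ne_eq, α.l_inj]
    have h4 : α.r i ≠ α.r j := by rwa [ne_eq, α.r_inj]
    omega

end MeliaOrdering

/-! ### The constraints in terms of positions -/

/-- The constraints that are added with the block `C` to an ordering `[(l₁, r₁), β]`, except those
among the sub-blocks of `C`. -/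
def Step (r₁ : Particle k a) (β : List (Block k a)) (C : Block k a)
    (I : Finset (Particle k a)) : Prop :=
  I ∈ C1 r₁ β C.particles ∨ ∃ j sub, C = .pair j sub ∧
    (I ∈ C2 β (.af j) ∨ sub ≠ .nil ∧ (I ∈ C3a j sub.toList ∨ I ∈ C3b β sub.toList))

/-- The constraints that are added with the blocks of a list, one after the other. -/
def Steps (r₁ : Particle k a) (β L : List (Block k a)) (I : Finset (Particle k a)) : Prop :=
  ∃ pre C post, L = pre ++ C :: post ∧ Step r₁ (β ++ pre) C I

theorem steps_nil (r₁ : Particle k a) (β : List (Block k a)) (I : Finset (Particle k a)) :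
    ¬ Steps r₁ β [] I := by
  rintro ⟨pre, C, post, h, _⟩
  simp at h

theorem steps_cons (r₁ : Particle k a) (β L : List (Block k a)) (C : Block k a)
    (I : Finset (Particle k a)) :
    Steps r₁ β (C :: L) I ↔ Step r₁ β C I ∨ Steps r₁ (β ++ [C]) L I := by
  constructor
  · rintro ⟨pre, D, post, h, hs⟩
    cases pre with
    | nil =>
      simp only [List.nil_append, List.cons.injEq] at h
      obtain ⟨rfl, rfl⟩ := h
      exact .inl (by simpa using hs)
    | cons E pre =>
      simp only [List.cons_append, List.cons.injEq] at h
      obtain ⟨rfl, rfl⟩ := h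
      exact .inr ⟨pre, D, post, rfl, by simpa using hs⟩
  · rintro (h | ⟨pre, D, post, rfl, hs⟩)
    · exact ⟨[], C, L, rfl, by simpa using h⟩
    · exact ⟨C :: pre, D, post, rfl, by simpa using hs⟩

/-- The recursion unwound: every constraint arises when one block is appended to its predecessors on
its own level, and on the level enclosed by a pair `j` the particle `f j` plays the role of r₁. -/
theorem mem_softConstraints (bs : Blocks k a) (r₁ : Particle k a) (β : List (Block k a))
    (I : Finset (Particle k a)) :
    I ∈ softConstraints r₁ β bs ↔ Steps r₁ β bs.toList I ∨
      ∃ j sub, Block.pair j sub ∈ bs.all ∧ Steps (.f j) [] sub.toList I := by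
  induction bs generalizing r₁ β with
  | nil => simp [softConstraints, Blocks.toList, Blocks.all, steps_nil]
  | adj g rest ih =>
    simp only [softConstraints, Blocks.toList, Blocks.all, steps_cons, Set.mem_union, ih]
    simp [Step, Block.particles, or_assoc]
  | pair j sub rest ih1 ih2 =>
    -- The separate equation for a pair without sub-blocks is absorbed by the condition `sub ≠ .nil`
    -- in `Step` and by the emptiness of the constraints of `.nil`.
    have key : I ∈ softConstraints r₁ β (.pair j sub rest) ↔ Step r₁ β (.pair j sub) I ∨
        I ∈ softConstraints (.f j) [] sub ∨ I ∈ softConstraints r₁ (β ++ [.pair j sub]) rest := by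
      cases sub <;> simp [softConstraints, Step] <;> tauto
    rw [key, ih1, ih2]
    simp only [Blocks.toList, Blocks.all, steps_cons, List.mem_cons, List.mem_append]
    constructor
    · rintro (h | (h | ⟨i, s, h1, h2⟩) | h | ⟨i, s, h1, h2⟩)
      · exact .inl (.inl h)
      · exact .inr ⟨j, sub, .inl rfl, h⟩
      · exact .inr ⟨i, s, .inr (.inl h1), h2⟩
      · exact .inl (.inr h)
      · exact .inr ⟨i, s, .inr (.inr h1), h2⟩
    · rintro ((h | h) | ⟨i, s, h1 | h1 | h1, h2⟩)
      · exact .inl h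
      · exact .inr (.inr (.inl h))
      · simp only [Block.pair.injEq] at h1
        obtain ⟨rfl, rfl⟩ := h1
        exact .inr (.inl (.inl h2))
      · exact .inr (.inl (.inr ⟨i, s, h1, h2⟩))
      · exact .inr (.inr (.inr ⟨i, s, h1, h2⟩))

theorem Blocks.mem_all_cases (bs : Blocks k a) {C : Block k a} (h : C ∈ bs.all) :
    C ∈ bs.toList ∨ ∃ j sub, Block.pair j sub ∈ bs.all ∧ C ∈ sub.toList := by
  induction bs with
  | nil => simp [Blocks.all] at h
  | adj g rest ih => simp only [Blocks.all, Blocks.toList, List.mem_cons] at *; grind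
  | pair i s rest ih1 ih2 =>
    simp only [Blocks.all, Blocks.toList, List.mem_cons, List.mem_append] at *
    rcases h with h | h | h
    · exact .inl (.inl h)
    · rcases ih1 h with h | ⟨j, sub, h1, h2⟩
      · exact .inr ⟨i, s, .inl rfl, h⟩
      · exact .inr ⟨j, sub, .inr (.inl h1), h2⟩
    · rcases ih2 h with h | ⟨j, sub, h1, h2⟩
      · exact .inl (.inr h)
      · exact .inr ⟨j, sub, .inr (.inr h1), h2⟩

theorem Block.word_length_pos (B : Block k a) : 0 < B.word.length := by
  cases B <;> simp [Block.word]

/-! ### Levels of a Melia ordering and sibling blocks -/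

namespace MeliaOrdering
variable (α : MeliaOrdering k a)

/-- `L` is the list of the blocks of one level of `α`, which come directly after `v`. -/
def Lev (v : Particle k a) (L : List (Block k a)) : Prop :=
  (v = .af α.first ∧ L = α.rest.toList) ∨
    ∃ j sub, Block.pair j sub ∈ α.rest.all ∧ v = .f j ∧ L = sub.toList

theorem mem_H_iff (I : Finset (Particle k a)) :
    I ∈ α.H ↔ ∃ v L pre C post, α.Lev v L ∧ L = pre ++ C :: post ∧ Step v pre C I := by
  rw [H, mem_softConstraints]
  constructor
  · rintro (⟨pre, C, post, h, hs⟩ | ⟨j, sub, hj, pre, C, post, h, hs⟩)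
    · exact ⟨_, _, pre, C, post, .inl ⟨rfl, rfl⟩, h, hs⟩
    · exact ⟨_, _, pre, C, post, .inr ⟨j, sub, hj, rfl, rfl⟩, h, hs⟩
  · rintro ⟨v, L, pre, C, post, (⟨rfl, rfl⟩ | ⟨j, sub, hj, rfl, rfl⟩), h, hs⟩
    · exact .inl ⟨pre, C, post, h, hs⟩
    · exact .inr ⟨j, sub, hj, pre, C, post, h, hs⟩

variable {α}

theorem isStart_left {B : Block k a} (h : B ∈ α.rest.all) : α.IsStart B.left := by
  cases B with
  | adj g => exact α.isStart_adj g
  | pair j sub => exact α.isStart_f (α.ne_first h)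

theorem endPos_left {B : Block k a} : α.endPos B.left = α.pos B.right + 1 := by
  cases B <;> rfl

theorem head_left {B : Block k a} (h : B ∈ α.rest.all) : α.head B.left = B.particles := by
  ext p
  rw [α.mem_block_iff h, head, mem_Iv, endPos_left]
  omega

theorem IsStart.exists_block {u : Particle k a} (h : α.IsStart u) :
    ∃ B ∈ α.rest.all, B.left = u := by
  rcases h.cases with ⟨j, hj, rfl⟩ | ⟨g, rfl⟩
  · obtain ⟨s, hs⟩ := α.exists_pair hj
    exact ⟨_, hs, rfl⟩
  · exact ⟨_, α.exists_adj g, rfl⟩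

theorem Lev.isOpen {v : Particle k a} {L : List (Block k a)} (h : α.Lev v L) : α.IsOpen v := by
  rcases h with ⟨rfl, _⟩ | ⟨j, sub, hj, rfl, _⟩
  · exact ⟨by simp [root], fun j hj => by simpa using hj.symm⟩
  · exact (α.isStart_f (α.ne_first hj)).isOpen

theorem Lev.mem_all {v : Particle k a} {L : List (Block k a)} (h : α.Lev v L) :
    ∀ B ∈ L, B ∈ α.rest.all := by
  rcases h with ⟨_, rfl⟩ | ⟨j, sub, hj, _, rfl⟩
  · exact α.rest.toList_subset_all
  · exact fun B hB => α.rest.sub_all_subset hj B (sub.toList_subset_all B hB)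

theorem Lev.word_eq {v : Particle k a} {L : List (Block k a)} (h : α.Lev v L) :
    ∃ x y, α.word = x ++ v :: (L.flatMap Block.word ++ y) ∧
      ∀ j, v = .f j → ∃ z, y = .af j :: z := by
  rcases h with ⟨rfl, rfl⟩ | ⟨j, sub, hj, rfl, rfl⟩
  · exact ⟨[.f α.first], [], by simp [word, ← Blocks.word_eq_flatMap], by simp⟩
  · obtain ⟨x, y, e⟩ := α.exists_word_eq hj
    refine ⟨x, .af j :: y, by simp [e, Block.word, ← Blocks.word_eq_flatMap], ?_⟩
    rintro i hi
    simp only [Particle.f.injEq] at hi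
    exact ⟨y, by rw [hi]⟩

theorem bal_of_infix {x y : List (Particle k a)} {M : List (Block k a)}
    (h : α.word = x ++ (M.flatMap Block.word ++ y)) :
    α.Bal x.length (x.length + (M.flatMap Block.word).length) := by
  intro j
  have h1 := idxOf_mem_infix α.word_nodup h (α.mem_word (.f j))
  have h2 := idxOf_mem_infix α.word_nodup h (α.mem_word (.af j))
  simp only [l, r, pos]
  rw [← h1, ← h2]
  simp only [List.mem_flatMap, Block.f_mem_word_iff]

/-- A level is a concatenation of whole blocks directly behind `v`, so the position of a block is
found by adding lengths, and the stretch in front of it contains only complete pairs. -/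
theorem Lev.split {v : Particle k a} {pre post : List (Block k a)} {C : Block k a}
    (h : α.Lev v (pre ++ C :: post)) :
    α.pos C.left = α.pos v + 1 + (pre.flatMap Block.word).length ∧
      α.endPos C.left = α.pos C.left + C.word.length ∧ α.Bal (α.pos v + 1) (α.pos C.left) := by
  obtain ⟨x, y, e, -⟩ := h.word_eq
  have hv : α.pos v = x.length := idxOf_append_cons α.word_nodup e
  have e1 : α.word = (x ++ [v]) ++ (pre.flatMap Block.word ++
      (C.word ++ (post.flatMap Block.word ++ y))) := by
    rw [e]; simp
  have hb := bal_of_infix e1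
  have e2 : α.word = ((x ++ [v]) ++ pre.flatMap Block.word) ++
      (C.word ++ (post.flatMap Block.word ++ y)) := by rw [e1]; simp
  have hl : α.pos C.left = x.length + 1 + (pre.flatMap Block.word).length := by
    have : ∃ z, C.word = C.left :: z := by
      cases C with
      | adj g => exact ⟨[], rfl⟩
      | pair j s => exact ⟨_, rfl⟩
    obtain ⟨z, hz⟩ := this
    rw [hz] at e2
    have : α.pos C.left = _ := idxOf_append_cons α.word_nodup e2
    rw [this]; simp; omega
  have hr : α.pos C.right + 1 = α.pos C.left + C.word.length := by
    have : ∃ z, C.word = z ++ [C.right] := by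
      cases C with
      | adj g => exact ⟨[], rfl⟩
      | pair j s => exact ⟨.f j :: s.word, rfl⟩
    obtain ⟨z, hz⟩ := this
    have e3 : α.word = ((x ++ [v]) ++ pre.flatMap Block.word ++ z) ++
        C.right :: (post.flatMap Block.word ++ y) := by rw [e2, hz]; simp
    have := idxOf_append_cons α.word_nodup e3
    change α.pos C.right = _ at this
    rw [this, hl, hz]
    simp
    omega
  refine ⟨by rw [hl, hv], by rw [endPos_left, hr], ?_⟩
  rw [hl, hv]
  simpa using hb

theorem Lev.right_eq {j : Fin k} {L : List (Block k a)} (h : α.Lev (.f j) L) :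
    α.r j = α.l j + 1 + (L.flatMap Block.word).length := by
  obtain ⟨x, y, e, hy⟩ := h.word_eq
  obtain ⟨z, rfl⟩ := hy j rfl
  have hv : α.l j = x.length := idxOf_append_cons α.word_nodup e
  have e1 : α.word = (x ++ Particle.f j :: L.flatMap Block.word) ++ .af j :: z := by
    rw [e]; simp
  have : α.r j = _ := idxOf_append_cons α.word_nodup e1
  rw [this, hv]; simp; omega

theorem Lev.split_lt {v : Particle k a} {pre mid post : List (Block k a)} {B C : Block k a}
    (h : α.Lev v (pre ++ B :: (mid ++ C :: post))) :
    α.endPos B.left ≤ α.pos C.left ∧ α.Bal (α.endPos B.left) (α.pos C.left) ∧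
      (α.endPos B.left = α.pos C.left ↔ mid = []) := by
  obtain ⟨h1, h2, h3⟩ := h.split
  have h' : α.Lev v ((pre ++ B :: mid) ++ C :: post) := by simpa using h
  obtain ⟨h4, h5, h6⟩ := h'.split
  have h7 : α.pos C.left = α.endPos B.left + (mid.flatMap Block.word).length := by
    rw [h4, h2, h1]; simp; omega
  have hB : α.IsStart B.left := isStart_left (h.mem_all B (by simp))
  refine ⟨by omega, (h6.of_append_left h3 ?_ ?_).of_append_left hB.bal ?_ ?_, ?_⟩
  · omega
  · have := α.pos_lt_endPos B.left; omega
  · exact (α.pos_lt_endPos _).le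
  · omega
  · cases mid with
    | nil => simp at h7; simp [h7]
    | cons D mid =>
      have := D.word_length_pos
      simp at h7 ⊢
      omega

theorem exists_lev {C : Block k a} (h : C ∈ α.rest.all) :
    ∃ v pre post, α.Lev v (pre ++ C :: post) := by
  rcases α.rest.mem_all_cases h with h | ⟨j, sub, hj, h⟩
  · obtain ⟨pre, post, e⟩ := List.append_of_mem h
    exact ⟨_, pre, post, .inl ⟨rfl, e.symm⟩⟩
  · obtain ⟨pre, post, e⟩ := List.append_of_mem h
    exact ⟨_, pre, post, .inr ⟨j, sub, hj, rfl, e.symm⟩⟩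

theorem eq_of_left_eq {B C : Block k a} (hB : B ∈ α.rest.all) (hC : C ∈ α.rest.all)
    (h : B.left = C.left) : B = C := by
  cases B <;> cases C <;> simp [Block.left] at h
  · rw [h]
  · subst h; rw [α.sub_unique hB hC]

/-- The blocks of a level cover it without holes; the block containing the position `i` is found by
scanning from the left. -/
theorem Lev.length_pos_le {v : Particle k a} {L : List (Block k a)} (h : α.Lev v L) {i : ℕ}
    (h1 : α.pos v + 1 ≤ i) (h2 : i < α.pos v + 1 + (L.flatMap Block.word).length) :
    ∃ pre B post, L = pre ++ B :: post ∧ α.pos B.left ≤ i ∧ i < α.endPos B.left := by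
  have aux : ∀ (post pre : List (Block k a)), α.Lev v (pre ++ post) →
      α.pos v + 1 + (pre.flatMap Block.word).length ≤ i →
      i < α.pos v + 1 + ((pre ++ post).flatMap Block.word).length →
      ∃ pre' B post', pre ++ post = pre' ++ B :: post' ∧ α.pos B.left ≤ i ∧
        i < α.endPos B.left := by
    intro post
    induction post with
    | nil => intro pre _ h3 h4; rw [List.append_nil] at h4; omega
    | cons B post ih =>
      intro pre hl h3 h4
      obtain ⟨h5, h6, -⟩ := hl.split
      by_cases h7 : i < α.endPos B.left
      · exact ⟨pre, B, post, rfl, by omega, h7⟩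
      · have := ih (pre ++ [B]) (by simpa using hl) (by simp at h5 ⊢; omega) (by simpa using h4)
        simpa using this
  exact aux L [] (by simpa using h) (by simpa using h1) (by simpa using h2)

/-- The blocks of a level, in terms of positions. -/
theorem Lev.mem_of_bal {v : Particle k a} {L : List (Block k a)} (h : α.Lev v L) {V : Block k a}
    (hV : V ∈ α.rest.all) (h1 : α.pos v < α.pos V.left)
    (h2 : α.Bal (α.pos v + 1) (α.pos V.left)) : V ∈ L := by
  have hVs := isStart_left hV
  have hlt : α.pos V.left < α.pos v + 1 + (L.flatMap Block.word).length := by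
    by_cases hj : ∃ j, v = .f j
    · obtain ⟨j, rfl⟩ := hj
      have h3 := h.right_eq
      have h4 := h2 j
      have h5 : α.pos V.left ≠ α.r j := by
        rw [r, ne_eq, α.pos_inj]; exact hVs.2 j
      have h6 : α.pos (.f j) = α.l j := rfl
      rw [h6] at h1 h4 ⊢
      omega
    · rcases h with ⟨rfl, rfl⟩ | ⟨j, sub, _, rfl, _⟩
      · have h3 := α.pos_lt V.left
        have h4 : α.pos (.af α.first) = 1 := α.r_first
        have h5 := α.length_word
        simp only [word, List.length_cons] at h5
        rw [← Blocks.word_eq_flatMap, h4]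
        omega
      · exact absurd ⟨j, rfl⟩ hj
  obtain ⟨pre, B, post, rfl, h3, h4⟩ := h.length_pos_le h1 hlt
  have hB : B ∈ α.rest.all := h.mem_all B (by simp)
  by_cases he : α.pos B.left = α.pos V.left
  · rw [α.pos_inj] at he
    rw [← eq_of_left_eq hB hV he]; simp
  · exfalso
    have hs := h.split
    -- The block `V` would begin strictly inside `B`. Then `B` is a pair whose left end lies in the
    -- stretch before `V` and whose right end does not, against the balance of this stretch.
    cases B with
    | adj g => simp only [endPos, Block.left] at h3 h4 he; omega
    | pair j s =>
      have h5 := h2 j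
      have h6 : α.pos V.left ≠ α.r j := by
        rw [r, ne_eq, α.pos_inj]; exact hVs.2 j
      have h7 : α.pos (Block.pair j s).left = α.l j := rfl
      have h8 : α.endPos (Block.pair j s).left = α.r j + 1 := rfl
      have := α.l_lt_r j
      omega

/-- A balanced stretch between two blocks crosses no bracket, so it cannot leave or enter a level:
balance characterizes siblings by positions. -/
theorem exists_siblings {U V : Block k a} (hU : U ∈ α.rest.all) (hV : V ∈ α.rest.all)
    (h1 : α.endPos U.left ≤ α.pos V.left) (h2 : α.Bal (α.endPos U.left) (α.pos V.left)) :
    ∃ v pre mid post, α.Lev v (pre ++ U :: (mid ++ V :: post)) := by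
  obtain ⟨v, pre, post, h⟩ := exists_lev hU
  obtain ⟨h3, h4, h5⟩ := h.split
  have hs := isStart_left hU
  have h6 := α.pos_lt_endPos U.left
  have hm := h.mem_of_bal hV (by omega)
    ((h5.append hs.bal (by omega) h6.le).append h2 (by omega) h1)
  simp only [List.mem_append, List.mem_cons] at hm
  have h9 := α.pos_lt_endPos V.left
  rcases hm with hm | rfl | hm
  · obtain ⟨x, y, rfl⟩ := List.append_of_mem hm
    have h7 : α.Lev v (x ++ V :: (y ++ U :: post)) := by simpa using h
    have := h7.split_lt
    omega
  · omega
  · obtain ⟨x, y, rfl⟩ := List.append_of_mem hm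
    exact ⟨v, pre, x, y, h⟩

end MeliaOrdering

@[simp] theorem lastRight_nil (v : Particle k a) : lastRight v [] = v := rfl

@[simp] theorem lastRight_concat (v : Particle k a) (β : List (Block k a)) (B : Block k a) :
    lastRight v (β ++ [B]) = B.right := by
  simp [lastRight]

theorem C2_mem {β : List (Block k a)} {p : Particle k a} {I : Finset (Particle k a)} :
    I ∈ C2 β p ↔ ∃ B ∈ β, I = insert p B.particles := Iff.rfl

theorem C3b_mem {β sub : List (Block k a)} {I : Finset (Particle k a)} :
    I ∈ C3b β sub ↔ ∃ B ∈ β, ∃ D ∈ sub, I = B.particles ∪ D.particles := Iff.rfl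

theorem C3a_mem {j : Fin k} {sub : List (Block k a)} {I : Finset (Particle k a)} :
    I ∈ C3a j sub ↔ I = {.f j, .af j} ∨ ∃ D ∈ sub.dropLast, I = insert (.af j) D.particles :=
  Iff.rfl

theorem C1_mem {v : Particle k a} {β : List (Block k a)} {q I : Finset (Particle k a)} :
    I ∈ C1 v β q ↔ (I = insert v q ∨ ∃ B ∈ β, I = insert B.left q ∨ I = insert B.right q ∨
      ∃ D ∈ B.sub, I = q ∪ D.particles) ∧ I ≠ insert (lastRight v β) q := Iff.rfl

theorem Blocks.toList_eq_nil {bs : Blocks k a} (h : bs ≠ .nil) : bs.toList ≠ [] := by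
  cases bs <;> simp [Blocks.toList] at *

theorem Block.particles_disjoint_left {B C : Block k a} (h : Disjoint B.particles C.particles) :
    B.left ∉ C.particles :=
  Finset.disjoint_left.mp h (by cases B <;> simp [Block.particles, Block.left])

theorem charge_ne_zero_iff (I : Finset (Particle k a)) (j : Fin k) :
    charge I j ≠ 0 ↔ ¬ (Particle.f j ∈ I ↔ Particle.af j ∈ I) := by
  unfold charge
  split_ifs <;> simp [*]

/-! ### Equality of the two descriptions of the constraints -/

namespace MeliaOrdering
variable {α : MeliaOrdering k a}

theorem mem_crossed {u v : Particle k a} {j : Fin k} : j ∈ α.crossed u v ↔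
    ¬ ((min (α.pos u) (α.pos v) ≤ α.l j ∧ α.l j < max (α.pos u) (α.pos v)) ↔
      (min (α.pos u) (α.pos v) ≤ α.r j ∧ α.r j < max (α.pos u) (α.pos v))) := by
  simp only [crossed, Finset.mem_filter, Finset.mem_univ, true_and, charge_ne_zero_iff, segment]
  rfl

theorem crossed_comm (u v : Particle k a) : α.crossed u v = α.crossed v u := by
  ext j; rw [mem_crossed, mem_crossed, min_comm, max_comm]

theorem Lev.sub {v : Particle k a} {pre post : List (Block k a)} {j : Fin k} {sub : Blocks k a}
    (h : α.Lev v (pre ++ .pair j sub :: post)) : α.Lev (.f j) sub.toList :=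
  .inr ⟨j, sub, h.mem_all _ (by simp), rfl, rfl⟩

/-- A sub-block lies inside its block. -/
theorem Lev.sub_pos {j : Fin k} {L : List (Block k a)} (h : α.Lev (.f j) L) {D : Block k a}
    (hD : D ∈ L) : α.l j < α.pos D.left ∧ α.endPos D.left ≤ α.r j ∧
      α.Bal (α.l j + 1) (α.pos D.left) ∧ (D ∈ L.dropLast → α.endPos D.left ≠ α.r j) := by
  obtain ⟨x, y, rfl⟩ := List.append_of_mem hD
  obtain ⟨h1, h2, h3⟩ := h.split
  have h4 := h.right_eq
  have h5 : α.pos (.f j) = α.l j := rfl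
  simp only [List.flatMap_append, List.flatMap_cons, List.length_append] at h4
  refine ⟨by omega, by omega, h3, ?_⟩
  intro h6 h7
  have hy : y ≠ [] := by
    rintro rfl
    rw [List.dropLast_concat] at h6
    obtain ⟨x', y', rfl⟩ := List.append_of_mem h6
    have h8 : α.Lev (.f j) (x' ++ D :: (y' ++ D :: [])) := by simpa using h
    have := h8.split_lt
    have := α.pos_lt_endPos D.left
    omega
  cases y with
  | nil => exact hy rfl
  | cons E y =>
    have := E.word_length_pos
    simp at h4 h1 h2
    omega

/-- C₁ gives the cases `left`, `right` and, through the sub-blocks of earlier siblings, `apart`; C₂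
gives `right`; C₃ᵃ gives `pair` and `right`; C₃ᵇ gives `apart`. The elements excluded from C₁ and
C₃ᵃ are those that belong to adjacent pieces. -/
theorem cons_of_mem_H {I : Finset (Particle k a)} (hI : I ∈ α.H) : α.Cons I := by
  obtain ⟨v, L, pre, C, post, hL, rfl, hs⟩ := (α.mem_H_iff I).1 hI
  have hC : C ∈ α.rest.all := hL.mem_all C (by simp)
  have hCs := isStart_left hC
  have hlt := α.pos_lt_endPos C.left
  rcases hs with hs | ⟨j, sub, rfl, hs⟩
  · rw [C1_mem] at hs
    obtain ⟨h1 | ⟨B, hB, h1⟩, h2⟩ := hs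
    · subst h1
      have hp : pre ≠ [] := by rintro rfl; simp at h2
      obtain ⟨h3, h4, h5⟩ := hL.split
      rw [← head_left hC]
      refine .left hL.isOpen hCs ?_ (.inr h5)
      cases pre with
      | nil => exact absurd rfl hp
      | cons D pre =>
        have := D.word_length_pos
        simp at h3; omega
    · obtain ⟨x, y, rfl⟩ := List.append_of_mem hB
      have hL' : α.Lev v (x ++ B :: (y ++ C :: post)) := by simpa using hL
      obtain ⟨h3, h4, h5⟩ := hL'.split_lt
      have hBa : B ∈ α.rest.all := hL'.mem_all B (by simp)
      have hBs := isStart_left hBa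
      have hBlt := α.pos_lt_endPos B.left
      have hright : I = insert B.right C.particles → y ≠ [] := by
        rintro rfl rfl
        rw [show x ++ B :: [] = x ++ [B] from rfl, lastRight_concat] at h2
        exact h2 rfl
      have hleft : I = insert B.left C.particles →
          (B.left = B.right → y ≠ []) → α.Cons I := by
        rintro rfl h6
        rw [← head_left hC]
        refine .left hBs.isOpen hCs ?_ (.inl ⟨h3, h4⟩)
        -- For an adjoint particle both ends coincide, and it is the element excluded from C₁ that
        -- rules out adjacency. For a pair, its right end lies in between.
        cases B with
        | adj g =>
          have := h6 rfl
          rw [ne_eq, ← h5] at this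
          omega
        | pair j s =>
          have := α.l_lt_r j
          simp only [Block.left, endPos] at h3 ⊢
          change α.l j + 1 < _
          omega
      rcases h1 with h1 | h1 | ⟨D, hD, h1⟩
      · exact hleft h1 fun e => hright (by rwa [← e])
      · cases B with
        | adj g => exact hleft h1 fun _ => hright h1
        | pair j s =>
          have h6 := hright h1
          subst h1
          rw [← head_left hC]
          rw [ne_eq, ← h5] at h6
          rw [show α.endPos (Block.pair j s).left = α.r j + 1 from rfl] at h3 h6
          refine .right hCs (α.ne_first hBa) ?_ ?_ ?_
          · rw [head, mem_Iv]
            change ¬ (_ ≤ α.r j ∧ _)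
            omega
          · omega
          · omega
      · subst h1
        cases B with
        | adj g => simp [Block.sub] at hD
        | pair j s =>
          have hs := hL'.sub
          obtain ⟨h6, h7, -, -⟩ := hs.sub_pos hD
          have hDa := hs.mem_all D hD
          rw [← head_left hC, ← head_left hDa, Finset.union_comm]
          rw [show α.endPos (Block.pair j s).left = α.r j + 1 from rfl] at h3
          -- Between the sub-block and `C` lies the right end of the enclosing pair `j`, but not its
          -- left end.
          refine .apart (isStart_left hDa) hCs (by omega) fun hb => ?_
          have := hb j
          have := α.pos_lt_endPos D.left
          omega
  · have hS := hL.sub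
    have hjf := α.ne_first hC
    have hlr := α.l_lt_r j
    have e1 : α.pos (Block.pair j sub).left = α.l j := rfl
    rcases hs with hs | ⟨hne, hs | hs⟩
    · rw [C2_mem] at hs
      obtain ⟨B, hB, rfl⟩ := hs
      obtain ⟨x, y, rfl⟩ := List.append_of_mem hB
      have hL' : α.Lev v (x ++ B :: (y ++ .pair j sub :: post)) := by simpa using hL
      obtain ⟨h3, h4, h5⟩ := hL'.split_lt
      have hBa : B ∈ α.rest.all := hL'.mem_all B (by simp)
      have hBlt := α.pos_lt_endPos B.left
      rw [← head_left hBa]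
      refine .right (isStart_left hBa) hjf ?_ (by omega) (by omega)
      rw [head, mem_Iv]
      change ¬ (_ ≤ α.r j ∧ α.r j < _)
      omega
    · rw [C3a_mem] at hs
      rcases hs with rfl | ⟨D, hD, rfl⟩
      · refine .pair hjf ?_
        have := hS.right_eq
        obtain ⟨E, L, hE⟩ := List.exists_cons_of_ne_nil (Blocks.toList_eq_nil hne)
        have h6 := E.word_length_pos
        rw [hE] at this
        change _ = α.l j + 1 + _ at this
        simp at this
        omega
      · have hD' := List.mem_of_mem_dropLast hD
        obtain ⟨h6, h7, h8, h9⟩ := hS.sub_pos hD'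
        have hDa := hS.mem_all D hD'
        rw [← head_left hDa]
        have := α.pos_lt_endPos D.left
        refine .right (isStart_left hDa) hjf ?_ (h9 hD) (by omega)
        rw [head, mem_Iv]
        change ¬ (_ ≤ α.r j ∧ α.r j < _)
        omega
    · rw [C3b_mem] at hs
      obtain ⟨B, hB, D, hD, rfl⟩ := hs
      obtain ⟨x, y, rfl⟩ := List.append_of_mem hB
      have hL' : α.Lev v (x ++ B :: (y ++ .pair j sub :: post)) := by simpa using hL
      obtain ⟨h3, h4, h5⟩ := hL'.split_lt
      have hBa : B ∈ α.rest.all := hL'.mem_all B (by simp)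
      obtain ⟨h6, h7, h8, h9⟩ := hS.sub_pos hD
      have hDa := hS.mem_all D hD
      rw [← head_left hBa, ← head_left hDa]
      refine .apart (isStart_left hBa) (isStart_left hDa) (by omega) fun hb => ?_
      have := hb j
      have := α.pos_lt_endPos D.left
      omega

theorem disjoint_blocks {B C : Block k a} (hB : B ∈ α.rest.all) (hC : C ∈ α.rest.all)
    (h : Disjoint B.particles C.particles) :
    α.endPos B.left ≤ α.pos C.left ∨ α.endPos C.left ≤ α.pos B.left := by
  have h1 := Block.particles_disjoint_left h
  have h2 := Block.particles_disjoint_left h.symm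
  rw [← head_left hC, head, mem_Iv] at h1
  rw [← head_left hB, head, mem_Iv] at h2
  omega

theorem apart_of_crossed {B C : Block k a} (hB : B ∈ α.rest.all) (hC : C ∈ α.rest.all)
    (h : α.endPos B.left ≤ α.pos C.left) (hc : (α.crossed B.left C.left).Nonempty) :
    α.Cons (B.particles ∪ C.particles) := by
  rw [← head_left hB, ← head_left hC]
  refine .apart (isStart_left hB) (isStart_left hC) h fun hb => ?_
  obtain ⟨j, hj⟩ := hc
  rw [mem_crossed] at hj
  have h1 := α.pos_lt_endPos B.left
  rw [min_eq_left (by omega), max_eq_right (by omega)] at hj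
  exact hj (((isStart_left hB).bal.append hb h1.le h) j)

/-- The blocks themselves are balanced, so a flavour line crossed by the diagonal must be unbalanced
in the stretch between them. For a right end, adjacency would leave no line to cross except that of
its own pair. -/
theorem cons_of_mem_HA {I : Finset (Particle k a)} (hI : I ∈ α.HA) : α.Cons I := by
  rcases hI with ⟨B, hB, C, hC, hd, hc, rfl⟩ | ⟨B, hB, j, sub, hC, hd, ⟨i, hi, hij⟩, rfl⟩
  · have hne : (α.crossed B.left C.left).Nonempty := by
      rw [← Finset.card_pos]; omega
    rcases disjoint_blocks hB hC hd with h | h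
    · exact apart_of_crossed hB hC h hne
    · rw [Finset.union_comm]
      exact apart_of_crossed hC hB h (by rwa [crossed_comm])
  · have hBs := isStart_left hB
    have hlt := α.pos_lt_endPos B.left
    have hn : Particle.af j ∉ B.particles := by
      intro h
      rcases hd with hd | hd
      · exact Finset.disjoint_left.mp hd h (by simp [Block.particles])
      · apply hd.2
        intro p hp
        rw [α.mem_block_iff hC] at hp
        rw [← head_left hB, head, mem_Iv] at h ⊢
        have := hBs.bal j
        change _ ≤ α.r j ∧ α.r j < _ at h
        change α.l j ≤ _ ∧ _ ≤ α.r j at hp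
        omega
    rw [← head_left hB] at hn ⊢
    have hn' := hn
    rw [head, mem_Iv] at hn'
    change ¬ (_ ≤ α.r j ∧ α.r j < _) at hn'
    rw [mem_crossed] at hi
    change ¬ (min _ (α.r j) ≤ _ ∧ _ < max _ (α.r j) ↔ min _ (α.r j) ≤ _ ∧ _ < max _ (α.r j)) at hi
    refine .right hBs (α.ne_first hC) hn (fun h => ?_) fun h => ?_
    · have := hBs.bal i
      rw [h] at this
      rw [min_eq_left (by omega), max_eq_right (by omega)] at hi
      exact hi this
    · rw [min_eq_right (by omega), max_eq_left (by omega), h] at hi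
      have h1 := α.l_ne_r i j
      have h2 : α.r i ≠ α.r j := by rwa [ne_eq, α.r_inj]
      omega

/-- To see that `I` is not the element excluded from C₁, it suffices to exhibit a particle of `I`
outside `q` other than the last right end. -/
theorem C1_mem_of {v : Particle k a} {pre : List (Block k a)} {q I : Finset (Particle k a)}
    {w : Particle k a} (hw : w ∈ I) (hq : w ∉ q) (hne : w ≠ lastRight v pre)
    (h : I = insert v q ∨ ∃ B ∈ pre, I = insert B.left q ∨ I = insert B.right q ∨
      ∃ D ∈ B.sub, I = q ∪ D.particles) : I ∈ C1 v pre q := by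
  rw [C1_mem]
  refine ⟨h, ?_⟩
  rintro rfl
  simp only [Finset.mem_insert] at hw
  tauto

/-- The last particle before a block `C` of a level. -/
theorem Lev.lastRight_pos {v : Particle k a} {pre post : List (Block k a)} {C : Block k a}
    (h : α.Lev v (pre ++ C :: post)) : α.pos (lastRight v pre) + 1 = α.pos C.left := by
  rcases List.eq_nil_or_concat pre with rfl | ⟨x, B, rfl⟩
  · have := h.split.1
    simp at this ⊢
    omega
  · have h' : α.Lev v (x ++ B :: ([] ++ C :: post)) := by simpa using h
    have := h'.split_lt
    rw [List.concat_eq_append, lastRight_concat, ← endPos_left]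
    tauto

theorem Block.left_mem (B : Block k a) : B.left ∈ B.particles := by
  cases B <;> simp [Block.particles, Block.left]

theorem pos_notMem {C : Block k a} (hC : C ∈ α.rest.all) {p : Particle k a}
    (h : α.pos p < α.pos C.left) : p ∉ C.particles := by
  rw [α.mem_block_iff hC]; omega

/-- All of these come from C₁: either `w` is the particle in front of the level of the block, or it
is the left end of an earlier sibling. An adjoint particle can only be a sibling. -/
theorem mem_of_left {w u : Particle k a} (hw : α.IsOpen w) (hu : α.IsStart u)
    (h : α.pos w + 1 < α.pos u)
    (hb : (α.endPos w ≤ α.pos u ∧ α.Bal (α.endPos w) (α.pos u)) ∨ α.Bal (α.pos w + 1) (α.pos u)) :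
    insert w (α.head u) ∈ α.H := by
  obtain ⟨U, hU, rfl⟩ := hu.exists_block
  rw [head_left hU, mem_H_iff]
  have hq : w ∉ U.particles := pos_notMem hU (by omega)
  have hlast : ∀ {v : Particle k a} {pre post : List (Block k a)}, α.Lev v (pre ++ U :: post) →
      w ≠ lastRight v pre := by
    rintro v pre post hL rfl
    have := hL.lastRight_pos
    omega
  have key1 : ∀ L, α.Lev w L → α.Bal (α.pos w + 1) (α.pos U.left) →
      ∃ v L pre C post, α.Lev v L ∧ L = pre ++ C :: post ∧
        Step v pre C (insert w U.particles) := by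
    intro L hL hb
    obtain ⟨pre, post, rfl⟩ := List.append_of_mem (hL.mem_of_bal hU (by omega) hb)
    exact ⟨w, _, pre, U, post, hL, rfl, .inl (C1_mem_of (by simp) hq (hlast hL) (.inl rfl))⟩
  have key2 : ∀ W ∈ α.rest.all, W.left = w → α.endPos W.left ≤ α.pos U.left →
      α.Bal (α.endPos W.left) (α.pos U.left) → ∃ v L pre C post, α.Lev v L ∧
        L = pre ++ C :: post ∧ Step v pre C (insert w U.particles) := by
    rintro W hW rfl h1 h2
    obtain ⟨v, pre, mid, post, hL⟩ := exists_siblings hW hU h1 h2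
    have hL' : α.Lev v ((pre ++ W :: mid) ++ U :: post) := by simpa using hL
    exact ⟨v, _, _, U, post, hL', rfl, .inl (C1_mem_of (by simp) hq (hlast hL')
      (.inr ⟨W, by simp, .inl rfl⟩))⟩
  cases w with
  | f j =>
    have hj : j ≠ α.first := by
      rintro rfl; exact hw.1 rfl
    obtain ⟨s, hs⟩ := α.exists_pair hj
    rcases hb with ⟨h1, h2⟩ | hb
    · exact key2 _ hs rfl h1 h2
    · exact key1 _ (.inr ⟨j, s, hs, rfl, rfl⟩) hb
  | af j =>
    have hj : j = α.first := by
      by_contra hj; exact hw.2 j hj rfl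
    subst hj
    refine key1 _ (.inl ⟨rfl, rfl⟩) ?_
    rcases hb with ⟨_, h2⟩ | hb
    · exact h2
    · exact hb
  | adj g =>
    have : α.endPos (.adj g) ≤ α.pos U.left ∧ α.Bal (α.endPos (.adj g)) (α.pos U.left) := by
      rcases hb with h1 | h1
      · exact h1
      · exact ⟨by simp only [endPos]; omega, h1⟩
    exact key2 _ (α.exists_adj g) rfl this.1 this.2

theorem mem_of_pair {j : Fin k} (hj : j ≠ α.first) (h : α.r j ≠ α.l j + 1) :
    {.f j, .af j} ∈ α.H := by
  obtain ⟨s, hs⟩ := α.exists_pair hj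
  obtain ⟨v, pre, post, hL⟩ := exists_lev hs
  rw [mem_H_iff]
  refine ⟨v, _, pre, _, post, hL, rfl, .inr ⟨j, s, rfl, .inr ⟨?_, .inl (.inl rfl)⟩⟩⟩
  rintro rfl
  have h1 := hL.split
  simp [Block.left, Block.word, Blocks.word, endPos] at h1
  have : α.pos (.f j) = α.l j := rfl
  omega

/-- Two crossed lines give an element of H^A. If just one line `j` is crossed, the blocks differ by
one level: one of them is a sibling of the pair `j` and the other is one of its sub-blocks. -/
theorem mem_of_apart {u v : Particle k a} (hu : α.IsStart u) (hv : α.IsStart v)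
    (h : α.endPos u ≤ α.pos v) (hb : ¬ α.Bal (α.endPos u) (α.pos v)) :
    α.head u ∪ α.head v ∈ α.H ∪ α.HA := by
  obtain ⟨U, hU, rfl⟩ := hu.exists_block
  obtain ⟨V, hV, rfl⟩ := hv.exists_block
  rw [head_left hU, head_left hV]
  have hlt := α.pos_lt_endPos U.left
  have hlt2 := α.pos_lt_endPos V.left
  by_cases hc : 2 ≤ (α.crossed U.left V.left).card
  · refine .inr (.inl ⟨U, hU, V, hV, ?_, hc, rfl⟩)
    rw [← head_left hU, ← head_left hV, Finset.disjoint_left]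
    intro p
    simp only [head, mem_Iv]
    omega
  · left
    have hcr : ∀ i, i ∈ α.crossed U.left V.left ↔ ¬ ((α.endPos U.left ≤ α.l i ∧
        α.l i < α.pos V.left) ↔ (α.endPos U.left ≤ α.r i ∧ α.r i < α.pos V.left)) := by
      intro i
      rw [mem_crossed, min_eq_left (by omega), max_eq_right (by omega)]
      have := hu.bal i
      omega
    obtain ⟨j, hj⟩ := not_forall.mp hb
    have huniq : ∀ i, i ≠ j → ((α.endPos U.left ≤ α.l i ∧ α.l i < α.pos V.left) ↔
        (α.endPos U.left ≤ α.r i ∧ α.r i < α.pos V.left)) := by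
      intro i hi
      by_contra hn
      apply hc
      rw [show 2 = ({i, j} : Finset (Fin k)).card by rw [Finset.card_pair hi]]
      apply Finset.card_le_card
      intro x hx
      rw [hcr]
      simp only [Finset.mem_insert, Finset.mem_singleton] at hx
      rcases hx with rfl | rfl <;> assumption
    have hlr := α.l_lt_r j
    have hU2 := hu.two_le
    have hjf : j ≠ α.first := by
      rintro rfl
      simp at hj
      omega
    obtain ⟨s, hs⟩ := α.exists_pair hjf
    have e1 : α.pos (Block.pair j s).left = α.l j := rfl
    have e2 : α.endPos (Block.pair j s).left = α.r j + 1 := rfl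
    -- If the left end of `j` lies in the stretch, `V` is a sub-block of `j` and `U` an earlier
    -- sibling of `j`, so C₃ᵇ applies. Otherwise `U` is a sub-block and `V` a later sibling of `j`,
    -- and C₁ applies.
    by_cases h1 : α.endPos U.left ≤ α.l j ∧ α.l j < α.pos V.left
    · have h2 : ¬ α.r j < α.pos V.left := by omega
      have h2' : α.pos V.left ≠ α.r j := by
        rw [r, ne_eq, α.pos_inj]; exact hv.2 j
      have hin : ∀ i, i ≠ j → (α.l j < α.l i ∧ α.l i < α.r j ↔ α.l j < α.r i ∧ α.r i < α.r j) := by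
        intro i _
        have := α.bal_interior j i
        omega
      have b2 : α.Bal (α.l j + 1) (α.pos V.left) := by
        intro i
        by_cases hij : i = j
        · subst hij; omega
        · have := huniq i hij
          have := hin i hij
          have : α.r i ≠ α.r j := by rwa [ne_eq, α.r_inj]
          omega
      have b1 : α.Bal (α.endPos U.left) (α.l j) := by
        intro i
        by_cases hij : i = j
        · subst hij; omega
        · have := huniq i hij
          have := b2 i
          have : α.l i ≠ α.l j := by rwa [ne_eq, α.l_inj]
          have := α.l_ne_r j i
          omega
      obtain ⟨v, pre, mid, post, hL⟩ := exists_siblings hU hs (by omega) b1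
      have hL' : α.Lev v ((pre ++ U :: mid) ++ .pair j s :: post) := by simpa using hL
      have hm := hL'.sub.mem_of_bal hV (by change α.l j < _; omega) b2
      rw [mem_H_iff]
      refine ⟨v, _, _, _, post, hL', rfl, .inr ⟨j, s, rfl, .inr ⟨?_, .inr ?_⟩⟩⟩
      · rintro rfl; simp [Blocks.toList] at hm
      · exact ⟨U, by simp, V, hm, rfl⟩
    · have h2 : α.endPos U.left ≤ α.r j ∧ α.r j < α.pos V.left := by omega
      have h3 : α.l j < α.pos U.left := by
        have := hu.bal j
        omega
      have hin : ∀ i, i ≠ j → (α.l j < α.l i ∧ α.l i < α.r j ↔ α.l j < α.r i ∧ α.r i < α.r j) := by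
        intro i _
        have := α.bal_interior j i
        omega
      have b1 : α.Bal (α.endPos U.left) (α.r j) := by
        intro i
        by_cases hij : i = j
        · subst hij; omega
        · have := huniq i hij
          have := hin i hij
          have := α.l_lt_r i
          have : α.r i ≠ α.r j := by rwa [ne_eq, α.r_inj]
          omega
      have b2 : α.Bal (α.r j + 1) (α.pos V.left) := by
        intro i
        by_cases hij : i = j
        · subst hij; omega
        · have := huniq i hij
          have := b1 i
          have : α.r i ≠ α.r j := by rwa [ne_eq, α.r_inj]
          have := α.l_ne_r i j
          omega
      have b3 : α.Bal (α.l j + 1) (α.pos U.left) :=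
        (α.bal_interior j).of_append_right (hu.bal.append b1 hlt.le h2.1) (by omega) (by omega)
      obtain ⟨v, pre, mid, post, hL⟩ := exists_siblings hs hV (by omega) b2
      have hL' : α.Lev v ((pre ++ .pair j s :: mid) ++ V :: post) := by simpa using hL
      have hm := hL.sub.mem_of_bal hU (by change α.l j < _; omega) b3
      rw [mem_H_iff]
      refine ⟨v, _, _, V, post, hL', rfl, .inl (C1_mem_of (w := U.left) ?_ ?_ ?_
        (.inr ⟨.pair j s, by simp, .inr (.inr ⟨U, hm, Finset.union_comm _ _⟩)⟩))⟩
      · simp [Block.left_mem]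
      · exact pos_notMem hV (by omega)
      · intro e
        have := hL'.lastRight_pos
        rw [← e] at this
        omega

/-- If no foreign line is crossed, the block stands on the level of the pair `j` or one level below
it: C₁ applies if it comes after `j`, C₃ᵃ if it is inside, and C₂ if it comes before. -/
theorem mem_of_right {u : Particle k a} {j : Fin k} (hu : α.IsStart u) (hj : j ≠ α.first)
    (hn : Particle.af j ∉ α.head u) (h1 : α.endPos u ≠ α.r j) (h2 : α.pos u ≠ α.r j + 1) :
    insert (.af j) (α.head u) ∈ α.H ∪ α.HA := by
  obtain ⟨U, hU, rfl⟩ := hu.exists_block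
  obtain ⟨s, hs⟩ := α.exists_pair hj
  have hlt := α.pos_lt_endPos U.left
  have hlr := α.l_lt_r j
  have hn' := hn
  rw [head, mem_Iv] at hn'
  change ¬ (_ ≤ α.r j ∧ α.r j < _) at hn'
  have hbj := hu.bal j
  rw [head_left hU] at hn ⊢
  have e1 : α.pos (Block.pair j s).left = α.l j := rfl
  have e2 : α.endPos (Block.pair j s).left = α.r j + 1 := rfl
  have e3 : α.pos (.af j) = α.r j := rfl
  by_cases hc : ∃ i ∈ α.crossed U.left (.af j), i ≠ j
  · refine .inr (.inr ⟨U, hU, j, s, hs, ?_, hc, rfl⟩)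
    by_cases hin : α.l j < α.pos U.left ∧ α.pos U.left < α.r j
    · right
      rw [Finset.ssubset_iff_of_subset]
      · exact ⟨.af j, by simp [Block.particles], hn⟩
      · intro p
        rw [α.mem_block_iff hU, α.mem_block_iff hs]
        have : α.endPos U.left = α.pos U.right + 1 := endPos_left
        change _ → α.l j ≤ _ ∧ _ ≤ α.r j
        omega
    · left
      rw [Finset.disjoint_left]
      intro p
      rw [α.mem_block_iff hU, α.mem_block_iff hs]
      have : α.endPos U.left = α.pos U.right + 1 := endPos_left
      change _ → ¬ (α.l j ≤ _ ∧ _ ≤ α.r j)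
      have := α.bal_pair j
      have h5 : α.pos U.left = α.l j → U = .pair j s := fun h =>
        eq_of_left_eq hU hs (by rw [← α.pos_inj, h, e1])
      have h6 : α.pos U.left ≠ α.l j := by
        intro h
        rw [h5 h] at hn
        simp [Block.particles] at hn
      have h7 : α.pos U.left ≠ α.r j := by
        rw [r, ne_eq, α.pos_inj]; exact hu.2 j
      intro h8
      omega
  · left
    push Not at hc
    have huniq : ∀ i, i ≠ j → ((min (α.pos U.left) (α.r j) ≤ α.l i ∧
        α.l i < max (α.pos U.left) (α.r j)) ↔ (min (α.pos U.left) (α.r j) ≤ α.r i ∧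
        α.r i < max (α.pos U.left) (α.r j))) := by
      intro i hi
      by_contra h
      exact hi (hc i (mem_crossed.2 h))
    rw [mem_H_iff]
    rcases Nat.lt_or_ge (α.r j) (α.pos U.left) with h3 | h3
    · rw [min_eq_right h3.le, max_eq_left h3.le] at huniq
      have b1 : α.Bal (α.r j + 1) (α.pos U.left) := by
        intro i
        by_cases hij : i = j
        · subst hij; omega
        · have := huniq i hij
          have : α.r i ≠ α.r j := by rwa [ne_eq, α.r_inj]
          have := α.l_ne_r i j
          omega
      obtain ⟨v, pre, mid, post, hL⟩ := exists_siblings hs hU (by omega) b1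
      have hL' : α.Lev v ((pre ++ .pair j s :: mid) ++ U :: post) := by simpa using hL
      refine ⟨v, _, _, U, post, hL', rfl, .inl (C1_mem_of (w := .af j) (by simp) hn ?_
        (.inr ⟨.pair j s, by simp, .inr (.inl rfl)⟩))⟩
      intro e
      have := hL'.lastRight_pos
      rw [← e] at this
      omega
    · have h4 : α.endPos U.left < α.r j := by omega
      rw [min_eq_left h3, max_eq_right h3] at huniq
      by_cases h5 : α.l j < α.pos U.left
      · have b0 : α.Bal (α.pos U.left) (α.r j) := by
          intro i
          by_cases hij : i = j
          · subst hij; omega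
          · exact huniq i hij
        have b1 : α.Bal (α.l j + 1) (α.pos U.left) :=
          (α.bal_interior j).of_append_right b0 (by omega) h3
        obtain ⟨v, pre, post, hL⟩ := exists_lev hs
        have hm := hL.sub.mem_of_bal hU h5 b1
        refine ⟨v, _, pre, _, post, hL, rfl, .inr ⟨j, s, rfl, .inr ⟨?_, .inl (.inr ⟨U, ?_, rfl⟩)⟩⟩⟩
        · rintro rfl; simp [Blocks.toList] at hm
        -- C₃ᵃ omits the last sub-block, but that one ends directly before the right end of `j`,
        -- which has been excluded.
        · rcases List.eq_nil_or_concat s.toList with h6 | ⟨L, E, h6⟩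
          · rw [h6] at hm; simp at hm
          · have hR := hL.sub
            rw [List.concat_eq_append] at h6
            rw [h6, List.dropLast_concat]
            rw [h6] at hm hR
            simp only [List.mem_append, List.mem_singleton] at hm
            rcases hm with hm | rfl
            · exact hm
            · exfalso
              have h7 := hR.right_eq
              have h8 := hR.split
              simp at h7 h8
              have : α.pos (.f j) = α.l j := rfl
              omega
      · have h6 : α.pos U.left ≠ α.l j := by
          intro h
          rw [eq_of_left_eq hU hs (by rw [← α.pos_inj, h, e1])] at hn
          simp [Block.particles] at hn
        have b1 : α.Bal (α.endPos U.left) (α.l j) := by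
          intro i
          by_cases hij : i = j
          · subst hij; omega
          · have := huniq i hij
            have := hu.bal i
            have := α.bal_pair j i
            have : α.l i ≠ α.l j := by rwa [ne_eq, α.l_inj]
            have := α.l_ne_r j i
            have : α.r i ≠ α.r j := by rwa [ne_eq, α.r_inj]
            omega
        obtain ⟨v, pre, mid, post, hL⟩ := exists_siblings hU hs (by omega) b1
        have hL' : α.Lev v ((pre ++ U :: mid) ++ .pair j s :: post) := by simpa using hL
        exact ⟨v, _, _, _, post, hL', rfl, .inr ⟨j, s, rfl, .inl ⟨U, by simp, rfl⟩⟩⟩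

theorem mem_constraints_iff (I : Finset (Particle k a)) : I ∈ α.H ∪ α.HA ↔ α.Cons I := by
  constructor
  · rintro (h | h)
    · exact cons_of_mem_H h
    · exact cons_of_mem_HA h
  · rintro (⟨hu, hv, h, hb⟩ | ⟨hu, hj, hn, h1, h2⟩ | ⟨hw, hu, h, hb⟩ | ⟨hj, h⟩)
    · exact mem_of_apart hu hv h hb
    · exact mem_of_right hu hj hn h1 h2
    · exact .inl (mem_of_left hw hu h hb)
    · exact .inl (mem_of_pair hj h)

end MeliaOrdering

/-! ### Charges -/

theorem isNeutral_iff (I : Finset (Particle k a)) : IsNeutral I ↔ charge I = 0 := by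
  simp [IsNeutral, funext_iff]

theorem isAllowed_iff (I : Finset (Particle k a)) : IsAllowed I ↔
    charge I = 0 ∨ ∃ j, charge I = Pi.single j 1 ∨ charge I = - Pi.single j 1 := by
  rw [IsAllowed, isNeutral_iff, IsMatter]
  refine or_congr_right (exists_congr fun j => ?_)
  constructor
  · rintro ⟨h1 | h1, h2⟩
    · left; ext i; by_cases h : i = j
      · subst h; simp [h1]
      · simp [h, h2 i h]
    · right; ext i; by_cases h : i = j
      · subst h; simp [h1]
      · simp [h, h2 i h]
  · rintro (h | h) <;> simp [h] <;> intro i hi <;> simp [hi]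

theorem charge_union {X Y : Finset (Particle k a)} (h : Disjoint X Y) :
    charge (X ∪ Y) = charge X + charge Y := by
  ext j
  have h1 : Particle.f j ∈ X → Particle.f j ∉ Y := fun h1 => Finset.disjoint_left.mp h h1
  have h2 : Particle.af j ∈ X → Particle.af j ∉ Y := fun h1 => Finset.disjoint_left.mp h h1
  simp only [charge, Finset.mem_union, Pi.add_apply]
  split_ifs <;> simp_all

@[simp] theorem charge_f (j : Fin k) :
    charge ({.f j} : Finset (Particle k a)) = Pi.single j 1 := by
  ext i; by_cases h : i = j <;> simp [charge, h]

@[simp] theorem charge_af (j : Fin k) :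
    charge ({.af j} : Finset (Particle k a)) = - Pi.single j 1 := by
  ext i; by_cases h : i = j <;> simp [charge, h]

@[simp] theorem charge_adj (g : Fin a) : charge ({.adj g} : Finset (Particle k a)) = 0 := by
  ext i; simp [charge]

theorem isAllowed_of_charge_eq {X Y : Finset (Particle k a)} (h : charge X = charge Y)
    (hX : IsAllowed X) : IsAllowed Y := by
  rw [isAllowed_iff] at *; rwa [← h]

theorem isAllowed_of_zero {X : Finset (Particle k a)} (h : charge X = 0) : IsAllowed X := by
  rw [isAllowed_iff]; exact .inl h

theorem isAllowed_singleton (p : Particle k a) : IsAllowed {p} := by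
  rw [isAllowed_iff]
  cases p with
  | f j => exact .inr ⟨j, .inl (charge_f j)⟩
  | af j => exact .inr ⟨j, .inr (charge_af j)⟩
  | adj g => exact .inl (charge_adj g)

theorem isAllowed_union_left {X Y : Finset (Particle k a)} (h : Disjoint X Y) (hX : IsAllowed X)
    (hY : charge Y = 0) : IsAllowed (X ∪ Y) :=
  isAllowed_of_charge_eq (by rw [charge_union h, hY, add_zero]) hX

/-! ### Intervals, gaps and polarizations -/

namespace MeliaOrdering
variable {α : MeliaOrdering k a}

theorem bal_iff_charge (x y : ℕ) : α.Bal x y ↔ charge (α.Iv x y) = 0 := by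
  simp only [funext_iff, Pi.zero_apply, Bal]
  refine forall_congr' fun j => ?_
  have := charge_ne_zero_iff (α.Iv x y) j
  rw [mem_Iv, mem_Iv] at this
  simp only [l, r]
  tauto

theorem Bal.charge {x y : ℕ} (h : α.Bal x y) : charge (α.Iv x y) = 0 := (bal_iff_charge x y).1 h

theorem Iv_append {x y z : ℕ} (h1 : x ≤ y) (h2 : y ≤ z) : α.Iv x y ∪ α.Iv y z = α.Iv x z := by
  ext p; simp only [Finset.mem_union, mem_Iv]; omega

theorem Iv_disjoint {x y x' y' : ℕ} (h : y ≤ x' ∨ y' ≤ x) : Disjoint (α.Iv x y) (α.Iv x' y') := by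
  rw [Finset.disjoint_left]; intro p; simp only [mem_Iv]; omega

theorem Iv_pos (p : Particle k a) : α.Iv (α.pos p) (α.pos p + 1) = {p} := by
  ext q
  rw [mem_Iv, Finset.mem_singleton, ← α.pos_inj]; omega

theorem root_notMem_Iv {x y : ℕ} (h : 1 ≤ x) : α.root ∉ α.Iv x y := by
  rw [mem_Iv, α.pos_root]; omega

variable (α)

/-- The block or the single particle that ends with `p`. -/
def tail : Particle k a → Finset (Particle k a)
  | .f j => {.f j}
  | .af j => α.Iv (α.l j) (α.r j + 1)
  | .adj g => {.adj g}

/-- The planar channel that belongs to two adjacent particles. -/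
def gap (u : Particle k a) : Particle k a → Finset (Particle k a)
  | .f j => insert u (α.head (.f j))
  | .af j => insert (.af j) (α.tail u)
  | .adj g => insert u (α.head (.adj g))

/-- The planar channel that belongs to the particles at the positions `g` and `g + 1`. -/
def gapAt (g : ℕ) : Finset (Particle k a) :=
  if h : g + 1 < α.word.length then α.gap α.word[g] α.word[g + 1] else ∅

variable {α}

theorem gapAt_pos {u v : Particle k a} (h : α.pos v = α.pos u + 1) :
    α.gapAt (α.pos u) = α.gap u v := by
  have h1 := α.pos_lt v
  have e1 := α.getElem_pos u
  have e2 := α.getElem_pos v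
  simp only [h] at e2
  have h2 : α.pos u + 1 < α.word.length := by rw [α.length_word]; omega
  exact (dif_pos h2).trans (congrArg₂ α.gap e1 e2)

theorem gap_start {u v : Particle k a} (hv : α.IsStart v) :
    α.gap u v = insert u (α.head v) := by
  rcases hv.cases with ⟨j, -, rfl⟩ | ⟨g, rfl⟩ <;> rfl

theorem gapAt_endPos {u : Particle k a} (hu : α.IsStart u) {j : Fin k} (h : α.endPos u = α.r j) :
    α.gapAt (α.r j - 1) = insert (.af j) (α.head u) := by
  rcases hu.cases with ⟨i, -, rfl⟩ | ⟨g, rfl⟩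
  · rw [← h]
    exact gapAt_pos (u := .af i) (v := .af j) h.symm
  · rw [← h]
    refine (gapAt_pos (u := .adj g) (v := .af j) h.symm).trans ?_
    rw [head, endPos, Iv_pos]; rfl

/-- A family of vectors that satisfies the relations between the Mandelstam variables and the
constraints. -/
structure Soft (α : MeliaOrdering k a) {V : Type*} [AddCommGroup V] [Module ℝ V]
    (s : Finset (Particle k a) → V) : Prop where
  rel : ∀ X Y Z : Finset (Particle k a), α.root ∉ X → α.root ∉ Y → α.root ∉ Z → Disjoint X Y →
    Disjoint X Z → Disjoint Y Z → IsAllowed X → IsAllowed Y → IsAllowed (X ∪ Y) →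
    charge Z = 0 → s (X ∪ Y) + s (Y ∪ Z) + s (X ∪ Z) = s X + s Y + s Z + s (X ∪ Y ∪ Z)
  small : ∀ I : Finset (Particle k a), I.card ≤ 1 → s I = 0
  cons : ∀ I, α.Cons I → s I = 0

/-- The polarization of `s`. -/
def polar {V : Type*} [AddCommGroup V] (s : Finset (Particle k a) → V)
    (X Y : Finset (Particle k a)) : V := s (X ∪ Y) - s X - s Y

theorem polar_comm {V : Type*} [AddCommGroup V] (s : Finset (Particle k a) → V)
    (X Y : Finset (Particle k a)) : polar s X Y = polar s Y X := by
  unfold polar; rw [Finset.union_comm]; abel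

section

variable {V : Type*} [AddCommGroup V] [Module ℝ V] {s : Finset (Particle k a) → V}

theorem Soft.polar_add (hs : α.Soft s) {X Y Z : Finset (Particle k a)} (rX : α.root ∉ X)
    (rY : α.root ∉ Y) (rZ : α.root ∉ Z) (dXY : Disjoint X Y) (dXZ : Disjoint X Z)
    (dYZ : Disjoint Y Z) (hX : IsAllowed X) (hY : IsAllowed Y) (hXY : IsAllowed (X ∪ Y))
    (hZ : charge Z = 0) : polar s Z (X ∪ Y) = polar s Z X + polar s Z Y := by
  have h := hs.rel X Y Z rX rY rZ dXY dXZ dYZ hX hY hXY hZ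
  unfold polar
  rw [Finset.union_comm Z, Finset.union_comm Z, Finset.union_comm Z]
  have : s (X ∪ Y ∪ Z) = s (X ∪ Y) + s (Y ∪ Z) + s (X ∪ Z) - s X - s Y - s Z := by rw [h]; abel
  rw [this]; abel

theorem Soft.polar_add' (hs : α.Soft s) {X Y Z : Finset (Particle k a)} (rX : α.root ∉ X)
    (rY : α.root ∉ Y) (rZ : α.root ∉ Z) (dXY : Disjoint X Y) (dXZ : Disjoint X Z)
    (dYZ : Disjoint Y Z) (hX : IsAllowed X) (hY : IsAllowed Y) (hXY : IsAllowed (X ∪ Y))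
    (hZ : charge Z = 0) : polar s X (Y ∪ Z) = polar s X Y + polar s X Z := by
  have h := hs.rel X Y Z rX rY rZ dXY dXZ dYZ hX hY hXY hZ
  unfold polar
  rw [← Finset.union_assoc]
  have : s (X ∪ Y ∪ Z) = s (X ∪ Y) + s (Y ∪ Z) + s (X ∪ Z) - s X - s Y - s Z := by rw [h]; abel
  rw [this]; abel

theorem Soft.singleton (hs : α.Soft s) (p : Particle k a) : s {p} = 0 := hs.small _ (by simp)

variable (α s)

/-- The vector of the gap between the positions `g` and `g + 1`. -/
def gapVec (g : ℕ) : V := s (α.gapAt g)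

/-- The span of the vectors of the gaps inside the interval `[x, z)`. -/
def E (x z : ℕ) : Submodule ℝ V := Submodule.span ℝ (α.gapVec s '' {g | x ≤ g ∧ g + 1 < z})

/-- The vector of the gap between two intervals that touch each other. -/
def touch (x z x' z' : ℕ) : V :=
  (if z = x' then α.gapVec s (z - 1) else 0) + if z' = x then α.gapVec s (z' - 1) else 0

/-- The polarization on two intervals is the vector of the gap between them, up to the gaps inside
them. -/
def Link (x z x' z' : ℕ) : Prop :=
  polar s (α.Iv x z) (α.Iv x' z') - α.touch s x z x' z' ∈ α.E s x z ⊔ α.E s x' z'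

variable {α s}

theorem E_mono {x z x' z' : ℕ} (h1 : x' ≤ x) (h2 : z ≤ z') : α.E s x z ≤ α.E s x' z' := by
  apply Submodule.span_mono
  apply Set.image_mono
  intro g
  simp only [Set.mem_ofPred_eq]
  omega

theorem gapVec_mem_E {g x z : ℕ} (h1 : x ≤ g) (h2 : g + 1 < z) : α.gapVec s g ∈ α.E s x z :=
  Submodule.subset_span ⟨g, ⟨h1, h2⟩, rfl⟩

theorem touch_comm (x z x' z' : ℕ) : α.touch s x z x' z' = α.touch s x' z' x z := by
  unfold touch; rw [add_comm]

theorem Link.symm {x z x' z' : ℕ} (h : α.Link s x z x' z') : α.Link s x' z' x z := by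
  unfold Link at *
  rwa [polar_comm, touch_comm, sup_comm]

theorem touch_of_lt {x z x' z' : ℕ} (h : z < x') (h1 : x < z) (h2 : x' < z') :
    α.touch s x z x' z' = 0 := by
  rw [touch, if_neg (by omega), if_neg (by omega), add_zero]

theorem touch_of_eq {x z z' : ℕ} (h1 : x < z) (h2 : z < z') :
    α.touch s x z z z' = α.gapVec s (z - 1) := by
  rw [touch, if_pos rfl, if_neg (by omega), add_zero]

theorem touch_append {x m z x' z' : ℕ} (h1 : x < m) (h2 : m < z) (h3 : x' < z')
    (hd : z ≤ x' ∨ z' ≤ x) :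
    α.touch s x z x' z' = α.touch s x m x' z' + α.touch s m z x' z' := by
  unfold touch
  rw [if_neg (show m ≠ x' by omega), if_neg (show z' ≠ m by omega)]
  abel

theorem Link.append {x m z x' z' : ℕ} (h1 : x < m) (h2 : m < z) (h3 : x' < z')
    (hd : z ≤ x' ∨ z' ≤ x) (hp : polar s (α.Iv x z) (α.Iv x' z') =
      polar s (α.Iv x m) (α.Iv x' z') + polar s (α.Iv m z) (α.Iv x' z'))
    (hl : α.Link s x m x' z') (hr : α.Link s m z x' z') : α.Link s x z x' z' := by
  unfold Link at *
  rw [hp, touch_append h1 h2 h3 hd, add_sub_add_comm]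
  have e1 : α.E s x m ⊔ α.E s x' z' ≤ α.E s x z ⊔ α.E s x' z' :=
    sup_le_sup_right (E_mono le_rfl h2.le) _
  have e2 : α.E s m z ⊔ α.E s x' z' ≤ α.E s x z ⊔ α.E s x' z' :=
    sup_le_sup_right (E_mono h1.le le_rfl) _
  exact add_mem (e1 hl) (e2 hr)

/-- Both intervals on the left are allowed, the one on the right is neutral. -/
theorem Soft.link_append (hs : α.Soft s) {x m z x' z' : ℕ} (h1 : x < m) (h2 : m < z)
    (h3 : x' < z') (hd : z ≤ x' ∨ z' ≤ x) (hx : 1 ≤ x) (hx' : 1 ≤ x')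
    (a1 : IsAllowed (α.Iv x m)) (a2 : IsAllowed (α.Iv m z)) (a3 : IsAllowed (α.Iv x z))
    (hb : α.Bal x' z') (hl : α.Link s x m x' z') (hr : α.Link s m z x' z') :
    α.Link s x z x' z' := by
  refine Link.append h1 h2 h3 hd ?_ hl hr
  rw [polar_comm, ← Iv_append h1.le h2.le, hs.polar_add (root_notMem_Iv hx)
    (root_notMem_Iv (by omega)) (root_notMem_Iv hx') (Iv_disjoint (by omega))
    (Iv_disjoint (by omega)) (Iv_disjoint (by omega)) a1 a2 ?_ hb.charge, polar_comm s (α.Iv x' z'),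
    polar_comm s (α.Iv x' z')]
  rwa [Iv_append h1.le h2.le]

/-- The second interval on the left is neutral, the other two are allowed, with their union. -/
theorem Soft.link_append_right (hs : α.Soft s) {x m z x' z' : ℕ} (h1 : x < m) (h2 : m < z)
    (h3 : x' < z') (hd : z ≤ x' ∨ z' ≤ x) (hx : 1 ≤ x) (hx' : 1 ≤ x')
    (a1 : IsAllowed (α.Iv x m)) (hb : α.Bal m z) (a3 : IsAllowed (α.Iv x' z'))
    (a4 : IsAllowed (α.Iv x' z' ∪ α.Iv x m)) (hl : α.Link s x m x' z')
    (hr : α.Link s m z x' z') : α.Link s x z x' z' := by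
  refine Link.append h1 h2 h3 hd ?_ hl hr
  have hc := polar_comm s (α.Iv x' z')
  rw [polar_comm, ← Iv_append h1.le h2.le, hs.polar_add' (root_notMem_Iv hx')
    (root_notMem_Iv hx) (root_notMem_Iv (by omega)) (Iv_disjoint (by omega))
    (Iv_disjoint (by omega)) (Iv_disjoint (by omega)) a3 a1 a4 hb.charge,
    hc, hc]

/-- The first interval on the left is neutral, the other two are allowed, with their union. -/
theorem Soft.link_append_left (hs : α.Soft s) {x m z x' z' : ℕ} (h1 : x < m) (h2 : m < z)
    (h3 : x' < z') (hd : z ≤ x' ∨ z' ≤ x) (hx : 1 ≤ x) (hx' : 1 ≤ x')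
    (a1 : IsAllowed (α.Iv m z)) (hb : α.Bal x m) (a3 : IsAllowed (α.Iv x' z'))
    (a4 : IsAllowed (α.Iv x' z' ∪ α.Iv m z)) (hl : α.Link s x m x' z')
    (hr : α.Link s m z x' z') : α.Link s x z x' z' := by
  refine Link.append h1 h2 h3 hd ?_ hl hr
  rw [polar_comm, ← Iv_append h1.le h2.le, Finset.union_comm (α.Iv x m),
    hs.polar_add' (root_notMem_Iv hx')
    (root_notMem_Iv (by omega)) (root_notMem_Iv (by omega)) (Iv_disjoint (by omega))
    (Iv_disjoint (by omega)) (Iv_disjoint (by omega)) a3 a1 a4 hb.charge,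
    polar_comm s (α.Iv x' z'), polar_comm s (α.Iv x' z'), add_comm]

/-- The vector of a union is the polarization plus the vectors of the parts, and the gap at the
junction is a gap inside the union. -/
theorem mem_E_append {x m z : ℕ} (h1 : x < m) (h2 : m < z) (h : α.Link s x m m z)
    (hl : s (α.Iv x m) ∈ α.E s x m) (hr : s (α.Iv m z) ∈ α.E s m z) :
    s (α.Iv x z) ∈ α.E s x z := by
  unfold Link at h
  rw [touch_of_eq h1 h2, polar, Iv_append h1.le h2.le] at h
  have e1 : α.E s x m ≤ α.E s x z := E_mono le_rfl h2.le
  have e2 : α.E s m z ≤ α.E s x z := E_mono h1.le le_rfl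
  have e3 : α.gapVec s (m - 1) ∈ α.E s x z := gapVec_mem_E (by omega) (by omega)
  have h4 := add_mem (add_mem (add_mem (sup_le e1 e2 h) e3) (e1 hl)) (e2 hr)
  convert h4 using 1
  abel

theorem IsOpen.one_le {w : Particle k a} (hw : α.IsOpen w) : 1 ≤ α.pos w := by
  have h := hw.1
  rw [ne_eq, ← α.pos_inj, α.pos_root] at h
  omega

variable (α s)

/-- The vectors of the neutral intervals of length less than `m` lie in the span of their gaps. -/
def SpanLT (m : ℕ) : Prop := ∀ x z, 2 ≤ x → x < z → z ≤ 2 * k + a → α.Bal x z → z - x < m →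
  s (α.Iv x z) ∈ α.E s x z

variable {α s}

/-- The form in which constraints enter: for pieces that do not touch and whose own vectors lie in
their spans, a vanishing vector of the union leaves nothing in the polarization modulo these spans.
`link_of_eq` is the counterpart for touching pieces, where the union is itself the channel of the
gap. -/
theorem link_of_zero {x z x' z' : ℕ} (ht : α.touch s x z x' z' = 0)
    (h1 : s (α.Iv x z) ∈ α.E s x z) (h2 : s (α.Iv x' z') ∈ α.E s x' z')
    (h : s (α.Iv x z ∪ α.Iv x' z') = 0) : α.Link s x z x' z' := by
  unfold Link
  rw [ht, polar, h]
  have e1 : α.E s x z ≤ α.E s x z ⊔ α.E s x' z' := le_sup_left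
  have e2 : α.E s x' z' ≤ α.E s x z ⊔ α.E s x' z' := le_sup_right
  convert neg_mem (add_mem (e1 h1) (e2 h2)) using 1
  abel

theorem link_of_eq {x z x' z' : ℕ} (ht : α.touch s x z x' z' = s (α.Iv x z ∪ α.Iv x' z'))
    (h1 : s (α.Iv x z) ∈ α.E s x z) (h2 : s (α.Iv x' z') ∈ α.E s x' z') :
    α.Link s x z x' z' := by
  unfold Link
  rw [ht, polar]
  have e1 : α.E s x z ≤ α.E s x z ⊔ α.E s x' z' := le_sup_left
  have e2 : α.E s x' z' ≤ α.E s x z ⊔ α.E s x' z' := le_sup_right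
  convert neg_mem (add_mem (e1 h1) (e2 h2)) using 1
  abel

theorem Soft.single_mem_E (hs : α.Soft s) (p : Particle k a) :
    s (α.Iv (α.pos p) (α.pos p + 1)) ∈ α.E s (α.pos p) (α.pos p + 1) := by
  rw [Iv_pos, hs.singleton]; exact zero_mem _

/-- Either the two pieces are separated, and their union is a constraint of the kind `left`, or they
are adjacent, and their union is the channel of the gap. -/
theorem Soft.link_open_block (hs : α.Soft s) {m : ℕ} (hm : α.SpanLT s m) {w u : Particle k a}
    (hw : α.IsOpen w) (hu : α.IsStart u) (h : α.pos w < α.pos u)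
    (hb : (α.endPos w ≤ α.pos u ∧ α.Bal (α.endPos w) (α.pos u)) ∨ α.Bal (α.pos w + 1) (α.pos u))
    (hl : α.endPos u - α.pos u < m) :
    α.Link s (α.pos w) (α.pos w + 1) (α.pos u) (α.endPos u) := by
  have hlt := α.pos_lt_endPos u
  have h1 := hm _ _ hu.two_le hlt (α.endPos_le u) hu.bal hl
  rcases Nat.lt_or_ge (α.pos w + 1) (α.pos u) with h2 | h2
  · refine link_of_zero (touch_of_lt h2 (by omega) hlt) (hs.single_mem_E w) h1 ?_
    rw [Iv_pos]
    exact hs.cons _ (.left hw hu h2 hb)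
  · have h3 : α.pos w + 1 = α.pos u := by omega
    refine link_of_eq ?_ (hs.single_mem_E w) h1
    rw [h3, touch_of_eq h hlt, ← h3, Iv_pos, h3, show α.pos u - 1 = α.pos w by omega, gapVec,
      gapAt_pos h3.symm, gap_start hu]
    rfl

/-- A block directly after or directly before `af j` forms with it the channel of a gap; in all
other positions their union is a constraint of the kind `right`. -/
theorem Soft.link_right_block (hs : α.Soft s) {m : ℕ} (hm : α.SpanLT s m) {u : Particle k a}
    {j : Fin k} (hj : j ≠ α.first) (hu : α.IsStart u)
    (hn : ¬ (α.pos u ≤ α.r j ∧ α.r j < α.endPos u))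
    (hl : α.endPos u - α.pos u < m) :
    α.Link s (α.r j) (α.r j + 1) (α.pos u) (α.endPos u) := by
  have hlt := α.pos_lt_endPos u
  have h1 := hm _ _ hu.two_le hlt (α.endPos_le u) hu.bal hl
  have h4 := hs.single_mem_E (.af j : Particle k a)
  change s (α.Iv (α.r j) (α.r j + 1)) ∈ α.E s (α.r j) (α.r j + 1) at h4
  have h5 : α.Iv (α.r j) (α.r j + 1) = {.af j} := Iv_pos _
  by_cases h2 : α.pos u = α.r j + 1
  · refine link_of_eq ?_ h4 h1
    rw [h2, touch_of_eq (Nat.lt_succ_self _) (by omega), Nat.succ_sub_one, h5, ← h2]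
    have := gapAt_pos (u := .af j) h2
    rw [gapVec, show α.gapAt (α.r j) = _ from this, gap_start hu]
    rfl
  by_cases h3 : α.endPos u = α.r j
  · refine link_of_eq ?_ h4 h1
    rw [h3, touch_comm, touch_of_eq (by omega) (Nat.lt_succ_self _), h5, gapVec, gapAt_endPos hu h3,
      head, h3]
    rfl
  · refine link_of_zero ?_ h4 h1 ?_
    · rw [touch, if_neg (by omega), if_neg h3, add_zero]
    · rw [h5]
      exact hs.cons _ (.right hu hj (by rw [head, mem_Iv]; exact hn) h3 h2)

/-- Induction on the blocks of a balanced interval. -/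
theorem Bal.block_induction {P : ℕ → ℕ → Prop}
    (single : ∀ u, α.IsStart u → P (α.pos u) (α.endPos u))
    (cons : ∀ u z, α.IsStart u → α.endPos u < z → z ≤ 2 * k + a → α.Bal (α.endPos u) z →
      P (α.endPos u) z → P (α.pos u) z) {x z : ℕ} (h : α.Bal x z) (hx : 2 ≤ x) (hxz : x < z)
    (hz : z ≤ 2 * k + a) : P x z := by
  induction hn : z - x using Nat.strong_induction_on generalizing x with
  | _ n ih =>
    obtain ⟨u, hu, rfl, h1, h2⟩ := h.exists_start hx hxz hz
    rcases h1.eq_or_lt with rfl | h1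
    · exact single u hu
    · have := α.pos_lt_endPos u
      exact cons u z hu h1 hz h2 (ih _ (by omega) h2 (by omega) h1 rfl)

end
end MeliaOrdering

/-! ### Spans of neutral intervals -/

namespace MeliaOrdering
variable {α : MeliaOrdering k a}
variable {V : Type*} [AddCommGroup V] [Module ℝ V] {s : Finset (Particle k a) → V}

theorem isAllowed_Iv_single (p : Particle k a) : IsAllowed (α.Iv (α.pos p) (α.pos p + 1)) := by
  rw [Iv_pos]; exact isAllowed_singleton p

theorem Soft.link_append_bal (hs : α.Soft s) {x m z x' z' : ℕ} (h1 : x < m) (h2 : m < z)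
    (h3 : x' < z') (hd : z ≤ x' ∨ z' ≤ x) (hx : 1 ≤ x) (hx' : 1 ≤ x')
    (b1 : α.Bal x m) (b2 : α.Bal m z) (a3 : IsAllowed (α.Iv x' z')) (hl : α.Link s x m x' z')
    (hr : α.Link s m z x' z') : α.Link s x z x' z' :=
  hs.link_append_right h1 h2 h3 hd hx hx' (isAllowed_of_zero b1.charge) b2 a3
    (isAllowed_union_left (Iv_disjoint (by omega)) a3 b1.charge) hl hr

theorem Soft.link_right_lt (hs : α.Soft s) {m : ℕ} (hm : α.SpanLT s m) {j : Fin k}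
    (hj : j ≠ α.first) {x z : ℕ} (hb : α.Bal x z) (hx : 2 ≤ x) (hxz : x < z)
    (hz : z ≤ 2 * k + a) (hn : ¬ (x ≤ α.r j ∧ α.r j < z)) (hl : z - x < m) :
    α.Link s (α.r j) (α.r j + 1) x z := by
  refine Bal.block_induction (α := α) (P := fun x z => ¬ (x ≤ α.r j ∧ α.r j < z) → z - x < m →
    α.Link s (α.r j) (α.r j + 1) x z) ?_ ?_ hb hx hxz hz hn hl
  · intro u hu hn hl
    exact hs.link_right_block hm hj hu hn hl
  · intro u z hu h1 hz hb ih hn hl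
    have h2 := α.pos_lt_endPos u
    have h3 := hu.two_le
    have h4 := α.two_le_l hj
    have h5 := α.l_lt_r j
    exact (hs.link_append_bal (x' := α.r j) (z' := α.r j + 1) h2 h1 (Nat.lt_succ_self _)
      (by omega) (by omega) (by omega) hu.bal hb (isAllowed_Iv_single (.af j))
      (hs.link_right_block hm hj hu (by omega) (by omega)).symm
      (ih (by omega) (by omega)).symm).symm

theorem Soft.link_open_lt (hs : α.Soft s) {m : ℕ} (hm : α.SpanLT s m) {w : Particle k a}
    (hw : α.IsOpen w) {x z : ℕ} (hb : α.Bal x z) (hx : 2 ≤ x) (hxz : x < z)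
    (hz : z ≤ 2 * k + a) (hwx : α.pos w < x)
    (hc : (α.endPos w ≤ x ∧ α.Bal (α.endPos w) x) ∨ α.Bal (α.pos w + 1) x) (hl : z - x < m) :
    α.Link s (α.pos w) (α.pos w + 1) x z := by
  refine Bal.block_induction (α := α) (P := fun x z => α.pos w < x →
    ((α.endPos w ≤ x ∧ α.Bal (α.endPos w) x) ∨ α.Bal (α.pos w + 1) x) → z - x < m →
    α.Link s (α.pos w) (α.pos w + 1) x z) ?_ ?_ hb hx hxz hz hwx hc hl
  · intro u hu h hc hl
    exact hs.link_open_block hm hw hu h hc hl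
  · intro u z hu h1 hz hb ih h hc hl
    have h2 := α.pos_lt_endPos u
    have h3 := hu.two_le
    have h4 := hw.one_le
    refine (hs.link_append_bal h2 h1 (Nat.lt_succ_self _) (by omega) (by omega) (by omega)
      hu.bal hb (isAllowed_Iv_single w)
      (hs.link_open_block hm hw hu h hc (by omega)).symm
      (ih (by omega) ?_ (by omega)).symm).symm
    rcases hc with ⟨h5, h6⟩ | h6
    · exact .inl ⟨by omega, h6.append hu.bal h5 h2.le⟩
    · exact .inr (h6.append hu.bal (by omega) h2.le)

theorem Soft.link_pair (hs : α.Soft s) {j : Fin k} (hj : j ≠ α.first) :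
    α.Link s (α.l j) (α.l j + 1) (α.r j) (α.r j + 1) := by
  have h0 := α.l_lt_r j
  have h1 := hs.single_mem_E (.f j : Particle k a)
  have h2 := hs.single_mem_E (.af j : Particle k a)
  have e1 : α.Iv (α.l j) (α.l j + 1) = {.f j} := Iv_pos _
  have e2 : α.Iv (α.r j) (α.r j + 1) = {.af j} := Iv_pos _
  by_cases h : α.r j = α.l j + 1
  · refine link_of_eq ?_ h1 h2
    rw [e1, e2, h, touch_of_eq (by omega) (by omega), Nat.add_sub_cancel, gapVec]
    have : α.gapAt (α.l j) = _ := gapAt_pos (u := .f j) (v := .af j) h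
    rw [this, gap, tail, Finset.pair_comm]; rfl
  · refine link_of_zero (touch_of_lt (by omega) (by omega) (by omega)) h1 h2 ?_
    rw [e1, e2]
    exact hs.cons _ (.pair hj h)

theorem isAllowed_Iv_of_bal {x z : ℕ} (h : α.Bal x z) : IsAllowed (α.Iv x z) :=
  isAllowed_of_zero h.charge

theorem isAllowed_Iv_append {x m z : ℕ} (h1 : x ≤ m) (h2 : m ≤ z) (h : IsAllowed (α.Iv x m))
    (hb : α.Bal m z) : IsAllowed (α.Iv x z) := by
  rw [← Iv_append h1 h2]
  exact isAllowed_union_left (Iv_disjoint (by omega)) h hb.charge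

theorem isAllowed_Iv_append' {x m z : ℕ} (h1 : x ≤ m) (h2 : m ≤ z) (h : IsAllowed (α.Iv m z))
    (hb : α.Bal x m) : IsAllowed (α.Iv x z) := by
  rw [← Iv_append h1 h2, Finset.union_comm]
  exact isAllowed_union_left (Iv_disjoint (by omega)) h hb.charge

/-- Additivity reduces the claim to two single blocks. Blocks that are not siblings are constrained
as a whole. For siblings only the ends and sub-blocks of the first are constrained against the
second, so the first is cut into left end, interior and right end. The length bound `m` lets this
alternate with `Soft.spanLT`. -/
theorem Soft.link_bal_lt (hs : α.Soft s) {m : ℕ} (hm : α.SpanLT s m) {x z x' z' : ℕ}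
    (hb : α.Bal x z) (hb' : α.Bal x' z') (hx : 2 ≤ x) (hxz : x < z) (hzx : z ≤ x')
    (hxz' : x' < z') (hz' : z' ≤ 2 * k + a) (hl : z - x < m) (hl' : z' - x' < m) :
    α.Link s x z x' z' := by
  induction hn : (z - x) + (z' - x') using Nat.strong_induction_on generalizing x z x' z' with
  | _ n ih =>
  obtain ⟨v, hv, rfl, v1, v2⟩ := hb'.exists_start (by omega) hxz' hz'
  have v3 := α.pos_lt_endPos v
  rcases v1.lt_or_eq with v1 | rfl
  -- Detach the first block of the right interval; below, the same is done for the left one. The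
  -- induction runs over the sum of the two lengths.
  · refine (hs.link_append_bal v3 v1 hxz (by omega) (by omega) (by omega) hv.bal v2
      (isAllowed_Iv_of_bal hb) ?_ ?_).symm
    · exact (ih _ (by omega) hb hv.bal hx hxz hzx v3 (by omega) hl (by omega) rfl).symm
    · exact (ih _ (by omega) hb v2 hx hxz (by omega) v1 hz' hl (by omega) rfl).symm
  obtain ⟨u, hu, rfl, u1, u2⟩ := hb.exists_start (by omega) hxz (by omega)
  have u3 := α.pos_lt_endPos u
  rcases u1.lt_or_eq with u1 | rfl
  · refine hs.link_append_bal u3 u1 hxz' (by omega) (by omega) (by omega) hu.bal u2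
      (isAllowed_Iv_of_bal hb') ?_ ?_
    · exact ih _ (by omega) hu.bal hb' hx u3 (by omega) hxz' hz' (by omega) hl' rfl
    · exact ih _ (by omega) u2 hb' (by omega) u1 hzx hxz' hz' (by omega) hl' rfl
  have hsu := hm _ _ hx u3 (α.endPos_le u) hb hl
  have hsv := hm _ _ hv.two_le v3 (α.endPos_le v) hb' hl'
  -- Balance of the stretch in between means that the two blocks are siblings.
  by_cases hn : α.Bal (α.endPos u) (α.pos v)
  · rcases hu.cases with ⟨j, hj, rfl⟩ | ⟨g, rfl⟩
    · have hlr := α.l_lt_r j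
      simp only [show α.pos (.f j) = α.l j from rfl,
          show α.endPos (.f j) = α.r j + 1 from rfl] at *
      have e1 : α.pos (.f j) = α.l j := rfl
      have e2 : α.endPos (.f j) = α.r j + 1 := rfl
      have l1 := hs.link_open_block hm hu.isOpen hv (by rw [e1]; omega)
        (.inl ⟨by rw [e2]; omega, by rwa [e2]⟩) hl'
      rw [e1] at l1
      have l2 := hs.link_right_block hm hj hv (by omega) hl'
      have hb1 := α.bal_interior j
      have af : IsAllowed (α.Iv (α.l j) (α.l j + 1)) := isAllowed_Iv_single (.f j)
      have aaf : IsAllowed (α.Iv (α.r j) (α.r j + 1)) := isAllowed_Iv_single (.af j)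
      have l3 : α.Link s (α.l j) (α.r j) (α.pos v) (α.endPos v) := by
        rcases Nat.lt_or_ge (α.l j + 1) (α.r j) with h5 | h5
        · refine hs.link_append (Nat.lt_succ_self _) h5 v3 (by omega) (by omega) (by omega) af
            (isAllowed_Iv_of_bal hb1) (isAllowed_Iv_append (by omega) (by omega) af hb1) hb' l1 ?_
          exact ih _ (by omega) hb1 hb' (by omega) h5 (by omega) v3 (by omega) (by omega) hl' rfl
        · rwa [show α.r j = α.l j + 1 by omega]
      refine hs.link_append hlr (Nat.lt_succ_self _) v3 (by omega) (by omega) (by omega) ?_ aaf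
        (isAllowed_Iv_of_bal hb) hb' l3 l2
      rcases Nat.lt_or_ge (α.l j + 1) (α.r j) with h5 | h5
      · exact isAllowed_Iv_append (by omega) (by omega) af hb1
      · rwa [show α.r j = α.l j + 1 by omega]
    · exact hs.link_open_block hm hu.isOpen hv (by omega) (.inl ⟨hzx, hn⟩) hl'
  · have hne : α.endPos u ≠ α.pos v := by
      intro h
      rw [h] at hn
      exact hn (Bal.self _)
    exact link_of_zero (touch_of_lt (by omega) u3 v3) hsu hsv
      (hs.cons _ (.apart hu hv hzx hn))

/-- Induction on the length: an interval of several blocks is its first block and the rest, and a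
pair is built from its left end, its interior and its right end. The links needed at each junction
concern shorter neutral intervals, except for the one between the two ends, which is a constraint or
a gap. -/
theorem Soft.spanLT (hs : α.Soft s) (m : ℕ) : α.SpanLT s m := by
  induction m with
  | zero => intro x z _ _ _ _ h; omega
  | succ m ih =>
    intro x z hx hxz hz hb hl
    obtain ⟨u, hu, rfl, u1, u2⟩ := hb.exists_start hx hxz hz
    have u3 := α.pos_lt_endPos u
    rcases u1.lt_or_eq with u1 | rfl
    · exact mem_E_append u3 u1 (hs.link_bal_lt ih hu.bal u2 hx u3 le_rfl u1 hz (by omega)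
        (by omega)) (ih _ _ hx u3 (by omega) hu.bal (by omega))
        (ih _ _ (by omega) u1 hz u2 (by omega))
    · rcases hu.cases with ⟨j, hj, rfl⟩ | ⟨g, rfl⟩
      · have hlr := α.l_lt_r j
        simp only [show α.pos (.f j) = α.l j from rfl,
          show α.endPos (.f j) = α.r j + 1 from rfl] at *
        have e1 : α.pos (.f j) = α.l j := rfl
        have e2 : α.endPos (.f j) = α.r j + 1 := rfl
        have hb1 := α.bal_interior j
        have af : IsAllowed (α.Iv (α.l j) (α.l j + 1)) := isAllowed_Iv_single (.f j)
        have aaf : IsAllowed (α.Iv (α.r j) (α.r j + 1)) := isAllowed_Iv_single (.af j)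
        have s1 := hs.single_mem_E (.f j : Particle k a)
        have s2 := hs.single_mem_E (.af j : Particle k a)
        have l1 := hs.link_pair hj
        rw [e1] at s1
        rcases Nat.lt_or_ge (α.l j + 1) (α.r j) with h5 | h5
        · have l2 := hs.link_open_lt ih hu.isOpen hb1 (by omega) h5 (by omega)
            (by rw [e1]; omega) (.inr (Bal.self _)) (by omega)
          have l3 := hs.link_right_lt ih hj hb1 (by omega) h5 (by omega) (by omega) (by omega)
          rw [e1] at l2
          have s3 := mem_E_append (Nat.lt_succ_self _) h5 l2 s1
            (ih _ _ (by omega) h5 (by omega) hb1 (by omega))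
          refine mem_E_append hlr (Nat.lt_succ_self _) ?_ s3 s2
          -- Here both ends are charged, but the interior is neutral and the ends together are
          -- neutral, so additivity is available.
          refine hs.link_append_right (Nat.lt_succ_self _) h5 (Nat.lt_succ_self _) (by omega)
            (by omega) (by omega) af hb1 aaf ?_ l1 l3.symm
          rw [e1.symm, Iv_pos, show α.r j = α.pos (.af j) from rfl, Iv_pos]
          refine isAllowed_of_zero ?_
          rw [charge_union (by simp), charge_f, charge_af, neg_add_cancel]
        · have h6 : α.r j = α.l j + 1 := by omega
          refine mem_E_append hlr (Nat.lt_succ_self _) ?_ ?_ s2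
          · rw [← h6] at l1; exact l1
          · rw [← h6] at s1; exact s1
      · have : α.endPos (.adj g) = α.pos (.adj g) + 1 := rfl
        rw [this]
        exact hs.single_mem_E _

theorem Soft.bal_mem_E (hs : α.Soft s) {x z : ℕ} (hb : α.Bal x z) (hx : 2 ≤ x) (hxz : x < z)
    (hz : z ≤ 2 * k + a) : s (α.Iv x z) ∈ α.E s x z :=
  hs.spanLT _ x z hx hxz hz hb (Nat.lt_succ_self _)

theorem Soft.link_bal (hs : α.Soft s) {x z x' z' : ℕ} (hb : α.Bal x z) (hb' : α.Bal x' z')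
    (hx : 2 ≤ x) (hxz : x < z) (hz : z ≤ 2 * k + a) (hx' : 2 ≤ x') (hxz' : x' < z')
    (hz' : z' ≤ 2 * k + a) (hd : z ≤ x' ∨ z' ≤ x) : α.Link s x z x' z' := by
  rcases hd with hd | hd
  · exact hs.link_bal_lt (hs.spanLT (2 * k + a)) hb hb' hx hxz hd hxz' hz' (by omega) (by omega)
  · exact (hs.link_bal_lt (hs.spanLT (2 * k + a)) hb' hb hx' hxz' hd hxz hz (by omega)
      (by omega)).symm

theorem Soft.link_right (hs : α.Soft s) {j : Fin k} (hj : j ≠ α.first) {x z : ℕ}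
    (hb : α.Bal x z) (hx : 2 ≤ x) (hxz : x < z) (hz : z ≤ 2 * k + a)
    (hn : ¬ (x ≤ α.r j ∧ α.r j < z)) : α.Link s (α.r j) (α.r j + 1) x z :=
  hs.link_right_lt (hs.spanLT (2 * k + a)) hj hb hx hxz hz hn (by omega)

theorem Soft.link_open (hs : α.Soft s) {w : Particle k a} (hw : α.IsOpen w) {x z : ℕ}
    (hb : α.Bal x z) (hx : 2 ≤ x) (hxz : x < z) (hz : z ≤ 2 * k + a) (hwx : α.pos w < x)
    (hc : (α.endPos w ≤ x ∧ α.Bal (α.endPos w) x) ∨ α.Bal (α.pos w + 1) x) :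
    α.Link s (α.pos w) (α.pos w + 1) x z :=
  hs.link_open_lt (hs.spanLT (2 * k + a)) hw hb hx hxz hz hwx hc (by omega)

end MeliaOrdering

/-! ### Wedge products -/

section Exterior

open ExteriorAlgebra

variable {V : Type*} [AddCommGroup V] [Module ℝ V]

/-- The vectors that annihilate `x`. -/
def kills (x : ExteriorAlgebra ℝ V) : Submodule ℝ V :=
  LinearMap.ker ((LinearMap.mulRight ℝ x).comp (ι ℝ))

theorem mem_kills {x : ExteriorAlgebra ℝ V} {v : V} : v ∈ kills x ↔ ι ℝ v * x = 0 := by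
  simp [kills]

theorem kills_mul (x y : ExteriorAlgebra ℝ V) : kills x ≤ kills (x * y) := by
  intro v hv
  rw [mem_kills] at *
  rw [← mul_assoc, hv, zero_mul]

theorem kills_smul (c : ℝ) (x : ExteriorAlgebra ℝ V) : kills x ≤ kills (c • x) := by
  intro v hv
  rw [mem_kills] at *
  rw [mul_smul_comm, hv, smul_zero]

theorem ι_mul_swap (v w : V) (x : ExteriorAlgebra ℝ V) :
    ι ℝ v * (ι ℝ w * x) = - (ι ℝ w * (ι ℝ v * x)) := by
  have h : ι ℝ v * ι ℝ w = - (ι ℝ w * ι ℝ v) :=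
    eq_neg_of_add_eq_zero_left (ι_add_mul_swap v w)
  rw [← mul_assoc, h, neg_mul, mul_assoc]

theorem kills_ι_mul (w : V) (x : ExteriorAlgebra ℝ V) : kills x ≤ kills (ι ℝ w * x) := by
  intro v hv
  rw [mem_kills] at *
  rw [ι_mul_swap, hv, mul_zero, neg_zero]

theorem ι_mul_list_prod {v : V} {L : List V} (h : v ∈ L) : ι ℝ v * (L.map (ι ℝ)).prod = 0 := by
  induction L with
  | nil => simp at h
  | cons w L ih =>
    rw [List.map_cons, List.prod_cons]
    rcases List.mem_cons.1 h with rfl | h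
    · rw [← mul_assoc, ι_sq_zero, zero_mul]
    · rw [ι_mul_swap, ih h, mul_zero, neg_zero]

end Exterior

/-! ### Wedge products attached to branches -/

namespace PlaneTree

open ExteriorAlgebra

variable {V : Type*} [AddCommGroup V] [Module ℝ V] (s : Finset (Particle k a) → V)

/-- A branch form is homogeneous, so a vector passes through it at the cost of a sign. -/
theorem kills_branchForm_mul (t : PlaneTree k a) (x : ExteriorAlgebra ℝ V) :
    kills x ≤ kills (t.branchForm s * x) := by
  intro v hv
  rw [mem_kills] at *
  have h := branchForm_mul_ι s t v
  have h2 : ι ℝ v * t.branchForm s =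
      (-1 : ℝ) ^ (t.leaves.length + 1) • (t.branchForm s * ι ℝ v) := by
    rw [h, ← smul_assoc, smul_eq_mul, ← mul_pow]; simp
  rw [← mul_assoc, h2, smul_mul_assoc, mul_assoc, hv, mul_zero, smul_zero]

theorem kills_node_left (l r : PlaneTree k a) :
    kills (l.branchForm s) ≤ kills ((node l r).branchForm s) := by
  rw [branchForm]
  exact (kills_mul _ _).trans ((kills_ι_mul _ _).trans (kills_smul _ _))

theorem kills_node_right (l r : PlaneTree k a) :
    kills (r.branchForm s) ≤ kills ((node l r).branchForm s) := by
  rw [branchForm]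
  exact (kills_branchForm_mul s l _).trans ((kills_ι_mul _ _).trans (kills_smul _ _))

/-- An unspecified scalar suffices for annihilators and vanishing, and spares the assumption that
the leaves are distinct, which the exact sign requires. -/
theorem branchForm_swap (l r : PlaneTree k a) :
    ∃ ε : ℝ, (node r l).branchForm s = ε • (node l r).branchForm s := by
  have hs : (node r l).leafSet = (node l r).leafSet := by
    ext p; simp [leafSet, leaves, or_comm]
  have hv : vertexSign l r * vertexSign l r = 1 := by
    rw [vertexSign, ← mul_pow]; simp
  refine ⟨vertexSign r l * (-1 : ℝ) ^ ((r.leaves.length + 1) * (l.leaves.length + 1)) *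
    vertexSign l r, ?_⟩
  rw [branchForm, branchForm, hs, branchForm_comm s r l, mul_smul_comm, ← smul_assoc, ← smul_assoc,
    smul_eq_mul, smul_eq_mul, mul_assoc (_ * _), hv, mul_one]

theorem kills_node_swap (l r : PlaneTree k a) :
    kills ((node l r).branchForm s) ≤ kills ((node r l).branchForm s) := by
  obtain ⟨ε, h⟩ := branchForm_swap s l r
  rw [h]
  exact kills_smul _ _

/-- The root channel of a branch is a factor of its form; for a single leaf the vector itself is
zero. -/
theorem leafSet_mem_kills (hs : ∀ p, s {p} = 0) (t : PlaneTree k a) :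
    s t.leafSet ∈ kills (t.branchForm s) := by
  cases t with
  | leaf p =>
    have : (leaf p : PlaneTree k a).leafSet = {p} := by simp [leafSet, leaves]
    rw [this, hs]; exact zero_mem _
  | node l r =>
    rw [branchForm]
    refine kills_smul _ _ ?_
    rw [mem_kills, ← mul_assoc, ι_sq_zero, zero_mul]

theorem leafSet_node (l r : PlaneTree k a) : (node l r).leafSet = l.leafSet ∪ r.leafSet := by
  simp [leafSet, leaves]

/-- The wedge product attached to a vertex, when the polarization is known up to vectors that
annihilate one of the branches. -/
theorem branchForm_node_mul (hs : ∀ p, s {p} = 0) (l r : PlaneTree k a)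
    (x : ExteriorAlgebra ℝ V) {y : V}
    (h : MeliaOrdering.polar s l.leafSet r.leafSet - y ∈
      kills (l.branchForm s) ⊔ kills (r.branchForm s * x)) :
    (node l r).branchForm s * x =
      (-1 : ℝ) ^ inversions l.leaves r.leaves •
        (l.branchForm s * (ι ℝ y * (r.branchForm s * x))) := by
  have h1 : kills (l.branchForm s) ⊔ kills (r.branchForm s * x) ≤
      kills (l.branchForm s * (r.branchForm s * x)) :=
    sup_le (kills_mul _ _) (kills_branchForm_mul s l _)
  have h2 := h1 h
  have h3 := (kills_mul _ _ : _ ≤ kills (l.branchForm s * (r.branchForm s * x)))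
    (leafSet_mem_kills s hs l)
  have h4 := kills_branchForm_mul s l (r.branchForm s * x)
    (kills_mul _ x (leafSet_mem_kills s hs r))
  -- The vector of the union is the polarization plus the vectors of both branches, and these are
  -- annihilated by the branch forms.
  have h5 : s (node l r).leafSet - y ∈ kills (l.branchForm s * (r.branchForm s * x)) := by
    have := add_mem (add_mem h2 h3) h4
    rw [leafSet_node]
    convert this using 1
    rw [MeliaOrdering.polar]; abel
  rw [mem_kills, map_sub, sub_mul, sub_eq_zero] at h5
  rw [branchForm, smul_mul_assoc, mul_assoc, mul_assoc (l.branchForm s), h5,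
    ← mul_assoc (l.branchForm s) (ι ℝ y), branchForm_mul_ι, smul_mul_assoc, ← smul_assoc,
    smul_eq_mul, vertexSign, ← pow_add, add_assoc, mul_assoc]

/-- The number of inversions of a list of particles. -/
def totalInv : List (Particle k a) → ℕ
  | [] => 0
  | p :: u => inversions [p] u + totalInv u

theorem totalInv_append (u v : List (Particle k a)) :
    totalInv (u ++ v) = totalInv u + totalInv v + inversions u v := by
  induction u with
  | nil => simp [totalInv, inversions]
  | cons p u ih =>
    have := inversions_append_left [p] u v
    rw [List.singleton_append] at this
    rw [List.cons_append, totalInv, totalInv, ih, inversions_append_right, this]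
    ring

/-- The sign of the ordering of the leaves. -/
def sign (t : PlaneTree k a) : ℝ := (-1) ^ totalInv t.leaves

/-- After the vertex vector has moved past the left branch, the remaining part of `vertexSign` is
the parity of the inversions between the branches. Hence these signs multiply to the parity of the
ordering, whatever the tree. -/
theorem sign_node (l r : PlaneTree k a) :
    (node l r).sign = (-1) ^ inversions l.leaves r.leaves * (l.sign * r.sign) := by
  rw [sign, leaves, totalInv_append, sign, sign]; ring

theorem sign_leaf (p : Particle k a) : (leaf p).sign = 1 := by
  simp [sign, leaves, totalInv, inversions]

end PlaneTree

/-! ### Wedge products of consecutive gaps -/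

namespace MeliaOrdering

open ExteriorAlgebra PlaneTree

variable (α : MeliaOrdering k a)
variable {V : Type*} [AddCommGroup V] [Module ℝ V] (s : Finset (Particle k a) → V)

/-- The wedge product of the vectors of consecutive gaps. -/
def Z (x z : ℕ) : ExteriorAlgebra ℝ V :=
  (((List.range' x (z - x)).map (α.gapVec s)).map (ι ℝ)).prod

variable {α s}

theorem Z_self (x : ℕ) : α.Z s x x = 1 := by simp [Z]

theorem Z_mul {x y z : ℕ} (h1 : x ≤ y) (h2 : y ≤ z) : α.Z s x y * α.Z s y z = α.Z s x z := by
  unfold Z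
  rw [← List.prod_append, ← List.map_append, ← List.map_append]
  congr 3
  obtain ⟨m, rfl⟩ := Nat.exists_eq_add_of_le h1
  obtain ⟨n, rfl⟩ := Nat.exists_eq_add_of_le h2
  rw [Nat.add_sub_cancel_left, Nat.add_sub_cancel_left, List.range'_append_1]
  congr 1; omega

theorem Z_succ (x : ℕ) : α.Z s x (x + 1) = ι ℝ (α.gapVec s x) := by simp [Z]

theorem ι_mul_Z {x z : ℕ} (hx : 1 ≤ x) (h : x ≤ z) :
    ι ℝ (α.gapVec s (x - 1)) * α.Z s x z = α.Z s (x - 1) z := by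
  have := Z_succ (α := α) (s := s) (x - 1)
  rw [Nat.sub_add_cancel hx] at this
  rw [← this, Z_mul (by omega) h]

/-- An interval of positions `[x, z)` has its last gap at `z - 2`, so the product up to `z - 1`
contains each of its gaps as a factor. -/
theorem E_le_kills (x z : ℕ) : α.E s x z ≤ kills (α.Z s x (z - 1)) := by
  rw [E, Submodule.span_le]
  rintro _ ⟨g, ⟨h1, h2⟩, rfl⟩
  rw [SetLike.mem_coe, mem_kills]
  apply ι_mul_list_prod
  refine List.mem_map.2 ⟨g, ?_, rfl⟩
  rw [List.mem_range'_1]; omega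

end MeliaOrdering

/-! ### Trees drawn in the plane -/

/-- Two single flavours whose sum is zero or a single flavour must cancel. These are the only ways
in which two branches can meet at a vertex with allowed channels. -/
theorem charge_cases {X Y : Finset (Particle k a)} (h : Disjoint X Y) (hX : IsAllowed X)
    (hY : IsAllowed Y) (hXY : IsAllowed (X ∪ Y)) : charge X = 0 ∨ charge Y = 0 ∨
    ∃ j, (charge X = Pi.single j 1 ∧ charge Y = - Pi.single j 1) ∨
      (charge X = - Pi.single j 1 ∧ charge Y = Pi.single j 1) := by
  by_contra hc
  push Not at hc
  obtain ⟨h1, h2, h3⟩ := hc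
  rw [isAllowed_iff] at hX hY hXY
  obtain ⟨i, hi⟩ := hX.resolve_left h1
  obtain ⟨j, hj⟩ := hY.resolve_left h2
  rw [charge_union h] at hXY
  have hs : ∀ m : Fin k, ∀ x : Fin k → ℤ, (x = Pi.single m 1 ∨ x = - Pi.single m 1) →
      (∀ i, x i = if i = m then x m else 0) ∧ (x m = 1 ∨ x m = -1) := by
    rintro m x (rfl | rfl) <;> refine ⟨fun i => ?_, by simp⟩ <;> by_cases him : i = m <;>
      simp [him]
  obtain ⟨xi, xi'⟩ := hs i _ hi
  obtain ⟨xj, xj'⟩ := hs j _ hj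
  by_cases hij : i = j
  · subst hij
    rcases hi with hi | hi <;> rcases hj with hj | hj
    · rcases hXY with hX | ⟨m, hm⟩
      · have := congrFun hX i; simp [hi, hj] at this
      · have := (hs m _ hm).1 i
        have h4 := (hs m _ hm).2
        have h5 := (hs m _ hm).1 m
        simp only [hi, hj, Pi.add_apply, Pi.single_eq_same] at this h4
        split_ifs at this with him
        · subst him; simp at h4
        · simp at this
    · exact (h3 i).1 hi hj
    · exact (h3 i).2 hi hj
    · rcases hXY with hX | ⟨m, hm⟩
      · have := congrFun hX i; simp [hi, hj] at this
      · have := (hs m _ hm).1 i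
        have h4 := (hs m _ hm).2
        simp only [hi, hj, Pi.add_apply, Pi.neg_apply, Pi.single_eq_same] at this h4
        split_ifs at this with him
        · subst him; simp at h4
        · simp at this
  -- For different flavours the sum has two non-zero entries, too many for an allowed channel.
  · have ei : (charge X + charge Y) i ≠ 0 := by
      rw [Pi.add_apply, xj i, if_neg hij]; omega
    have ej : (charge X + charge Y) j ≠ 0 := by
      rw [Pi.add_apply, xi j, if_neg (Ne.symm hij)]; omega
    rcases hXY with hX | ⟨m, hm⟩
    · exact ei (congrFun hX i)
    · have h4 := (hs m _ hm).1
      have e1 := h4 i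
      have e2 := h4 j
      split_ifs at e1 e2 with h6 h7
      · exact hij (h6.trans h7.symm)
      · exact ej e2
      · exact ei e1
      · exact ei e1

namespace MeliaOrdering

open PlaneTree

variable {α : MeliaOrdering k a}

theorem charge_Iv_apply {x z : ℕ} (j : Fin k) : charge (α.Iv x z) j =
    (if x ≤ α.l j ∧ α.l j < z then 1 else 0) - if x ≤ α.r j ∧ α.r j < z then 1 else 0 := by
  simp only [charge, mem_Iv, l, r]
  congr

/-- The partner of the surplus right end is to the left of the interval. As brackets do not cross,
any other pair lies wholly before or wholly after this right end within the interval, so both pieces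
are balanced. `of_charge_Iv_pos` is the mirror image. -/
theorem of_charge_Iv_neg {x z : ℕ} {j : Fin k} (h : charge (α.Iv x z) = - Pi.single j 1) :
    α.l j < x ∧ x ≤ α.r j ∧ α.r j < z ∧ α.Bal x (α.r j) ∧ α.Bal (α.r j + 1) z := by
  have hl := α.l_lt_r j
  have hj := congrFun h j
  rw [charge_Iv_apply, Pi.neg_apply, Pi.single_eq_same] at hj
  have h1 : α.l j < x ∧ x ≤ α.r j ∧ α.r j < z := by
    split_ifs at hj <;> omega
  have hb : ∀ i, i ≠ j → ((x ≤ α.l i ∧ α.l i < z) ↔ (x ≤ α.r i ∧ α.r i < z)) := by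
    intro i hi
    have h2 := congrFun h i
    rw [charge_Iv_apply, Pi.neg_apply, Pi.single_eq_of_ne hi] at h2
    split_ifs at h2 with h3 h4 h4 <;> tauto
  have hp := α.bal_pair j
  refine ⟨h1.1, h1.2.1, h1.2.2, fun i => ?_, fun i => ?_⟩ <;>
  · by_cases hi : i = j
    · subst hi; omega
    · have e1 := hb i hi
      have e2 := hp i
      have e3 := α.l_lt_r i
      have e4 : α.r i ≠ α.r j := fun h => hi (α.r_inj.1 h)
      have e5 := α.l_ne_r i j
      omega

theorem of_charge_Iv_pos {x z : ℕ} {j : Fin k} (h : charge (α.Iv x z) = Pi.single j 1) :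
    x ≤ α.l j ∧ α.l j < z ∧ z ≤ α.r j ∧ α.Bal x (α.l j) ∧ α.Bal (α.l j + 1) z := by
  have hl := α.l_lt_r j
  have hj := congrFun h j
  rw [charge_Iv_apply, Pi.single_eq_same] at hj
  have h1 : x ≤ α.l j ∧ α.l j < z ∧ z ≤ α.r j := by
    split_ifs at hj <;> omega
  have hb : ∀ i, i ≠ j → ((x ≤ α.l i ∧ α.l i < z) ↔ (x ≤ α.r i ∧ α.r i < z)) := by
    intro i hi
    have h2 := congrFun h i
    rw [charge_Iv_apply, Pi.single_eq_of_ne hi] at h2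
    split_ifs at h2 with h3 h4 h4 <;> tauto
  have hp := α.bal_pair j
  refine ⟨h1.1, h1.2.1, h1.2.2, fun i => ?_, fun i => ?_⟩ <;>
  · by_cases hi : i = j
    · subst hi; omega
    · have e1 := hb i hi
      have e2 := hp i
      have e3 := α.l_lt_r i
      have e4 : α.l i ≠ α.l j := fun h => hi (α.l_inj.1 h)
      have e5 := α.l_ne_r j i
      omega

/-- The tree is drawn in the plane with the ordering `α`, the leaves being the particles at the
positions from `x` to `z`. -/
def Drawn (α : MeliaOrdering k a) (t : PlaneTree k a) (x z : ℕ) : Prop :=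
  x < z ∧ t.leaves.map α.pos = List.range' x (z - x)

theorem leaves_ne_nil (t : PlaneTree k a) : t.leaves ≠ [] := by
  induction t with
  | leaf p => simp [leaves]
  | node l r hl hr => simp [leaves, hl]

theorem Drawn.leafSet {t : PlaneTree k a} {x z : ℕ} (h : α.Drawn t x z) :
    t.leafSet = α.Iv x z := by
  have h1 := h.1
  ext p
  rw [PlaneTree.leafSet, List.mem_toFinset, mem_Iv]
  have : p ∈ t.leaves ↔ α.pos p ∈ t.leaves.map α.pos := by
    rw [List.mem_map]
    exact ⟨fun h => ⟨p, h, rfl⟩, fun ⟨q, h, e⟩ => (α.pos_inj.1 e) ▸ h⟩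
  rw [this, h.2, List.mem_range'_1]
  omega

theorem Drawn.le {t : PlaneTree k a} {x z : ℕ} (h : α.Drawn t x z) : z ≤ 2 * k + a := by
  have h1 := h.1
  have h2 : z - 1 ∈ t.leaves.map α.pos := by rw [h.2, List.mem_range'_1]; omega
  obtain ⟨p, -, hp⟩ := List.mem_map.1 h2
  have := α.pos_lt p
  omega

theorem Drawn.node {l r : PlaneTree k a} {x y z : ℕ} (hl : α.Drawn l x y) (hr : α.Drawn r y z) :
    α.Drawn (.node l r) x z := by
  have h1 := hl.1
  have h2 := hr.1
  refine ⟨by omega, ?_⟩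
  rw [leaves, List.map_append, hl.2, hr.2]
  obtain ⟨m, rfl⟩ := Nat.exists_eq_add_of_le h1.le
  obtain ⟨n, rfl⟩ := Nat.exists_eq_add_of_le h2.le
  rw [Nat.add_sub_cancel_left, Nat.add_sub_cancel_left, List.range'_append_1]
  congr 1; omega

theorem Drawn.of_node {l r : PlaneTree k a} {x z : ℕ} (h : α.Drawn (.node l r) x z) :
    ∃ y, α.Drawn l x y ∧ α.Drawn r y z := by
  obtain ⟨h1, h2⟩ := h
  have hl := List.length_pos_of_ne_nil (leaves_ne_nil l)
  have hr := List.length_pos_of_ne_nil (leaves_ne_nil r)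
  have hlen := congrArg List.length h2
  rw [List.length_map, List.length_range', leaves, List.length_append] at hlen
  have h3 : List.range' x (z - x) = List.range' x l.leaves.length ++
      List.range' (x + l.leaves.length) r.leaves.length := by
    rw [List.range'_append_1, hlen]
  rw [leaves, List.map_append, h3] at h2
  obtain ⟨e1, e2⟩ := List.append_inj h2 (by simp)
  refine ⟨x + l.leaves.length, ⟨by omega, by rw [e1]; congr 1; omega⟩,
    ⟨by omega, by rw [e2]; congr 1; omega⟩⟩

theorem drawn_leaf (p : Particle k a) : α.Drawn (.leaf p) (α.pos p) (α.pos p + 1) := by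
  simp [Drawn, leaves]

theorem Drawn.of_leaf {p : Particle k a} {x z : ℕ} (h : α.Drawn (.leaf p) x z) :
    x = α.pos p ∧ z = α.pos p + 1 := by
  obtain ⟨h1, h2⟩ := h
  have hlen := congrArg List.length h2
  simp [leaves] at hlen
  rw [← hlen] at h2
  simp [leaves] at h2
  omega

/-- The tree can be drawn in the plane with the ordering `α`, the leaves being the particles at
the positions from `x` to `z`. -/
def Planar (α : MeliaOrdering k a) (t : PlaneTree k a) (x z : ℕ) : Prop :=
  ∃ t' m, Flips t t' m ∧ α.Drawn t' x z

theorem flips_refl (t : PlaneTree k a) : Flips t t 0 := by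
  induction t with
  | leaf p => exact .leaf p
  | node l r hl hr => exact .keep hl hr

theorem Drawn.planar {t : PlaneTree k a} {x z : ℕ} (h : α.Drawn t x z) : α.Planar t x z :=
  ⟨t, 0, flips_refl t, h⟩

theorem Planar.node {l r : PlaneTree k a} {x y z : ℕ} (hl : α.Planar l x y)
    (hr : α.Planar r y z) : α.Planar (.node l r) x z := by
  obtain ⟨l', i, h1, h2⟩ := hl
  obtain ⟨r', j, h3, h4⟩ := hr
  exact ⟨_, _, .keep h1 h3, h2.node h4⟩

theorem Planar.swap {l r : PlaneTree k a} {x z : ℕ} (h : α.Planar (.node l r) x z) :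
    α.Planar (.node r l) x z := by
  obtain ⟨t', m, h1, h2⟩ := h
  cases h1 with
  | keep h3 h4 => exact ⟨_, _, .flip h4 h3, h2⟩
  | flip h3 h4 => exact ⟨_, _, .keep h4 h3, h2⟩

theorem flips_leafSet {t t' : PlaneTree k a} {m : ℕ} (h : Flips t t' m) :
    t'.leafSet = t.leafSet := List.toFinset_eq_of_perm _ _ h.perm

theorem Planar.leafSet {t : PlaneTree k a} {x z : ℕ} (h : α.Planar t x z) :
    t.leafSet = α.Iv x z := by
  obtain ⟨t', m, h1, h2⟩ := h
  rw [← flips_leafSet h1, h2.leafSet]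

theorem Planar.lt {t : PlaneTree k a} {x z : ℕ} (h : α.Planar t x z) : x < z := by
  obtain ⟨t', m, h1, h2⟩ := h; exact h2.1

theorem Planar.le {t : PlaneTree k a} {x z : ℕ} (h : α.Planar t x z) : z ≤ 2 * k + a := by
  obtain ⟨t', m, h1, h2⟩ := h; exact h2.le

variable {V : Type*} [AddCommGroup V] [Module ℝ V] {s : Finset (Particle k a) → V}

/-- The interval is neutral, or it has the charge of an anti-fundamental particle in it, other than
the first one. -/
def Closed (α : MeliaOrdering k a) (x z : ℕ) : Prop := α.Bal x z ∨
  ∃ j, j ≠ α.first ∧ x ≤ α.r j ∧ α.r j < z ∧ α.Bal x (α.r j) ∧ α.Bal (α.r j + 1) z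

theorem Closed.isAllowed {x z : ℕ} (h : α.Closed x z) : IsAllowed (α.Iv x z) := by
  rcases h with h | ⟨j, -, h1, h2, h3, h4⟩
  · exact isAllowed_Iv_of_bal h
  · refine isAllowed_Iv_append (by omega) (by omega) (m := α.r j + 1) ?_ h4
    exact isAllowed_Iv_append' h1 (by omega) (isAllowed_Iv_single (.af j)) h3

/-- A closed interval with charge consists of a neutral piece, a right end and a neutral piece, all
of which have been linked to neutral intervals. This does not work for left ends, because `left`
only constrains them against some of the blocks. -/
theorem Soft.link_closed (hs : α.Soft s) {x z x' z' : ℕ} (hb : α.Bal x z) (hx : 2 ≤ x)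
    (hxz : x < z) (hz : z ≤ 2 * k + a) (hc : α.Closed x' z') (hx' : 2 ≤ x') (hxz' : x' < z')
    (hz' : z' ≤ 2 * k + a) (hd : z ≤ x' ∨ z' ≤ x) : α.Link s x' z' x z := by
  rcases hc with h | ⟨j, hj, h1, h2, h3, h4⟩
  · exact hs.link_bal h hb hx' hxz' hz' hx hxz hz (by omega)
  have hr := hs.link_right hj hb hx hxz hz (by omega)
  have ar : IsAllowed (α.Iv (α.r j) (α.r j + 1)) := isAllowed_Iv_single (.af j)
  have hl : α.Link s x' (α.r j + 1) x z := by
    rcases h1.eq_or_lt with h1 | h1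
    · rwa [h1]
    · exact hs.link_append h1 (Nat.lt_succ_self _) hxz (by omega) (by omega) (by omega)
        (isAllowed_Iv_of_bal h3) ar (isAllowed_Iv_append' h1.le (by omega) ar h3) hb
        (hs.link_bal h3 hb hx' h1 (by omega) hx hxz hz (by omega)) hr
  rcases (show α.r j + 1 ≤ z' from h2).eq_or_lt with h5 | h5
  · rwa [← h5]
  · have al : IsAllowed (α.Iv x' (α.r j + 1)) := isAllowed_Iv_append' h1 (by omega) ar h3
    exact hs.link_append (by omega) h5 hxz (by omega) (by omega) (by omega)
      al (isAllowed_Iv_of_bal h4) (isAllowed_Iv_append (by omega) h5.le al h4) hb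
      hl (hs.link_bal h4 hb (by omega) h5 (by omega) hx hxz hz (by omega))

variable (α s)

/-- A branch whose leaves are the fundamental state `w`, neutral planar branches that are attached
one after the other to the interval from `w` up to `c`, and other neutral planar branches. -/
inductive Comb (w : Particle k a) : PlaneTree k a → ℕ → Prop
  | leaf : Comb w (.leaf w) (α.pos w + 1)
  | sub {t A : PlaneTree k a} {c z : ℕ} (ht : Comb w t c) (hcz : c < z) (hz : z ≤ 2 * k + a)
      (hb : α.Bal c z) (hA : A.leafSet = α.Iv c z) (hE : α.E s c z ≤ kills (A.branchForm s))
      (hd : Disjoint t.leafSet (α.Iv c z)) : Comb w (.node t A) z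
  | other {t A : PlaneTree k a} {c x z : ℕ} (ht : Comb w t c) (hx : 2 ≤ x) (hxz : x < z)
      (hz : z ≤ 2 * k + a) (hb : α.Bal x z) (hA : A.leafSet = α.Iv x z)
      (hE : α.E s x z ≤ kills (A.branchForm s)) (hd : Disjoint t.leafSet (α.Iv x z))
      (h1 : ¬ (α.pos w < x ∧ α.Bal (α.pos w + 1) x))
      (h2 : ¬ (α.endPos w ≤ x ∧ α.Bal (α.endPos w) x)) : Comb w (.node t A) c
  | swap {l r : PlaneTree k a} {c : ℕ} (h : Comb w (.node l r) c) : Comb w (.node r l) c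

variable {α s}

/-- The facts about a comb that do not involve its differential form. -/
structure CombData (α : MeliaOrdering k a) (w : Particle k a) (S : Finset (Particle k a))
    (c : ℕ) : Prop where
  lt : α.pos w < c
  le : c ≤ 2 * k + a
  bal : α.Bal (α.pos w + 1) c
  core : α.Iv (α.pos w) c ⊆ S
  charge : charge S = charge {w}
  root : α.root ∉ S
  le_r : ∀ j, w = .f j → c ≤ α.r j

/-- Attached branches are neutral and so do not change the charge. A neutral interval that continues
the core cannot contain `r j` without `l j`, so the core stays in front of the partner of `w`. -/
theorem Comb.data {w : Particle k a} (hw : α.IsOpen w) {t : PlaneTree k a} {c : ℕ}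
    (h : α.Comb s w t c) : CombData α w t.leafSet c := by
  have hw1 := hw.one_le
  induction h with
  | leaf =>
    have e : (PlaneTree.leaf w : PlaneTree k a).leafSet = {w} := by simp [PlaneTree.leafSet, leaves]
    refine ⟨by omega, α.pos_lt w, Bal.self _, by rw [Iv_pos, e], by rw [e], ?_, ?_⟩
    · rw [e, Finset.mem_singleton]; exact hw.1.symm
    · rintro j rfl; exact α.l_lt_r j
  | @sub t A c z ht hcz hz hb hA hE hd ih =>
    have h1 := ih.lt
    refine ⟨by omega, hz, ih.bal.append hb (by omega) hcz.le, ?_, ?_, ?_, ?_⟩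
    · rw [leafSet_node, hA, ← Iv_append h1.le hcz.le]
      exact Finset.union_subset_union_left ih.core
    · rw [leafSet_node, hA, charge_union hd, hb.charge, add_zero, ih.charge]
    · rw [leafSet_node, hA, Finset.mem_union]
      exact not_or.2 ⟨ih.root, root_notMem_Iv (by omega)⟩
    · rintro j rfl
      have h2 := ih.le_r j rfl
      have h3 := hb j
      have h4 : α.pos (.f j) = α.l j := rfl
      omega
  | @other t A c x z ht hx hxz hz hb hA hE hd h1 h2 ih =>
    refine ⟨ih.lt, ih.le, ih.bal, ?_, ?_, ?_, ih.le_r⟩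
    · rw [leafSet_node]
      exact ih.core.trans Finset.subset_union_left
    · rw [leafSet_node, hA, charge_union hd, hb.charge, add_zero, ih.charge]
    · rw [leafSet_node, hA, Finset.mem_union]
      exact not_or.2 ⟨ih.root, root_notMem_Iv (by omega)⟩
  | @swap l r c h ih =>
    have e : (node r l : PlaneTree k a).leafSet = (node l r).leafSet := by
      rw [leafSet_node, leafSet_node, Finset.union_comm]
    rw [e]; exact ih

end MeliaOrdering

/-! ### Polarization of combs and planar channels -/

namespace MeliaOrdering

open PlaneTree

variable {α : MeliaOrdering k a}
variable {V : Type*} [AddCommGroup V] [Module ℝ V] {s : Finset (Particle k a) → V}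

/-- The planar channels that a comb is combined with. -/
inductive Att (α : MeliaOrdering k a) (w : Particle k a) (c x z : ℕ) : Prop
  | right (j : Fin k) (hj : j ≠ α.first) (hw : w = .f j) (h1 : c ≤ x) (h2 : x ≤ α.r j)
      (h3 : α.r j < z) (h4 : α.Bal x (α.r j)) (h5 : α.Bal (α.r j + 1) z)
  | next (j : Fin k) (hw : w = .f j) (h1 : α.r j + 1 ≤ x) (h2 : α.Bal (α.r j + 1) x)
      (h3 : α.Bal x z)
  | sub (h1 : c ≤ x) (h2 : α.Bal (α.pos w + 1) x) (h3 : α.Bal x z)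

theorem Att.mono {w : Particle k a} {c c' x z : ℕ} (h : α.Att w c x z) (hc : c' ≤ c) :
    α.Att w c' x z := by
  cases h with
  | right j hj hw h1 h2 h3 h4 h5 => exact .right j hj hw (hc.trans h1) h2 h3 h4 h5
  | next j hw h1 h2 h3 => exact .next j hw h1 h2 h3
  | sub h1 h2 h3 => exact .sub (hc.trans h1) h2 h3

theorem Att.closed {w : Particle k a} {c x z : ℕ} (h : α.Att w c x z) : α.Closed x z := by
  cases h with
  | right j hj hw h1 h2 h3 h4 h5 => exact .inr ⟨j, hj, h2, h3, h4, h5⟩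
  | next j hw h1 h2 h3 => exact .inl h3
  | sub h1 h2 h3 => exact .inl h3

theorem charge_Iv_closed {x z : ℕ} {j : Fin k} (h2 : x ≤ α.r j)
    (h3 : α.r j < z) (h4 : α.Bal x (α.r j)) (h5 : α.Bal (α.r j + 1) z) :
    charge (α.Iv x z) = - Pi.single j 1 := by
  rw [← Iv_append (h2.trans (Nat.le_succ _)) (show α.r j + 1 ≤ z from h3),
    charge_union (Iv_disjoint (by omega)), h5.charge, add_zero, ← Iv_append h2 (Nat.le_succ _),
    charge_union (Iv_disjoint (by omega)), h4.charge, zero_add]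
  exact (congrArg charge (Iv_pos (.af j))).trans (charge_af j)

/-- The flavour of the comb is that of `w`; an attached channel is neutral or carries exactly the
opposite flavour. This is the hypothesis under which the polarization is additive. -/
theorem Att.isAllowed_union {w : Particle k a} {c x z : ℕ} (h : α.Att w c x z)
    {S : Finset (Particle k a)} (hS : charge S = charge {w}) (hd : Disjoint S (α.Iv x z)) :
    IsAllowed (α.Iv x z ∪ S) := by
  have hn : charge (α.Iv x z) = 0 → IsAllowed (α.Iv x z ∪ S) := fun h =>
    isAllowed_of_charge_eq (X := {w}) (by rw [charge_union hd.symm, h, zero_add, hS])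
      (isAllowed_singleton w)
  cases h with
  | right j hj hw h1 h2 h3 h4 h5 =>
    subst hw
    apply isAllowed_of_zero
    rw [charge_union hd.symm, hS, charge_Iv_closed h2 h3 h4 h5, charge_f, neg_add_cancel]
  | next j hw h1 h2 h3 => exact hn h3.charge
  | sub h1 h2 h3 => exact hn h3.charge

theorem E_self_succ (x : ℕ) : α.E s x (x + 1) = ⊥ := by
  rw [E, Submodule.span_eq_bot]
  rintro _ ⟨g, ⟨h1, h2⟩, -⟩
  omega

/-- The comb consisting of `w` alone. A channel with the right end of `w` is cut into neutral
interval, right end and neutral interval: the first is on the level enclosed by the pair, the last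
follows the pair. -/
theorem Soft.link_open_att (hs : α.Soft s) {w : Particle k a} (hw : α.IsOpen w) {x z : ℕ}
    (h : α.Att w (α.pos w + 1) x z) (hx : 2 ≤ x) (hxz : x < z) (hz : z ≤ 2 * k + a) :
    α.Link s (α.pos w) (α.pos w + 1) x z := by
  cases h with
  | right j hj hw' h1 h2 h3 h4 h5 =>
    subst hw'
    have e1 : α.pos (.f j) = α.l j := rfl
    have e2 : α.endPos (.f j) = α.r j + 1 := rfl
    have af : IsAllowed (α.Iv (α.l j) (α.l j + 1)) := isAllowed_Iv_single (.f j)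
    have ar : IsAllowed (α.Iv (α.r j) (α.r j + 1)) := isAllowed_Iv_single (.af j)
    have afr : IsAllowed (α.Iv (α.l j) (α.l j + 1) ∪ α.Iv (α.r j) (α.r j + 1)) := by
      rw [e1.symm, Iv_pos, show α.r j = α.pos (.af j) from rfl, Iv_pos]
      refine isAllowed_of_zero ?_
      rw [charge_union (by simp), charge_f, charge_af, add_neg_cancel]
    have hp := hs.link_pair hj
    rw [e1] at h1 ⊢
    have hbx : α.Bal (α.l j + 1) x := (α.bal_interior j).of_append_right h4 h1 h2
    have hl1 := hw.one_le
    rw [e1] at hl1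
    have hl : α.Link s x (α.r j + 1) (α.l j) (α.l j + 1) := by
      rcases h2.eq_or_lt with h2 | h2
      · rw [h2]; exact hp.symm
      · refine hs.link_append_left h2 (Nat.lt_succ_self _) (Nat.lt_succ_self _) (by omega)
          (by omega) (by omega) ar h4 af afr ?_ hp.symm
        exact (hs.link_open hw h4 hx h2 (by omega) (by rw [e1]; omega) (.inr hbx)).symm
    rcases (show α.r j + 1 ≤ z from h3).eq_or_lt with h6 | h6
    · rw [← h6]; exact hl.symm
    · refine (hs.link_append_right (by omega) h6 (Nat.lt_succ_self _) (by omega)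
        (by omega) (by omega) (isAllowed_Iv_append' h2 (by omega) ar h4) h5 af ?_ hl ?_).symm
      · rw [← Iv_append h2 (Nat.le_succ _), Finset.union_comm (α.Iv x _), ← Finset.union_assoc]
        refine isAllowed_union_left ?_ afr h4.charge
        rw [Finset.disjoint_union_left]
        exact ⟨Iv_disjoint (by omega), Iv_disjoint (by omega)⟩
      · exact (hs.link_open hw h5 (by omega) h6 hz (by rw [e1]; omega)
          (.inl ⟨by rw [e2], by rw [e2]; exact Bal.self _⟩)).symm
  | next j hw' h1 h2 h3 =>
    subst hw'
    have e2 : α.endPos (.f j) = α.r j + 1 := rfl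
    have e3 : α.pos (.f j) = α.l j := rfl
    have := α.l_lt_r j
    exact hs.link_open hw h3 hx hxz hz (by omega) (.inl ⟨h1, h2⟩)
  | sub h1 h2 h3 => exact hs.link_open hw h3 hx hxz hz h1 (.inr h2)

/-- The polarization of a comb and a planar channel. -/
theorem Comb.polar_mem (hs : α.Soft s) {w : Particle k a} (hw : α.IsOpen w) {t : PlaneTree k a}
    {c : ℕ} (h : α.Comb s w t c) {x z : ℕ} (hx : 2 ≤ x) (hxz : x < z) (hz : z ≤ 2 * k + a)
    (hX : α.Att w c x z) (hd : Disjoint t.leafSet (α.Iv x z)) :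
    polar s t.leafSet (α.Iv x z) - (if x = c then α.gapVec s (c - 1) else 0) ∈
      kills (t.branchForm s) ⊔ α.E s x z := by
  induction h with
  | leaf =>
    have e : (PlaneTree.leaf w : PlaneTree k a).leafSet = {w} := by
      simp [PlaneTree.leafSet, leaves]
    have hl := hs.link_open_att hw hX hx hxz hz
    have h1 : α.pos w < x := by
      rw [e, Finset.disjoint_singleton_left, mem_Iv] at hd
      cases hX with
      | right j hj hw h1 h2 h3 h4 h5 => exact h1
      | next j hw' h1 h2 h3 =>
        subst hw'
        exact (α.l_lt_r j).trans h1
      | sub h1 h2 h3 => exact h1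
    unfold Link at hl
    rw [E_self_succ, bot_sup_eq, Iv_pos] at hl
    have h2 : α.touch s (α.pos w) (α.pos w + 1) x z =
        if x = α.pos w + 1 then α.gapVec s (α.pos w + 1 - 1) else 0 := by
      rw [touch, if_neg (show z ≠ α.pos w by omega), add_zero]
      simp only [eq_comm]
    rw [e, ← h2]
    exact (le_sup_right : _ ≤ kills _ ⊔ α.E s x z) hl
  | @sub t A c c₁ ht hcz hz' hb hA hE hd' ih =>
    have hD := ht.data hw
    rw [leafSet_node, hA, Finset.disjoint_union_left] at hd
    have h1 := hD.lt
    have h2 := hw.one_le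
    have hz1 : 1 ≤ x := by omega
    have hdis : c₁ ≤ x ∨ z ≤ c := by
      cases hX with
      | right j hj hw h1 h2 h3 h4 h5 => exact .inl h1
      | next j hw' h1 h2 h3 =>
        have h3 := ((ht.sub hcz hz' hb hA hE hd').data hw).le_r j hw'
        left; omega
      | sub h1 h2 h3 => exact .inl h1
    have hcx : c₁ ≤ x := by
      rcases hdis with h | h
      · exact h
      · cases hX with
        | right j hj hw h1 h2 h3 h4 h5 => exact h1
        | next j hw' h1 h2 h3 =>
          have h3 := ((ht.sub hcz hz' hb hA hE hd').data hw).le_r j hw'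
          omega
        | sub h1 h2 h3 => exact h1
    have ih := ih (hX.mono hcz.le) hd.1
    -- The core has grown beyond `c`, so the old comb does not touch the channel; a touching gap can
    -- only come from the interval that was attached last.
    rw [if_neg (by omega), sub_zero] at ih
    have hadd := hs.polar_add' (X := α.Iv x z) (Y := t.leafSet) (Z := α.Iv c c₁)
      (root_notMem_Iv hz1) hD.root (root_notMem_Iv (by omega)) hd.1.symm hd.2.symm hd'
      hX.closed.isAllowed (isAllowed_of_charge_eq hD.charge.symm (isAllowed_singleton w))
      (hX.isAllowed_union hD.charge hd.1) hb.charge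
    rw [leafSet_node, hA, polar_comm, hadd, polar_comm, polar_comm s _ (α.Iv c c₁), add_sub_assoc]
    have hl := (hs.link_closed hb (by omega) hcz hz' hX.closed hx hxz hz (.inl hcx)).symm
    unfold Link at hl
    have ht' : α.touch s c c₁ x z = if x = c₁ then α.gapVec s (c₁ - 1) else 0 := by
      rw [touch, if_neg (show z ≠ c by omega), add_zero]
      simp only [eq_comm]
    rw [ht'] at hl
    have hk := sup_le_sup_right (hE.trans (kills_node_right s t A)) (α.E s x z)
    exact add_mem (sup_le_sup_right (kills_node_left s t A) _ ih) (hk hl)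
  | @other t A c x' z' ht hx' hxz' hz' hb hA hE hd' h1 h2 ih =>
    have hD := ht.data hw
    rw [leafSet_node, hA, Finset.disjoint_union_left] at hd
    have h3 := hw.one_le
    have ih := ih hX hd.1
    have hadd := hs.polar_add' (X := α.Iv x z) (Y := t.leafSet) (Z := α.Iv x' z')
      (root_notMem_Iv (by omega)) hD.root (root_notMem_Iv (by omega)) hd.1.symm hd.2.symm hd'
      hX.closed.isAllowed (isAllowed_of_charge_eq hD.charge.symm (isAllowed_singleton w))
      (hX.isAllowed_union hD.charge hd.1) hb.charge
    rw [leafSet_node, hA, polar_comm, hadd, polar_comm, polar_comm s _ (α.Iv x' z'),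
      add_sub_right_comm]
    have hwA : ¬ (x' ≤ α.pos w ∧ α.pos w < z') := by
      have h4 : w ∈ t.leafSet := hD.core (by rw [mem_Iv]; exact ⟨le_rfl, hD.lt⟩)
      have h5 := Finset.disjoint_left.1 hd' h4
      rwa [mem_Iv] at h5
    have hdis : z' ≤ x ∨ z ≤ x' := by
      by_contra hc
      push Not at hc
      obtain ⟨p, hp⟩ := α.exists_pos (show max x x' < 2 * k + a by omega)
      have h4 : p ∈ α.Iv x z := by rw [mem_Iv]; omega
      have h5 : p ∈ α.Iv x' z' := by rw [mem_Iv]; omega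
      exact Finset.disjoint_left.1 hd.2 h5 h4
    have hl := (hs.link_closed hb hx' hxz' hz' hX.closed hx hxz hz hdis).symm
    unfold Link at hl
    -- An interval attached by `other` is neither on the level enclosed by `w` nor on the level
    -- after `w`. If it touched the channel, balance would carry over to it and put it on one of
    -- these levels.
    have ht' : α.touch s x' z' x z = 0 := by
      have hsub : α.Bal (α.pos w + 1) x → α.pos w < x → z' ≠ x := by
        rintro h4 h5 rfl
        exact h1 ⟨by omega, h4.of_append_right hb (by omega) (by omega)⟩
      have hnot : z' ≠ x ∧ z ≠ x' := by
        cases hX with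
        | right j hj hw' h4 h5 h6 h7 h8 =>
          subst hw'
          have e1 : α.pos (.f j) = α.l j := rfl
          have e2 : α.endPos (.f j) = α.r j + 1 := rfl
          have h9 := hD.lt
          refine ⟨hsub ((α.bal_interior j).of_append_right h7 (by omega) h5) (by omega), ?_⟩
          rintro rfl
          exact h2 ⟨h6, h8⟩
        | next j hw' h4 h5 h6 =>
          subst hw'
          have e1 : α.pos (.f j) = α.l j := rfl
          have e2 : α.endPos (.f j) = α.r j + 1 := rfl
          have h9 := hb j
          constructor
          · rintro rfl
            have h10 : α.r j + 1 ≤ x' := by omega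
            exact h2 ⟨h10, h5.of_append_right hb h10 hxz'.le⟩
          · rintro rfl
            exact h2 ⟨by omega, h5.append h6 h4 hxz.le⟩
        | sub h4 h5 h6 =>
          have h9 := hD.lt
          refine ⟨hsub h5 (by omega), ?_⟩
          rintro rfl
          exact h1 ⟨by omega, h5.append h6 (by omega) hxz.le⟩
      rw [touch, if_neg hnot.1, if_neg hnot.2, add_zero]
    rw [ht', sub_zero] at hl
    have hk := sup_le_sup_right (hE.trans (kills_node_right s t A)) (α.E s x z)
    exact add_mem (sup_le_sup_right (kills_node_left s t A) _ ih) (hk hl)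
  | @swap l r c h ih =>
    have e : (PlaneTree.node r l : PlaneTree k a).leafSet = (PlaneTree.node l r).leafSet := by
      rw [leafSet_node, leafSet_node, Finset.union_comm]
    rw [e] at hd ⊢
    exact sup_le_sup_right (kills_node_swap s l r) _ (ih hX hd)

end MeliaOrdering

/-! ### Values of planar branches -/

theorem single_ne_zero_int (j : Fin k) : (Pi.single j 1 : Fin k → ℤ) ≠ 0 := by
  intro h; simpa using congrFun h j

theorem neg_single_ne_zero_int (j : Fin k) : (- Pi.single j 1 : Fin k → ℤ) ≠ 0 := by
  intro h; simpa using congrFun h j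

theorem single_ne_neg_single (i j : Fin k) : (Pi.single i 1 : Fin k → ℤ) ≠ - Pi.single j 1 := by
  intro h
  have := congrFun h i
  by_cases hij : i = j
  · subst hij; simp at this
  · simp [hij] at this

theorem single_int_inj {i j : Fin k} (h : (Pi.single i 1 : Fin k → ℤ) = Pi.single j 1) :
    i = j := by
  by_contra hij
  have := congrFun h i
  simp [hij] at this

namespace PlaneTree

theorem isAllowed_leafSet {t : PlaneTree k a} (h : ∀ I ∈ t.channels, IsAllowed I) :
    IsAllowed t.leafSet := by
  cases t with
  | leaf p =>
    have e : (leaf p : PlaneTree k a).leafSet = {p} := by simp [leafSet, leaves]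
    rw [e]; exact isAllowed_singleton p
  | node l r => exact h _ (by simp [channels])

theorem channels_left {l r : PlaneTree k a} (h : ∀ I ∈ (node l r).channels, IsAllowed I) :
    ∀ I ∈ l.channels, IsAllowed I := fun I hI => h I (by simp [channels, hI])

theorem channels_right {l r : PlaneTree k a} (h : ∀ I ∈ (node l r).channels, IsAllowed I) :
    ∀ I ∈ r.channels, IsAllowed I := fun I hI => h I (by simp [channels, hI])

theorem flips_channels {t t' : PlaneTree k a} {m : ℕ} (h : Flips t t' m) :
    t'.channels = t.channels := by
  induction h with
  | leaf p => rfl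
  | @keep l l' r r' i j hl hr il ir =>
    have := MeliaOrdering.flips_leafSet (Flips.keep hl hr)
    rw [channels, channels, this, il, ir]
  | @flip l l' r r' i j hl hr il ir =>
    have := MeliaOrdering.flips_leafSet (Flips.flip hl hr)
    rw [channels, channels, this, il, ir, Finset.union_comm l.channels]

end PlaneTree

namespace MeliaOrdering

open PlaneTree ExteriorAlgebra

variable {α : MeliaOrdering k a}
variable {V : Type*} [AddCommGroup V] [Module ℝ V] {s : Finset (Particle k a) → V}

theorem closed_of_charge {x z : ℕ} (h : charge (α.Iv x z) = 0 ∨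
    ∃ j, j ≠ α.first ∧ charge (α.Iv x z) = - Pi.single j 1) : α.Closed x z := by
  rcases h with h | ⟨j, hj, h⟩
  · exact .inl ((bal_iff_charge x z).2 h)
  · obtain ⟨-, h1, h2, h3, h4⟩ := of_charge_Iv_neg h
    exact .inr ⟨j, hj, h1, h2, h3, h4⟩

theorem Closed.charge {x z : ℕ} (h : α.Closed x z) : charge (α.Iv x z) = 0 ∨
    ∃ j, j ≠ α.first ∧ charge (α.Iv x z) = - Pi.single j 1 := by
  rcases h with h | ⟨j, hj, h1, h2, h3, h4⟩
  · exact .inl h.charge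
  · exact .inr ⟨j, hj, charge_Iv_closed h1 h2 h3 h4⟩

/-- The polarization of an open interval and a neutral one outside its closure. -/
theorem Soft.polar_pos_mem (hs : α.Soft s) {j : Fin k} {x z m c : ℕ}
    (hR : BiColour.charge (α.Iv m c) = Pi.single j 1) (hm : 2 ≤ m) (hb : α.Bal x z) (hx : 2 ≤ x)
    (hxz : x < z) (hz : z ≤ 2 * k + a) (hd : z ≤ m ∨ α.r j + 1 < x) :
    polar s (α.Iv m c) (α.Iv x z) - (if z = m then α.gapVec s (m - 1) else 0) ∈
      α.E s x z ⊔ α.E s m (α.r j + 1) := by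
  obtain ⟨h1, h2, h3, h4, h5⟩ := of_charge_Iv_pos hR
  have hr : α.r j < 2 * k + a := α.pos_lt _
  have hbP : α.Bal m (α.r j + 1) := h4.append (α.bal_pair j) h1 (by omega)
  have hbc : α.Bal c (α.r j) := (α.bal_interior j).of_append_left h5 (by omega) h3
  have hj : j ≠ α.first := by
    rintro rfl
    rw [l_first] at h1; omega
  have hc : α.Closed c (α.r j + 1) := .inr ⟨j, hj, h3, Nat.lt_succ_self _, hbc, Bal.self _⟩
  have l1 := hs.link_bal hbP hb hm (by omega) (by omega) hx hxz hz (by omega)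
  have l2 := hs.link_closed hb hx hxz hz hc (by omega) (by omega) (by omega) (by omega)
  have hadd := hs.polar_add (X := α.Iv m c) (Y := α.Iv c (α.r j + 1)) (Z := α.Iv x z)
    (root_notMem_Iv (by omega)) (root_notMem_Iv (by omega)) (root_notMem_Iv (by omega))
    (Iv_disjoint (by omega)) (Iv_disjoint (by omega)) (Iv_disjoint (by omega))
    ((isAllowed_iff _).2 (.inr ⟨j, .inl hR⟩)) hc.isAllowed
    (by rw [Iv_append (by omega) (by omega)]; exact isAllowed_Iv_of_bal hbP) hb.charge
  rw [Iv_append (by omega) (by omega), polar_comm, polar_comm s _ (α.Iv m c),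
    polar_comm s _ (α.Iv c _)] at hadd
  unfold Link at l1 l2
  have t2 : α.touch s c (α.r j + 1) x z = 0 := by
    rw [touch, if_neg (by omega), if_neg (by omega), add_zero]
  have t1 : α.touch s m (α.r j + 1) x z = if z = m then α.gapVec s (m - 1) else 0 := by
    rw [touch, if_neg (by omega), zero_add]
    split_ifs with h
    · rw [h]
    · rfl
  rw [t2, sub_zero] at l2
  rw [t1] at l1
  have e1 : α.E s c (α.r j + 1) ⊔ α.E s x z ≤ α.E s x z ⊔ α.E s m (α.r j + 1) := by
    rw [sup_comm]
    exact sup_le_sup_left (E_mono (by omega) le_rfl) _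
  have e2 : α.E s m (α.r j + 1) ⊔ α.E s x z ≤ α.E s x z ⊔ α.E s m (α.r j + 1) := by
    rw [sup_comm]
  have := sub_mem (e2 l1) (e1 l2)
  rw [hadd] at this
  convert this using 1
  abel

theorem mem_sup_mono {A B C D : Submodule ℝ V} (h1 : A ≤ C) (h2 : B ≤ D) {v : V}
    (h : v ∈ A ⊔ B) : v ∈ C ⊔ D := sup_le_sup h1 h2 h

theorem Z_kills {x z : ℕ} (c : ℝ) : α.E s x z ≤ kills (c • α.Z s x (z - 1)) :=
  (E_le_kills x z).trans (kills_smul _ _)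

/-- The values of the wedge products attached to the drawn branches. -/
structure Value (α : MeliaOrdering k a) (s : Finset (Particle k a) → V) (t : PlaneTree k a)
    (x z : ℕ) : Prop where
  closed : 2 ≤ x → α.Closed x z → t.branchForm s = t.sign • α.Z s x (z - 1)
  pos : ∀ j, charge (α.Iv x z) = Pi.single j 1 → α.Comb s (.f j) t z ∧
    t.branchForm s * α.Z s (z - 1) (α.r j) = t.sign • α.Z s x (α.r j)
  neg : x = 1 → charge (α.Iv x z) = - Pi.single α.first 1 → α.Comb s (.af α.first) t z ∧
    t.branchForm s = t.sign • α.Z s x (z - 1)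

theorem isOpen_f {j : Fin k} (hj : j ≠ α.first) : α.IsOpen (.f j) := (α.isStart_f hj).isOpen

theorem isOpen_af_first : α.IsOpen (.af α.first) := by
  refine ⟨by simp [MeliaOrdering.root], fun j hj h => hj ?_⟩
  injection h with h; exact h.symm

theorem pos_af_first : α.pos (.af α.first) = 1 := α.r_first

theorem not_bal_one {z : ℕ} (h : 1 < z) : ¬ α.Bal 1 z := by
  intro hb
  have := hb α.first
  rw [l_first, r_first] at this
  omega

/-- The left branch is known exactly: its gaps, the gap at the junction and the gaps of the right
factor join to one product. The multiplier `X` supplies the later gaps when the right branch is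
open. -/
theorem node_value {l r : PlaneTree k a} {x m : ℕ} {p q : ℝ} (hs : ∀ p, s {p} = 0)
    (hx : x < m) (hl : l.branchForm s = p • α.Z s x (m - 1)) {u : ℕ} (hu : m ≤ u)
    {X : ExteriorAlgebra ℝ V} (hr : r.branchForm s * X = q • α.Z s m u)
    (h : polar s l.leafSet r.leafSet - α.gapVec s (m - 1) ∈
      kills (l.branchForm s) ⊔ kills (r.branchForm s * X)) :
    (node l r).branchForm s * X =
      ((-1) ^ inversions l.leaves r.leaves * (p * q)) • α.Z s x u := by
  rw [branchForm_node_mul s hs l r X h, hl, hr, mul_smul_comm, mul_smul_comm, smul_mul_assoc,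
    ι_mul_Z (by omega) hu, Z_mul (by omega) (by omega), ← smul_assoc, ← smul_assoc, smul_eq_mul,
    smul_eq_mul]
  ring_nf

/-- The left branch is open and known only after multiplication by the gaps from the junction up to
`v`. The right factor must therefore reach at least as far as `v`. -/
theorem node_value' {l r : PlaneTree k a} {x m u v : ℕ} {p q : ℝ} (hs : ∀ p, s {p} = 0)
    (hx : x < m) (hv : v ≤ u) (hmv : m ≤ v)
    (hl : l.branchForm s * α.Z s (m - 1) v = p • α.Z s x v) {X : ExteriorAlgebra ℝ V}
    (hr : r.branchForm s * X = q • α.Z s m u)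
    (h : polar s l.leafSet r.leafSet - α.gapVec s (m - 1) ∈
      kills (l.branchForm s) ⊔ kills (r.branchForm s * X)) :
    (node l r).branchForm s * X =
      ((-1) ^ inversions l.leaves r.leaves * (p * q)) • α.Z s x u := by
  rw [branchForm_node_mul s hs l r X h, hr, mul_smul_comm, mul_smul_comm,
    ι_mul_Z (by omega) (by omega), ← Z_mul (show m - 1 ≤ v by omega) hv, ← mul_assoc, hl,
    smul_mul_assoc, Z_mul (by omega) hv, ← smul_assoc, ← smul_assoc, smul_eq_mul, smul_eq_mul]
  ring_nf

/-- Induction on the tree, by the flavours that meet at the vertex. When one branch is neutral the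
polarization is linked directly or through the comb; when flavours cancel, the right branch covers
the partner of the open left branch and provides the gaps that the latter needs. -/
theorem drawn_value (hs : α.Soft s) {t : PlaneTree k a} {x z : ℕ} (ht : α.Drawn t x z)
    (hx : 1 ≤ x) (ha : ∀ I ∈ t.channels, IsAllowed I) : α.Value s t x z := by
  induction t generalizing x z with
  | leaf p =>
    obtain ⟨rfl, rfl⟩ := ht.of_leaf
    have e : BiColour.charge (α.Iv (α.pos p) (α.pos p + 1)) = BiColour.charge {p} := by rw [Iv_pos]
    refine ⟨fun _ _ => ?_, fun j hj => ?_, fun _ hj => ?_⟩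
    · rw [branchForm, sign_leaf, Nat.add_sub_cancel, Z_self, one_smul]
    · have hp : p = .f j := by
        rw [e] at hj
        cases p with
        | f i => rw [charge_f] at hj; rw [single_int_inj hj]
        | af i => rw [charge_af] at hj; exact absurd hj.symm (single_ne_neg_single _ _)
        | adj g => rw [charge_adj] at hj; exact absurd hj.symm (single_ne_zero_int _)
      subst hp
      refine ⟨.leaf, ?_⟩
      rw [branchForm, sign_leaf, one_mul, Nat.add_sub_cancel, one_smul]
    · have hp : p = .af α.first := by
        rw [e] at hj
        cases p with
        | f i => rw [charge_f] at hj; exact absurd hj (single_ne_neg_single _ _)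
        | af i => rw [charge_af] at hj; rw [single_int_inj (neg_injective hj)]
        | adj g => rw [charge_adj] at hj; exact absurd hj.symm (neg_single_ne_zero_int _)
      subst hp
      refine ⟨.leaf, ?_⟩
      rw [branchForm, sign_leaf, Nat.add_sub_cancel, Z_self, one_smul]
  | node l r il ir =>
    have hz := ht.le
    obtain ⟨m, hl, hr⟩ := ht.of_node
    have h1 := hl.1
    have h2 := hr.1
    have il := il hl hx (channels_left ha)
    have ir := ir hr (by omega) (channels_right ha)
    have el := hl.leafSet
    have er := hr.leafSet
    have al := isAllowed_leafSet (channels_left ha)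
    have ar := isAllowed_leafSet (channels_right ha)
    have alr := isAllowed_leafSet ha
    rw [leafSet_node, el, er] at alr
    rw [el] at al
    rw [er] at ar
    have hd : Disjoint (α.Iv x m) (α.Iv m z) := Iv_disjoint (by omega)
    have hc := charge_cases hd al ar alr
    have hch := charge_union hd
    rw [Iv_append h1.le h2.le] at hch
    have hz0 := hs.singleton
    refine ⟨fun hx2 hcl => ?_, fun j hj => ?_, fun hx1 hj => ?_⟩
    · have hcc := hcl.charge
      rw [sign_node, ← mul_one (branchForm _ _)]
      rcases hc with hc | hc | ⟨j, ⟨hl', hr'⟩ | ⟨hl', hr'⟩⟩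
      · have cl : α.Bal x m := (bal_iff_charge x m).2 hc
        have cr : α.Closed m z := closed_of_charge (by rw [hch, hc, zero_add] at hcc; exact hcc)
        have vl := il.closed hx2 (.inl cl)
        have vr := ir.closed (by omega) cr
        refine node_value hz0 h1 vl (by omega) (by rw [mul_one]; exact vr) ?_
        have hk := (hs.link_closed cl hx2 h1 (by omega) cr (by omega) h2 hz (.inl le_rfl)).symm
        unfold Link at hk
        rw [touch_of_eq h1 h2] at hk
        rw [el, er, mul_one, vl, vr]
        exact mem_sup_mono (Z_kills _) (Z_kills _) hk
      · have cr : α.Bal m z := (bal_iff_charge m z).2 hc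
        have cl : α.Closed x m := closed_of_charge (by rw [hch, hc, add_zero] at hcc; exact hcc)
        have vl := il.closed hx2 cl
        have vr := ir.closed (by omega) (.inl cr)
        refine node_value hz0 h1 vl (by omega) (by rw [mul_one]; exact vr) ?_
        have hk := hs.link_closed cr (by omega) h2 (by omega) cl (by omega) h1 (by omega)
          (.inr le_rfl)
        unfold Link at hk
        rw [touch_of_eq h1 h2] at hk
        rw [el, er, mul_one, vl, vr]
        exact mem_sup_mono (Z_kills _) (Z_kills _) hk
      · obtain ⟨r1, r2, r3, r4, r5⟩ := of_charge_Iv_neg hr'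
        obtain ⟨l1, l2, l3, l4, l5⟩ := of_charge_Iv_pos hl'
        have hj : j ≠ α.first := by rintro rfl; rw [l_first] at l1; omega
        have cr : α.Closed m z := .inr ⟨j, hj, r2, r3, r4, r5⟩
        have vr := ir.closed (by omega) cr
        obtain ⟨cb, vl⟩ := il.pos j hl'
        -- The right branch contains the position `r j`, so its gaps include those from the junction
        -- to `r j` by which the left branch has to be multiplied.
        refine node_value' (v := α.r j) hz0 h1 (by omega) r2 vl
          (by rw [mul_one]; exact vr) ?_
        have hk := cb.polar_mem hs (isOpen_f hj) (by omega) h2 hz (.right j hj rfl le_rfl r2 r3 r4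
          r5) (by rw [el]; exact hd)
        rw [if_pos rfl, el] at hk
        rw [el, er, mul_one, vr]
        exact mem_sup_mono le_rfl (Z_kills _) hk
      -- Impossible in this order, since a left end comes before its right end.
      · obtain ⟨r1, r2, r3, r4, r5⟩ := of_charge_Iv_neg hl'
        obtain ⟨l1, l2, l3, l4, l5⟩ := of_charge_Iv_pos hr'
        omega
    · rw [sign_node]
      obtain ⟨j1, j2, j3, j4, j5⟩ := of_charge_Iv_pos hj
      have hjf : j ≠ α.first := by rintro rfl; rw [l_first] at j1; omega
      have hx2 : 2 ≤ x := by
        by_contra hx2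
        have hx1 : x = 1 := by omega
        have := j4 α.first
        have h3 := two_le_l α hjf
        rw [hx1, l_first, r_first] at this
        omega
      rcases hc with hc | hc | ⟨i, ⟨hl', hr'⟩ | ⟨hl', hr'⟩⟩
      · have cl : α.Bal x m := (bal_iff_charge x m).2 hc
        have vl := il.closed hx2 (.inl cl)
        have hrj : charge (α.Iv m z) = Pi.single j 1 := by rw [hch, hc, zero_add] at hj; exact hj
        obtain ⟨cb, vr⟩ := ir.pos j hrj
        obtain ⟨m1, -, -, -, -⟩ := of_charge_Iv_pos hrj
        have hkl : α.E s x m ≤ kills (l.branchForm s) := by rw [vl]; exact Z_kills _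
        constructor
        -- The neutral branch begins before `f j`, and so it lies neither on the enclosed level nor
        -- after the pair.
        · refine Comb.swap (.other cb hx2 h1 (by omega) cl el hkl (by rw [er]; exact hd.symm) ?_ ?_)
          · have : α.pos (.f j) = α.l j := rfl
            omega
          · have : α.endPos (.f j) = α.r j + 1 := rfl
            omega
        · refine node_value hz0 h1 vl (by omega) vr ?_
          have hk := hs.polar_pos_mem hrj (by omega) cl hx2 h1 (by omega) (.inl le_rfl)
          rw [if_pos rfl, polar_comm] at hk
          rw [el, er, vr]
          exact mem_sup_mono hkl (Z_kills (z := α.r j + 1) _) hk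
      · have cr : α.Bal m z := (bal_iff_charge m z).2 hc
        have vr := ir.closed (by omega) (.inl cr)
        have hlj : charge (α.Iv x m) = Pi.single j 1 := by rw [hch, hc, add_zero] at hj; exact hj
        obtain ⟨cb, vl⟩ := il.pos j hlj
        obtain ⟨m1, m2, m3, m4, m5⟩ := of_charge_Iv_pos hlj
        have hkr : α.E s m z ≤ kills (r.branchForm s) := by rw [vr]; exact Z_kills _
        constructor
        · exact .sub cb h2 hz cr er hkr (by rw [el]; exact hd)
        · have vr' : r.branchForm s * α.Z s (z - 1) (α.r j) = r.sign • α.Z s m (α.r j) := by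
            rw [vr, smul_mul_assoc, Z_mul (by omega) (by omega)]
          refine node_value' hz0 h1 le_rfl m3 vl vr' ?_
          have hk := cb.polar_mem hs (isOpen_f hjf) (by omega) h2 hz (.sub le_rfl m5 cr)
            (by rw [el]; exact hd)
          rw [if_pos rfl, el] at hk
          rw [el, er]
          exact mem_sup_mono le_rfl (hkr.trans (kills_mul _ _)) hk
      · rw [hch, hl', hr', add_neg_cancel] at hj
        exact absurd hj.symm (single_ne_zero_int _)
      · rw [hch, hl', hr', neg_add_cancel] at hj
        exact absurd hj.symm (single_ne_zero_int _)
    · rw [sign_node]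
      subst hx1
      rcases hc with hc | hc | ⟨i, ⟨hl', hr'⟩ | ⟨hl', hr'⟩⟩
      · exact absurd ((bal_iff_charge 1 m).2 hc) (not_bal_one h1)
      · have cr : α.Bal m z := (bal_iff_charge m z).2 hc
        have vr := ir.closed (by omega) (.inl cr)
        have hlj : charge (α.Iv 1 m) = - Pi.single α.first 1 := by
          rw [hch, hc, add_zero] at hj; exact hj
        obtain ⟨cb, vl⟩ := il.neg rfl hlj
        have hkr : α.E s m z ≤ kills (r.branchForm s) := by rw [vr]; exact Z_kills _
        constructor
        · exact .sub cb h2 hz cr er hkr (by rw [el]; exact hd)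
        · rw [← mul_one (branchForm _ _)]
          refine node_value hz0 h1 vl (by omega) (by rw [mul_one]; exact vr) ?_
          have hk := cb.polar_mem hs isOpen_af_first (by omega) h2 hz
            (.sub le_rfl (cb.data isOpen_af_first).bal cr) (by rw [el]; exact hd)
          rw [if_pos rfl, el] at hk
          rw [el, er, mul_one]
          exact mem_sup_mono le_rfl hkr hk
      · rw [hch, hl', hr', add_neg_cancel] at hj
        exact absurd hj.symm (neg_single_ne_zero_int _)
      · rw [hch, hl', hr', neg_add_cancel] at hj
        exact absurd hj.symm (neg_single_ne_zero_int _)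

end MeliaOrdering

/-! ### Vanishing of non-planar branches -/

namespace MeliaOrdering

open PlaneTree ExteriorAlgebra

variable {α : MeliaOrdering k a}
variable {V : Type*} [AddCommGroup V] [Module ℝ V] {s : Finset (Particle k a) → V}

/-- A branch with allowed channels, without the root. -/
structure Branch (α : MeliaOrdering k a) (t : PlaneTree k a) : Prop where
  nodup : t.leaves.Nodup
  root : α.root ∉ t.leafSet
  allowed : ∀ I ∈ t.channels, IsAllowed I

theorem Branch.left {l r : PlaneTree k a} (h : α.Branch (.node l r)) : α.Branch l := by
  refine ⟨(List.nodup_append'.1 h.nodup).1, fun hr => h.root ?_, channels_left h.allowed⟩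
  rw [leafSet_node]; exact Finset.mem_union_left _ hr

theorem Branch.right {l r : PlaneTree k a} (h : α.Branch (.node l r)) : α.Branch r := by
  refine ⟨(List.nodup_append'.1 h.nodup).2.1, fun hr => h.root ?_, channels_right h.allowed⟩
  rw [leafSet_node]; exact Finset.mem_union_right _ hr

theorem Branch.disjoint {l r : PlaneTree k a} (h : α.Branch (.node l r)) :
    Disjoint l.leafSet r.leafSet := by
  have := (List.nodup_append'.1 h.nodup).2.2
  rw [Finset.disjoint_left]
  intro p h1 h2
  exact this (List.mem_toFinset.1 h1) (List.mem_toFinset.1 h2)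

theorem Branch.swap {l r : PlaneTree k a} (h : α.Branch (.node l r)) : α.Branch (.node r l) := by
  have h2 := flips_channels (Flips.flip (flips_refl l) (flips_refl r))
  have h3 := flips_leafSet (Flips.flip (flips_refl l) (flips_refl r))
  refine ⟨List.nodup_append_comm.1 h.nodup, ?_, ?_⟩
  · rw [h3]; exact h.root
  · rw [h2]; exact h.allowed

/-- The positions 0 and 1 carry the first pair. The root is not in the branch, and its partner
cannot be there alone when the flavour of the first pair vanishes. -/
theorem Branch.two_le {t : PlaneTree k a} (h : α.Branch t) {x z : ℕ} (hp : α.Planar t x z)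
    (hc : charge t.leafSet α.first = 0) : 2 ≤ x := by
  have hl := hp.lt
  have hr := h.root
  rw [hp.leafSet] at hr hc
  rw [mem_Iv, α.pos_root] at hr
  rw [charge_Iv_apply, l_first, r_first] at hc
  by_contra hx
  rcases Nat.lt_or_ge 1 z with hz | hz
  · rw [if_neg (by omega), if_pos (by omega)] at hc
    omega
  · omega

/-- Flips only change signs, so the values of drawn branches carry over to planar ones; for
vanishing arguments the scalar is irrelevant. -/
theorem Planar.branchForm {t : PlaneTree k a} {x z : ℕ} (hs : α.Soft s) (h : α.Branch t)
    (hp : α.Planar t x z) (hx : 1 ≤ x) :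
    (2 ≤ x → α.Closed x z → ∃ ε : ℝ, t.branchForm s = ε • α.Z s x (z - 1)) ∧
    ∀ j, charge (α.Iv x z) = Pi.single j 1 →
      ∃ ε : ℝ, t.branchForm s * α.Z s (z - 1) (α.r j) = ε • α.Z s x (α.r j) := by
  obtain ⟨t', m, h1, h2⟩ := hp
  have hv := drawn_value hs h2 hx (by rw [flips_channels h1]; exact h.allowed)
  have hf := branchForm_flips s h1 h.nodup
  have hf' : t.branchForm s = (-1 : ℝ) ^ m • t'.branchForm s := by
    rw [hf, ← smul_assoc, smul_eq_mul, ← mul_pow]; simp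
  refine ⟨fun hx2 hc => ⟨(-1) ^ m * t'.sign, ?_⟩, fun j hj => ⟨(-1) ^ m * t'.sign, ?_⟩⟩
  · rw [hf', hv.closed hx2 hc, ← smul_assoc, smul_eq_mul]
  · rw [hf', smul_mul_assoc, (hv.pos j hj).2, ← smul_assoc, smul_eq_mul]

theorem branchForm_node_mul_eq_zero (hs : ∀ p, s {p} = 0) {l r : PlaneTree k a}
    {x : ExteriorAlgebra ℝ V} (h : polar s l.leafSet r.leafSet ∈
      kills (l.branchForm s) ⊔ kills (r.branchForm s * x)) :
    (node l r).branchForm s * x = 0 := by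
  rw [branchForm_node_mul s hs l r x (y := 0) (by rwa [sub_zero]), map_zero, zero_mul, mul_zero,
    smul_zero]

theorem branchForm_swap_mul_eq_zero {l r : PlaneTree k a} {x : ExteriorAlgebra ℝ V}
    (h : (node l r).branchForm s * x = 0) : (node r l).branchForm s * x = 0 := by
  obtain ⟨ε, he⟩ := branchForm_swap s l r
  rw [he, smul_mul_assoc, h, smul_zero]

theorem branchForm_swap_eq_zero {l r : PlaneTree k a}
    (h : (node l r).branchForm s = 0) : (node r l).branchForm s = 0 := by
  obtain ⟨ε, he⟩ := branchForm_swap s l r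
  rw [he, h, smul_zero]

/-- The wedge product attached to a branch vanishes, or the branch is planar, as far as it is
determined. -/
structure Vanish (α : MeliaOrdering k a) (s : Finset (Particle k a) → V) (t : PlaneTree k a) :
    Prop where
  closed : (charge t.leafSet = 0 ∨ ∃ j, j ≠ α.first ∧ charge t.leafSet = - Pi.single j 1) →
    t.branchForm s = 0 ∨ ∃ x z, α.Planar t x z
  pos : ∀ j, charge t.leafSet = Pi.single j 1 → t.branchForm s = 0 ∨
    ∃ c, α.Comb s (.f j) t c ∧ ((∀ q ∈ t.leafSet, ¬ (c ≤ α.pos q ∧ α.pos q ≤ α.r j)) →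
      t.branchForm s * α.Z s (c - 1) (α.r j) = 0 ∨ ∃ x, α.Planar t x c)
  neg : charge t.leafSet = - Pi.single α.first 1 → t.branchForm s = 0 ∨
    ∃ c, α.Comb s (.af α.first) t c ∧
      (∀ q ∈ t.leafSet, c ≤ α.pos q → ¬ α.Bal 2 (α.pos q)) ∧
      (t.leafSet = α.Iv 1 c → α.Planar t 1 c)

theorem Vanish.swap {l r : PlaneTree k a} (h : α.Vanish s (.node l r)) :
    α.Vanish s (.node r l) := by
  have e : (node r l : PlaneTree k a).leafSet = (node l r).leafSet := by
    rw [leafSet_node, leafSet_node, Finset.union_comm]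
  refine ⟨fun hc => ?_, fun j hc => ?_, fun hc => ?_⟩ <;> rw [e] at hc
  · rcases h.closed hc with h | ⟨x, z, h⟩
    · exact .inl (branchForm_swap_eq_zero h)
    · exact .inr ⟨x, z, h.swap⟩
  · rcases h.pos j hc with h | ⟨c, h1, h2⟩
    · exact .inl (branchForm_swap_eq_zero h)
    · refine .inr ⟨c, h1.swap, fun hq => ?_⟩
      rw [e] at hq
      rcases h2 hq with h | ⟨x, h⟩
      · exact .inl (branchForm_swap_mul_eq_zero h)
      · exact .inr ⟨x, h.swap⟩
  · rcases h.neg hc with h | ⟨c, h1, h2, h3⟩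
    · exact .inl (branchForm_swap_eq_zero h)
    · refine .inr ⟨c, h1.swap, ?_, ?_⟩
      · rw [e]; exact h2
      · rw [e]; exact fun h => (h3 h).swap

theorem Vanish.of_zero {t : PlaneTree k a} (h : t.branchForm s = 0) : α.Vanish s t :=
  ⟨fun _ => .inl h, fun _ _ => .inl h, fun _ => .inl h⟩

theorem branchForm_node_eq_zero {l r : PlaneTree k a}
    (h : l.branchForm s = 0 ∨ r.branchForm s = 0) :
    (node l r).branchForm s = 0 := by
  rw [branchForm]
  rcases h with h | h <;> simp [h]

theorem disjoint_Iv {x z x' z' : ℕ} (h : Disjoint (α.Iv x z) (α.Iv x' z')) (h1 : x < z)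
    (h2 : x' < z') (hz : z ≤ 2 * k + a) : z ≤ x' ∨ z' ≤ x := by
  by_contra hc
  push Not at hc
  obtain ⟨p, hp⟩ := α.exists_pos (show max x x' < 2 * k + a by omega)
  exact Finset.disjoint_left.1 h (show p ∈ _ by rw [mem_Iv]; omega) (by rw [mem_Iv]; omega)

theorem first_of_pos {S : Finset (Particle k a)} (hr : α.root ∉ S) {j : Fin k}
    (h : charge S = Pi.single j 1) : j ≠ α.first := by
  rintro rfl
  have := congrFun h α.first
  rw [Pi.single_eq_same, BiColour.charge, if_neg (show Particle.f α.first ∉ S from hr)] at this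
  split_ifs at this <;> omega

/-- The branch with the right end is planar, or the product vanishes at once. If it does not begin
where the core of the comb ends, the polarization is annihilated. If it does, it occupies all
positions up to `r j`, which is the condition under which the open branch is known to be planar or
to vanish after multiplication. -/
theorem Vanish.pair (hs : α.Soft s) {l r : PlaneTree k a} (hb : α.Branch (.node l r)) {j : Fin k}
    (hl : charge l.leafSet = Pi.single j 1) (hr : charge r.leafSet = - Pi.single j 1)
    (vl : α.Vanish s l) (vr : α.Vanish s r) : α.Vanish s (.node l r) := by
  have hj := first_of_pos hb.left.root hl
  have hch : charge (node l r : PlaneTree k a).leafSet = 0 := by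
    rw [leafSet_node, charge_union hb.disjoint, hl, hr, add_neg_cancel]
  refine ⟨fun _ => ?_, fun i hi => ?_, fun hi => ?_⟩
  · rcases vl.pos j hl with h | ⟨c, cb, hL⟩
    · exact .inl (branchForm_node_eq_zero (.inl h))
    rcases vr.closed (.inr ⟨j, hj, hr⟩) with h | ⟨x, z, hp⟩
    · exact .inl (branchForm_node_eq_zero (.inr h))
    have hx2 := hb.right.two_le hp (by rw [hr]; simp [hj.symm])
    have hxz := hp.lt
    have hz := hp.le
    have er := hp.leafSet
    rw [er] at hr
    have hd := hb.disjoint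
    rw [er] at hd
    obtain ⟨r1, r2, r3, r4, r5⟩ := of_charge_Iv_neg hr
    have hD := cb.data (isOpen_f hj)
    have hcx : c ≤ x := by
      by_contra hc
      obtain ⟨p, hp⟩ := α.exists_pos (show x < 2 * k + a by omega)
      have h1 : p ∈ l.leafSet := hD.core (by
        rw [mem_Iv]; exact ⟨by rw [hp]; exact r1.le, by omega⟩)
      exact Finset.disjoint_left.1 hd h1 (by rw [mem_Iv]; omega)
    have hcl : α.Closed x z := .inr ⟨j, hj, r2, r3, r4, r5⟩
    obtain ⟨ε, hF⟩ := (hp.branchForm hs hb.right (by omega)).1 hx2 hcl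
    have hk := cb.polar_mem hs (isOpen_f hj) hx2 hxz hz (.right j hj rfl hcx r2 r3 r4 r5) hd
    have hkr : α.E s x z ≤ kills (r.branchForm s * 1) := by rw [mul_one, hF]; exact Z_kills _
    have hk := mem_sup_mono le_rfl hkr hk
    rw [← er] at hk
    rw [← mul_one (branchForm _ _)]
    -- The gap at the junction and the product of the right branch together contain the factor by
    -- which the form of the open branch vanishes.
    split_ifs at hk with hxc
    · subst hxc
      have hq : ∀ q ∈ l.leafSet, ¬ (x ≤ α.pos q ∧ α.pos q ≤ α.r j) := fun q h1 h2 =>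
        Finset.disjoint_left.1 hd h1 (by rw [mem_Iv]; omega)
      rcases hL hq with h | ⟨y, h⟩
      · left
        rw [branchForm_node_mul s hs.singleton l r 1 hk, mul_one, hF, mul_smul_comm,
          ι_mul_Z (by omega) (by omega), ← Z_mul (show x - 1 ≤ α.r j by omega)
          (show α.r j ≤ z - 1 by omega), mul_smul_comm, ← mul_assoc, h, zero_mul, smul_zero,
          smul_zero]
      · exact .inr ⟨y, z, h.node hp⟩
    · left
      rw [sub_zero] at hk
      exact branchForm_node_mul_eq_zero hs.singleton hk
  · rw [hch] at hi; exact absurd hi.symm (single_ne_zero_int _)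
  · rw [hch] at hi; exact absurd hi.symm (neg_single_ne_zero_int _)

/-- Both branches are intervals, or the product vanishes. Intervals that touch on either side form a
planar branch; otherwise `Soft.link_closed` leaves no gap and the polarization is annihilated. -/
theorem Vanish.closed_node (hs : α.Soft s) {l r : PlaneTree k a} (hb : α.Branch (.node l r))
    (hl : charge l.leafSet = 0 ∨ ∃ j, j ≠ α.first ∧ charge l.leafSet = - Pi.single j 1)
    (vl : α.Vanish s l) {x z : ℕ} (hr : α.Bal x z) (hp : α.Planar r x z) (hx : 2 ≤ x)
    (hE : α.E s x z ≤ kills (r.branchForm s)) :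
    (node l r).branchForm s = 0 ∨ ∃ x z, α.Planar (.node l r) x z := by
  rcases vl.closed hl with h | ⟨x', z', hp'⟩
  · exact .inl (branchForm_node_eq_zero (.inl h))
  have hx' : 2 ≤ x' := by
    refine hb.left.two_le hp' ?_
    rcases hl with h | ⟨j, hj, h⟩
    · rw [h]; rfl
    · rw [h]; simp [hj.symm]
  have hd := hb.disjoint
  have el := hp'.leafSet
  have er := hp.leafSet
  rw [el] at hl
  rw [er, el] at hd
  have hcl := closed_of_charge hl
  have hd := disjoint_Iv hd hp'.lt hp.lt hp'.le
  have hk := hs.link_closed hr hx hp.lt hp.le hcl hx' hp'.lt hp'.le (by omega)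
  obtain ⟨ε, hF⟩ := (hp'.branchForm hs hb.left (by omega)).1 hx' hcl
  by_cases h1 : z' = x
  · subst h1; exact .inr ⟨_, _, hp'.node hp⟩
  by_cases h2 : z = x'
  · subst h2; exact .inr ⟨_, _, (hp.node hp').swap⟩
  left
  unfold Link at hk
  rw [touch, if_neg h1, if_neg h2, add_zero, sub_zero, ← el, ← er] at hk
  rw [← mul_one (branchForm _ _)]
  refine branchForm_node_mul_eq_zero hs.singleton (mem_sup_mono ?_ ?_ hk)
  · rw [hF]; exact Z_kills _
  · rw [mul_one]; exact hE

/-- Three positions of the neutral branch. On the enclosed level it either extends the core, or it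
leaves a hole and the product vanishes. On the level after the pair the product vanishes, since the
core stops before `r j`. Elsewhere it is carried along as an `other` branch, and its fate is decided
when the positions up to `r j` are known to be free. -/
theorem Vanish.pos_node (hs : α.Soft s) {l r : PlaneTree k a} (hb : α.Branch (.node l r))
    {j : Fin k} (hl : charge l.leafSet = Pi.single j 1)
    (vl : α.Vanish s l) {x z : ℕ} (hr : α.Bal x z) (hp : α.Planar r x z) (hx : 2 ≤ x) {ε : ℝ}
    (hF : r.branchForm s = ε • α.Z s x (z - 1)) :
    (node l r).branchForm s = 0 ∨ ∃ c, α.Comb s (.f j) (.node l r) c ∧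
      ((∀ q ∈ (node l r : PlaneTree k a).leafSet, ¬ (c ≤ α.pos q ∧ α.pos q ≤ α.r j)) →
      (node l r).branchForm s * α.Z s (c - 1) (α.r j) = 0 ∨ ∃ x, α.Planar (.node l r) x c) := by
  have hj := first_of_pos hb.left.root hl
  have hE : α.E s x z ≤ kills (r.branchForm s) := by rw [hF]; exact Z_kills _
  have hxz := hp.lt
  have hz := hp.le
  have hd := hb.disjoint
  have er := hp.leafSet
  rw [er] at hd
  rcases vl.pos j hl with h | ⟨c, cb, hL⟩
  · exact .inl (branchForm_node_eq_zero (.inl h))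
  have hD := cb.data (isOpen_f hj)
  have d1 := hD.lt
  have d2 := hD.le_r j rfl
  have e1 : α.pos (.f j) = α.l j := rfl
  have e2 : α.endPos (.f j) = α.r j + 1 := rfl
  have hrj : α.r j < 2 * k + a := α.pos_lt _
  have hcore : ∀ q, α.l j ≤ α.pos q → α.pos q < c → ¬ (x ≤ α.pos q ∧ α.pos q < z) := by
    intro q h1 h2 h3
    exact Finset.disjoint_left.1 hd (hD.core (show q ∈ _ by rw [mem_Iv]; exact ⟨h1, h2⟩))
      (by rw [mem_Iv]; exact h3)
  have hzero : ∀ hX : α.Att (.f j) c x z, x ≠ c → (node l r).branchForm s = 0 := by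
    intro hX hxc
    have hk := cb.polar_mem hs (isOpen_f hj) hx hxz hz hX hd
    rw [if_neg hxc, sub_zero, ← er] at hk
    rw [← mul_one (branchForm _ _)]
    exact branchForm_node_mul_eq_zero hs.singleton
      (mem_sup_mono le_rfl (by rw [mul_one]; exact hE) hk)
  by_cases hsub : α.pos (.f j) < x ∧ α.Bal (α.pos (.f j) + 1) x
  · have hcx : c ≤ x := by
      by_contra hc
      obtain ⟨p, hp⟩ := α.exists_pos (show x < 2 * k + a by omega)
      exact hcore p (by omega) (by omega) (by omega)
    by_cases hxc : x = c
    swap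
    · exact .inl (hzero (.sub hcx hsub.2 hr) hxc)
    subst hxc
    have hcomb : α.Comb s (.f j) (node l r) z := .sub cb hxz hz hr er hE hd
    have hzr := (hcomb.data (isOpen_f hj)).le_r j rfl
    refine .inr ⟨z, hcomb, fun hq => ?_⟩
    have hqL : ∀ q ∈ l.leafSet, ¬ (x ≤ α.pos q ∧ α.pos q ≤ α.r j) := by
      intro q h1 h2
      have h3 := hq q (by rw [leafSet_node]; exact Finset.mem_union_left _ h1)
      exact Finset.disjoint_left.1 hd h1 (by rw [mem_Iv]; omega)
    rcases hL hqL with h | ⟨y, h⟩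
    · left
      have hk := cb.polar_mem hs (isOpen_f hj) hx hxz hz (.sub le_rfl hsub.2 hr) hd
      rw [if_pos rfl, ← er] at hk
      rw [branchForm_node_mul s hs.singleton l r _ (mem_sup_mono le_rfl (hE.trans (kills_mul _ _))
        hk), hF, smul_mul_assoc, Z_mul (by omega) (by omega), mul_smul_comm,
        ι_mul_Z (by omega) (by omega), mul_smul_comm, h, smul_zero, smul_zero]
    · exact .inr ⟨y, h.node hp⟩
  by_cases hnext : α.endPos (.f j) ≤ x ∧ α.Bal (α.endPos (.f j)) x
  · exact .inl (hzero (.next j rfl hnext.1 hnext.2 hr) (by omega))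
  refine .inr ⟨c, .other cb hx hxz hz hr er hE hd hsub hnext, fun hq => ?_⟩
  have hqL : ∀ q ∈ l.leafSet, ¬ (c ≤ α.pos q ∧ α.pos q ≤ α.r j) := fun q h1 =>
    hq q (by rw [leafSet_node]; exact Finset.mem_union_left _ h1)
  rcases hL hqL with h | ⟨y, h⟩
  · left
    -- Exchanging the branches puts the form of `l` next to the product of gaps by which it
    -- vanishes.
    apply branchForm_swap_mul_eq_zero
    rw [branchForm, smul_mul_assoc, mul_assoc, mul_assoc, h, mul_zero, mul_zero, smul_zero]
  · have el := h.leafSet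
    have hy := hb.left.two_le h (by rw [hl]; simp [hj.symm])
    rw [el] at hd hl
    have hyc := h.lt
    have hdis := disjoint_Iv hd hyc hxz (by omega)
    -- To the right of the core the neutral branch avoids the positions up to `r j` by assumption,
    -- and it does not begin at `r j + 1`, since it would then follow the pair directly.
    have hdis2 : z ≤ y ∨ α.r j + 1 < x := by
      rcases hdis with h1 | h1
      · right
        have h2 : α.r j < x := by
          by_contra h3
          obtain ⟨p, hp'⟩ := α.exists_pos (show x < 2 * k + a by omega)
          refine hq p ?_ (by omega)
          rw [leafSet_node, er]
          exact Finset.mem_union_right _ (by rw [mem_Iv]; omega)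
        have h4 : x ≠ α.r j + 1 := by
          intro h5
          exact hnext ⟨by omega, by rw [e2, h5]; exact Bal.self _⟩
        omega
      · exact .inl h1
    by_cases hzy : z = y
    · subst hzy; exact .inr ⟨x, (hp.node h).swap⟩
    left
    obtain ⟨δ, hδ⟩ := (h.branchForm hs hb.left (by omega)).2 j hl
    have hk := hs.polar_pos_mem hl hy hr hx hxz hz hdis2
    rw [if_neg hzy, sub_zero, polar_comm, ← el, ← er] at hk
    apply branchForm_swap_mul_eq_zero
    refine branchForm_node_mul_eq_zero hs.singleton (mem_sup_mono hE ?_ hk)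
    rw [hδ]
    exact Z_kills (z := α.r j + 1) _

/-- Here the comb grows from r₁ along the top level. A neutral branch on this level extends the core
or makes the product vanish; a branch inside some pair is kept as `other`, and none of its positions
is on the top level. -/
theorem Vanish.neg_node (hs : α.Soft s) {l r : PlaneTree k a} (hb : α.Branch (.node l r))
    (hl : charge l.leafSet = - Pi.single α.first 1)
    (vl : α.Vanish s l) {x z : ℕ} (hr : α.Bal x z) (hp : α.Planar r x z) (hx : 2 ≤ x)
    (hE : α.E s x z ≤ kills (r.branchForm s)) :
    (node l r).branchForm s = 0 ∨ ∃ c, α.Comb s (.af α.first) (.node l r) c ∧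
      (∀ q ∈ (node l r : PlaneTree k a).leafSet, c ≤ α.pos q → ¬ α.Bal 2 (α.pos q)) ∧
      ((node l r : PlaneTree k a).leafSet = α.Iv 1 c → α.Planar (.node l r) 1 c) := by
  have hxz := hp.lt
  have hz := hp.le
  have hd := hb.disjoint
  have er := hp.leafSet
  rw [er] at hd
  rcases vl.neg hl with h | ⟨c, cb, hq, hS⟩
  · exact .inl (branchForm_node_eq_zero (.inl h))
  have hD := cb.data isOpen_af_first
  have d1 := hD.lt
  have e1 : α.pos (.af α.first) = 1 := pos_af_first
  have e2 : α.endPos (.af α.first) = 2 := congrArg (· + 1) (pos_af_first (α := α))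
  have hcore : ∀ q, 1 ≤ α.pos q → α.pos q < c → ¬ (x ≤ α.pos q ∧ α.pos q < z) := by
    intro q h1 h2 h3
    exact Finset.disjoint_left.1 hd (hD.core (show q ∈ _ by rw [mem_Iv, e1]; exact ⟨h1, h2⟩))
      (by rw [mem_Iv]; exact h3)
  have hcx : c ≤ x := by
    by_contra hc
    obtain ⟨p, hp⟩ := α.exists_pos (show x < 2 * k + a by omega)
    exact hcore p (by omega) (by omega) (by omega)
  by_cases hsub : α.Bal 2 x
  · by_cases hxc : x = c
    · subst hxc
      refine .inr ⟨z, .sub cb hxz hz hr er hE hd, fun q h1 h2 => ?_, fun h => ?_⟩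
      · rw [leafSet_node, er, Finset.mem_union, mem_Iv] at h1
        exact hq q (h1.resolve_right (by omega)) (by omega)
      · refine (hS ?_).node hp
        rw [leafSet_node, er, ← Iv_append (show 1 ≤ x by omega) hxz.le] at h
        have h1 : Disjoint (α.Iv 1 x) (α.Iv x z) := Iv_disjoint (.inl le_rfl)
        rw [← Finset.union_sdiff_cancel_right hd, h, Finset.union_sdiff_cancel_right h1]
    · left
      have hk := cb.polar_mem hs isOpen_af_first hx hxz hz (.sub hcx (by rw [e1]; exact hsub) hr) hd
      rw [if_neg hxc, sub_zero, ← er] at hk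
      rw [← mul_one (branchForm _ _)]
      exact branchForm_node_mul_eq_zero hs.singleton
        (mem_sup_mono le_rfl (by rw [mul_one]; exact hE) hk)
  · refine .inr ⟨c, .other cb hx hxz hz hr er hE hd (by rw [e1]; exact fun h => hsub h.2)
      (by rw [e2]; exact fun h => hsub h.2), fun q h1 h2 => ?_, fun h => ?_⟩
    · rw [leafSet_node, er, Finset.mem_union, mem_Iv] at h1
      rcases h1 with h1 | h1
      · exact hq q h1 h2
      -- If a position inside the neutral interval were on the top level, so would be its beginning:
      -- a bracket open at `x` would have to close inside the interval.
      · intro h3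
        apply hsub
        intro i
        have h4 := h3 i
        have h5 := hr i
        have h6 := α.l_lt_r i
        omega
    · exfalso
      obtain ⟨p, hp⟩ := α.exists_pos (show x < 2 * k + a by omega)
      have h1 : p ∈ (node l r : PlaneTree k a).leafSet := by
        rw [leafSet_node, er]
        exact Finset.mem_union_right _ (by rw [mem_Iv]; omega)
      rw [h, mem_Iv] at h1
      omega

theorem Vanish.node (hs : α.Soft s) {l r : PlaneTree k a} (hb : α.Branch (.node l r))
    (hr : charge r.leafSet = 0) (vl : α.Vanish s l) (vr : α.Vanish s r) :
    α.Vanish s (.node l r) := by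
  rcases vr.closed (.inl hr) with h | ⟨x, z, hp⟩
  · exact .of_zero (branchForm_node_eq_zero (.inr h))
  have hx := hb.right.two_le hp (by rw [hr]; rfl)
  have hbal : α.Bal x z := by rw [bal_iff_charge, ← hp.leafSet]; exact hr
  obtain ⟨ε, hF⟩ := (hp.branchForm hs hb.right (by omega)).1 hx (.inl hbal)
  have hE : α.E s x z ≤ kills (r.branchForm s) := by rw [hF]; exact Z_kills _
  have hch : charge (PlaneTree.node l r : PlaneTree k a).leafSet = charge l.leafSet := by
    rw [leafSet_node, charge_union hb.disjoint, hr, add_zero]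
  exact ⟨fun h => closed_node hs hb (by rwa [hch] at h) vl hbal hp hx hE,
    fun j h => pos_node hs hb (by rwa [hch] at h) vl hbal hp hx hF,
    fun h => neg_node hs hb (by rwa [hch] at h) vl hbal hp hx hE⟩

/-- Induction on the tree: at each vertex one of the branches is neutral or the two flavours cancel,
and swapping the branches leaves `Vanish.node` and `Vanish.pair`. -/
theorem Branch.vanish (hs : α.Soft s) {t : PlaneTree k a} (hb : α.Branch t) : α.Vanish s t := by
  induction t with
  | leaf p =>
    have e : (PlaneTree.leaf p : PlaneTree k a).leafSet = {p} := by
      simp [PlaneTree.leafSet, leaves]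
    refine ⟨fun _ => .inr ⟨_, _, (drawn_leaf p).planar⟩, fun j hj => .inr ?_, fun hj => .inr ?_⟩
    · have hp : p = .f j := by
        rw [e] at hj
        cases p with
        | f i => rw [charge_f] at hj; rw [single_int_inj hj]
        | af i => rw [charge_af] at hj; exact absurd hj.symm (single_ne_neg_single _ _)
        | adj g => rw [charge_adj] at hj; exact absurd hj.symm (single_ne_zero_int _)
      subst hp
      exact ⟨_, .leaf, fun _ => .inr ⟨_, (drawn_leaf _).planar⟩⟩
    · have hp : p = .af α.first := by
        rw [e] at hj
        cases p with
        | f i => rw [charge_f] at hj; exact absurd hj (single_ne_neg_single _ _)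
        | af i => rw [charge_af] at hj; rw [single_int_inj (neg_injective hj)]
        | adj g => rw [charge_adj] at hj; exact absurd hj.symm (neg_single_ne_zero_int _)
      subst hp
      refine ⟨_, .leaf, fun q hq h => ?_, fun _ => ?_⟩
      · rw [e, Finset.mem_singleton] at hq
        subst hq; omega
      · have := drawn_leaf (α := α) (.af α.first)
        rw [pos_af_first] at this ⊢
        exact this.planar
  | node l r il ir =>
    have il := il hb.left
    have ir := ir hb.right
    have al := isAllowed_leafSet hb.left.allowed
    have ar := isAllowed_leafSet hb.right.allowed
    have alr := isAllowed_leafSet hb.allowed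
    rw [leafSet_node] at alr
    rcases charge_cases hb.disjoint al ar alr with hc | hc | ⟨j, ⟨h1, h2⟩ | ⟨h1, h2⟩⟩
    · exact (Vanish.node hs hb.swap hc ir il).swap
    · exact Vanish.node hs hb hc il ir
    · exact Vanish.pair hs hb h1 h2 il ir
    · exact (Vanish.pair hs hb.swap h2 h1 ir il).swap

end MeliaOrdering

/-! ### A model of the relations -/

namespace MeliaOrdering

/-- The sum of `x p q` over the pairs in `I`. -/
def pairSum (x : Particle k a → Particle k a → ℝ) (I : Finset (Particle k a)) : ℝ :=
  ∑ p ∈ I, ∑ q ∈ I, x p q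

theorem pairSum_union (x : Particle k a → Particle k a → ℝ) {X Y : Finset (Particle k a)}
    (h : Disjoint X Y) : pairSum x (X ∪ Y) = pairSum x X + pairSum x Y +
      (∑ p ∈ X, ∑ q ∈ Y, x p q + ∑ p ∈ Y, ∑ q ∈ X, x p q) := by
  unfold pairSum
  rw [Finset.sum_union h]
  simp only [Finset.sum_union h, Finset.sum_add_distrib]
  ring

/-- A sum over pairs is quadratic in the indicator function of the set, so the seven-term relation
holds for all disjoint sets, whatever their flavour. -/
theorem pairSum_add (x : Particle k a → Particle k a → ℝ) {X Y Z : Finset (Particle k a)}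
    (hXY : Disjoint X Y) (hXZ : Disjoint X Z) (hYZ : Disjoint Y Z) :
    pairSum x (X ∪ Y) + pairSum x (Y ∪ Z) + pairSum x (X ∪ Z) =
      pairSum x X + pairSum x Y + pairSum x Z + pairSum x (X ∪ Y ∪ Z) := by
  rw [pairSum_union x (X := X ∪ Y) (Y := Z) (Finset.disjoint_union_left.2 ⟨hXZ, hYZ⟩),
    pairSum_union x hXY, pairSum_union x hXZ, pairSum_union x hYZ, Finset.sum_union hXY]
  simp only [Finset.sum_union hXY, Finset.sum_add_distrib]
  ring

/-- A triangular system of equations for the terms of a sum over pairs. -/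
theorem exists_pairSum {α : MeliaOrdering k a}
    (K : Particle k a → Particle k a → Finset (Particle k a))
    (m : Particle k a → Particle k a → ℕ) (val : Particle k a → Particle k a → ℝ)
    (hl : ∀ p q, p ∈ K p q) (hr : ∀ p q, q ∈ K p q)
    (hm : ∀ p q, α.pos p < α.pos q → ∀ p' ∈ K p q, ∀ q' ∈ K p q, α.pos p' < α.pos q' →
      (p', q') ≠ (p, q) → m p' q' < m p q) :
    ∃ x : Particle k a → Particle k a → ℝ, (∀ p q, ¬ α.pos p < α.pos q → x p q = 0) ∧
      ∀ p q, α.pos p < α.pos q → pairSum x (K p q) = val p q := by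
  have key : ∀ N, ∃ x : Particle k a → Particle k a → ℝ,
      (∀ p q, ¬ α.pos p < α.pos q → x p q = 0) ∧
      ∀ p q, α.pos p < α.pos q → m p q < N → pairSum x (K p q) = val p q := by
    intro N
    induction N with
    | zero => exact ⟨0, fun _ _ _ => rfl, fun _ _ _ h => absurd h (Nat.not_lt_zero _)⟩
    | succ N ih =>
      obtain ⟨x, hx, hv⟩ := ih
      classical
      -- The coefficients are corrected only at pairs of measure `N`, each by its own defect. A set
      -- `K p q` of measure at most `N` contains no pair of measure `N` other than possibly `(p,
      -- q)`, so the equations do not interfere.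
      let c : Particle k a → Particle k a → ℝ := fun p q =>
        if α.pos p < α.pos q ∧ m p q = N then val p q - pairSum x (K p q) else 0
      refine ⟨fun p q => x p q + c p q, fun p q h => ?_, fun p q h hN => ?_⟩
      · have : c p q = 0 := if_neg (fun h' => h h'.1)
        simp only [hx p q h, this, add_zero]
      · have hsum : pairSum (fun p q => x p q + c p q) (K p q) =
            pairSum x (K p q) + pairSum c (K p q) := by
          simp only [pairSum, Finset.sum_add_distrib]
        have hc : pairSum c (K p q) = c p q := by
          have h0 : ∀ p' ∈ K p q, ∀ q' ∈ K p q, (p', q') ≠ (p, q) → c p' q' = 0 := by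
            intro p' hp' q' hq' hne
            refine if_neg fun h' => ?_
            have := hm p q h p' hp' q' hq' h'.1 hne
            omega
          unfold pairSum
          rw [Finset.sum_eq_single p, Finset.sum_eq_single q]
          · intro q' hq' hne
            exact h0 p (hl p q) q' hq' (fun h => hne (Prod.ext_iff.1 h).2)
          · exact fun h => absurd (hr p q) h
          · intro p' hp' hne
            exact Finset.sum_eq_zero fun q' hq' => h0 p' hp' q' hq'
              (fun h => hne (Prod.ext_iff.1 h).1)
          · exact fun h => absurd (hl p q) h
        rw [hsum, hc]
        rcases Nat.lt_succ_iff_lt_or_eq.1 hN with h1 | h1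
        · have : c p q = 0 := if_neg (fun h' => by omega)
          rw [this, add_zero, hv p q h h1]
        · have : c p q = val p q - pairSum x (K p q) := if_pos ⟨h, h1⟩
          rw [this]; ring
  -- Any common bound for the measures will do.
  let N := ∑ p, ∑ q, m p q
  obtain ⟨x, hx, hv⟩ := key (N + 1)
  refine ⟨x, hx, fun p q h => hv p q h (Nat.lt_succ_of_le ?_)⟩
  calc m p q ≤ ∑ q, m p q := Finset.single_le_sum (fun _ _ => Nat.zero_le _) (Finset.mem_univ q)
    _ ≤ N := Finset.single_le_sum (f := fun p => ∑ q, m p q) (fun _ _ => Nat.zero_le _)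
      (Finset.mem_univ p)

variable (α : MeliaOrdering k a)

open Classical in
/-- The block that starts with `p`, if it does not contain `q`, and otherwise the particle `p`. -/
def part (p q : Particle k a) : Finset (Particle k a) :=
  if α.IsStart p ∧ q ∉ α.head p then α.head p else {p}

open Classical in
/-- The channel in whose Mandelstam variable the term of the pair `(p, q)` dominates. -/
def lead (p q : Particle k a) : Finset (Particle k a) :=
  (if α.IsStart q ∧ α.Bal (α.endPos p) (α.pos q) then {p} else α.part p q) ∪ α.part q p

variable {α}

theorem mem_head_self (p : Particle k a) : p ∈ α.head p := by
  rw [head, mem_Iv]; exact ⟨le_rfl, α.pos_lt_endPos p⟩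

theorem mem_part_self (p q : Particle k a) : p ∈ α.part p q := by
  unfold part; split_ifs
  · exact mem_head_self p
  · exact Finset.mem_singleton_self p

theorem part_subset_head (p q : Particle k a) : α.part p q ⊆ α.head p := by
  unfold part; split_ifs
  · rfl
  · exact Finset.singleton_subset_iff.2 (mem_head_self p)

theorem lead_subset (p q : Particle k a) : α.lead p q ⊆ α.part p q ∪ α.part q p := by
  unfold lead
  apply Finset.union_subset_union_left
  split_ifs
  · exact Finset.singleton_subset_iff.2 (mem_part_self p q)
  · rfl

theorem left_mem_lead (p q : Particle k a) : p ∈ α.lead p q := by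
  unfold lead
  apply Finset.mem_union_left
  split_ifs
  · exact Finset.mem_singleton_self p
  · exact mem_part_self p q

theorem right_mem_lead (p q : Particle k a) : q ∈ α.lead p q :=
  Finset.mem_union_right _ (mem_part_self q p)

theorem part_subset_of_mem {p q r : Particle k a} (hp : α.IsStart p) (hq : q ∈ α.head p) :
    α.part q r ⊆ α.head p := by
  unfold part
  split_ifs with h
  · intro x hx
    rw [head, mem_Iv] at *
    rcases h.1.cases with ⟨j, -, rfl⟩ | ⟨g, rfl⟩
    · have h1 : α.pos (.f j) = α.l j := rfl
      have h2 : α.endPos (.f j) = α.r j + 1 := rfl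
      have h3 := hp.bal j
      omega
    · have h2 : α.endPos (.adj g : Particle k a) = α.pos (.adj g) + 1 := rfl
      omega
  · exact Finset.singleton_subset_iff.2 hq

theorem notMem_part {p q : Particle k a} (h : p ≠ q) : p ∉ α.part q p := by
  unfold part
  split_ifs with h1
  · exact h1.2
  · rwa [Finset.mem_singleton]

/-- A block inside a block stays inside it, and if `p` is not expanded because its block contains
`q`, then neither is it against any `q'` of the part of `q`. -/
theorem part_subset_part {p q p' q' : Particle k a} (hp : p' ∈ α.part p q) (hq : q' ∈ α.part q p) :
    α.part p' q' ⊆ α.part p q := by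
  by_cases h : α.IsStart p ∧ q ∉ α.head p
  · have e : α.part p q = α.head p := if_pos h
    rw [e] at hp ⊢
    exact part_subset_of_mem h.1 hp
  · have e : α.part p q = {p} := if_neg h
    rw [e, Finset.mem_singleton] at hp
    subst hp
    rw [e]
    have : ¬ (α.IsStart p' ∧ q' ∉ α.head p') := by
      intro h1
      apply h1.2
      have h2 : q ∈ α.head p' := by by_contra h3; exact h ⟨h1.1, h3⟩
      exact part_subset_of_mem h1.1 h2 hq
    rw [part, if_neg this]

theorem card_lt_of_ne_left {p q p' q' : Particle k a} (hpq : p ≠ q) (hp : p' ∈ α.part p q)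
    (hq : q' ∈ α.part q p) (h : p' ≠ p) :
    (α.part p' q' ∪ α.part q' p').card < (α.part p q ∪ α.part q p).card := by
  apply Finset.card_lt_card
  rw [Finset.ssubset_iff_of_subset
    (Finset.union_subset_union (part_subset_part hp hq) (part_subset_part hq hp))]
  refine ⟨p, Finset.mem_union_left _ (mem_part_self p q), ?_⟩
  rw [Finset.mem_union]
  rintro (h1 | h1)
  · have h2 := part_subset_head _ _ h1
    have h3 := part_subset_head _ _ hp
    rw [head, mem_Iv] at h2 h3
    exact h (α.pos_inj.1 (by omega))
  · exact notMem_part hpq (part_subset_part hq hp h1)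

theorem card_lt_of_mem {p q p' q' : Particle k a} (hp : p' ∈ α.part p q)
    (hq : q' ∈ α.part p q) (hne : p' ≠ q') :
    (α.part p' q' ∪ α.part q' p').card < (α.part p q ∪ α.part q p).card := by
  by_cases h : α.IsStart p ∧ q ∉ α.head p
  · have e : α.part p q = α.head p := if_pos h
    rw [e] at hp hq ⊢
    refine lt_of_le_of_lt (Finset.card_le_card (Finset.union_subset
      (part_subset_of_mem h.1 hp) (part_subset_of_mem h.1 hq)) : _ ≤ (α.head p).card) ?_
    apply Finset.card_lt_card
    rw [Finset.ssubset_iff_of_subset Finset.subset_union_left]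
    exact ⟨q, Finset.mem_union_right _ (mem_part_self q p), h.2⟩
  · have e : α.part p q = {p} := if_neg h
    rw [e, Finset.mem_singleton] at hp hq
    exact absurd (hp.trans hq.symm) hne

/-- The measure that makes the system triangular: any other pair inside the two parts of `(p, q)`
has strictly smaller parts, because it loses `p` or `q`. -/
theorem card_part_lt {p q p' q' : Particle k a} (h : α.pos p < α.pos q) (h' : α.pos p' < α.pos q')
    (hp : p' ∈ α.part p q ∪ α.part q p) (hq : q' ∈ α.part p q ∪ α.part q p)
    (hne : (p', q') ≠ (p, q)) :
    (α.part p' q' ∪ α.part q' p').card < (α.part p q ∪ α.part q p).card := by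
  have h1 : p ≠ q := by rintro rfl; omega
  have h2 : p' ≠ q' := by rintro rfl; omega
  have cases : ∀ {p' q' : Particle k a}, (p', q') ≠ (p, q) → p' ∈ α.part p q → q' ∈ α.part q p →
      (α.part p' q' ∪ α.part q' p').card < (α.part p q ∪ α.part q p).card := by
    intro p' q' hne hp hq
    by_cases h3 : p' = p
    · have h4 : q' ≠ q := fun h4 => hne (by rw [h3, h4])
      rw [Finset.union_comm, Finset.union_comm (α.part p q)]
      exact card_lt_of_ne_left h1.symm hq hp h4
    · exact card_lt_of_ne_left h1 hp hq h3
  rcases Finset.mem_union.1 hp with hp | hp <;> rcases Finset.mem_union.1 hq with hq | hq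
  · exact card_lt_of_mem hp hq h2
  · exact cases hne hp hq
  · rw [Finset.union_comm (α.part p' q')]
    refine cases ?_ hq hp
    rintro ⟨⟩
    omega
  · rw [Finset.union_comm (α.part p q)]
    exact card_lt_of_mem hp hq h2

/-- The pair `(p, q)` dominates in a gap. -/
def IsGap (α : MeliaOrdering k a) (p q : Particle k a) : Prop :=
  (α.IsStart q ∧ α.pos q = α.pos p + 1) ∨
  ∃ j, q = .af j ∧ α.IsStart p ∧ (α.endPos p = α.r j ∨ (p = .f j ∧ α.r j = α.l j + 1))

theorem part_eq_head {p q : Particle k a} (h : α.IsStart p) (hq : ¬ (α.pos p ≤ α.pos q ∧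
    α.pos q < α.endPos p)) : α.part p q = α.head p :=
  if_pos ⟨h, by rwa [head, mem_Iv]⟩

theorem part_eq_single {p q : Particle k a} (h : ¬ α.IsStart p ∨ α.pos p ≤ α.pos q ∧
    α.pos q < α.endPos p) : α.part p q = {p} := by
  refine if_neg fun h1 => ?_
  rcases h with h | h
  · exact h h1.1
  · exact h1.2 (by rwa [head, mem_Iv])

theorem not_isStart_af (j : Fin k) : ¬ α.IsStart (.af j) := fun h => h.2 j rfl

theorem head_adj (g : Fin a) : α.head (.adj g) = {.adj g} := Iv_pos _

theorem part_adj (g : Fin a) (q : Particle k a) : α.part (.adj g) q = {.adj g} := by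
  unfold part; rw [head_adj]; split_ifs <;> rfl

theorem lead_of_not_start {p q : Particle k a} (h : ¬ α.IsStart q) :
    α.lead p q = α.part p q ∪ {q} := by
  rw [lead, if_neg (fun h1 => h h1.1), part_eq_single (p := q) (.inl h)]

/-- The leading pair of a gap consists of the two starts, or of the start of the block that ends
before a right end and this right end. As its second member is at `g + 1`, different gaps have
different leading pairs. -/
theorem exists_lead_of_gap {g : ℕ} (hg : 1 ≤ g) (hg' : g + 1 < 2 * k + a) :
    ∃ p q, α.pos p < α.pos q ∧ α.IsGap p q ∧ α.pos q = g + 1 ∧ α.gapAt g = α.lead p q := by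
  classical
  obtain ⟨v, hv⟩ := α.exists_pos hg'
  obtain ⟨u, hu⟩ := α.exists_pos (show g < 2 * k + a by omega)
  have hgap : α.gapAt g = α.gap u v := by rw [← hu]; exact gapAt_pos (by omega)
  have hu0 : u ≠ α.root := by
    rintro rfl
    rw [α.pos_root] at hu; omega
  rw [hgap]
  by_cases hs : α.IsStart v
  · refine ⟨u, v, by omega, .inl ⟨hs, by omega⟩, hv, ?_⟩
    rw [gap_start hs, lead, part_eq_head hs (by omega)]
    have : (if α.IsStart v ∧ α.Bal (α.endPos u) (α.pos v) then {u} else α.part u v) = {u} := by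
      split_ifs
      · rfl
      · by_cases hus : α.IsStart u
        · rcases hus.cases with ⟨j, -, rfl⟩ | ⟨i, rfl⟩
          · apply part_eq_single
            have h1 : α.pos (.f j) = α.l j := rfl
            have h2 : α.endPos (.f j) = α.r j + 1 := rfl
            have h3 := α.l_lt_r j
            right; omega
          · exact part_adj i v
        · exact part_eq_single (.inl hus)
    convert (Finset.insert_eq u (α.head v)).trans (congrArg (· ∪ α.head v) this.symm)
  · have hv' : ∃ j, v = .af j := by
      by_contra hc
      push Not at hc
      refine hs ⟨?_, hc⟩
      rintro rfl
      rw [α.pos_root] at hv; omega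
    obtain ⟨j, rfl⟩ := hv'
    have hj : α.r j = g + 1 := hv
    have hlj := α.l_lt_r j
    have hjf : j ≠ α.first := by
      rintro rfl
      rw [α.r_first] at hj; omega
    have hbj := α.bal_interior j
    cases u with
    | f i =>
      have hi : α.l i = g := hu
      have hij : i = j := by
        by_contra hij
        have h1 := hbj i
        have h2 : α.r i ≠ α.r j := fun h => hij (α.r_inj.1 h)
        have h3 : α.l i ≠ α.l j := fun h => hij (α.l_inj.1 h)
        have h4 := α.l_lt_r i
        omega
      subst hij
      refine ⟨.f i, .af i, by omega, .inr ⟨i, rfl, α.isStart_f hjf, .inr ⟨rfl, by omega⟩⟩, hv, ?_⟩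
      rw [lead_of_not_start (not_isStart_af i), part_eq_single]
      · rw [gap, tail]; ext p; simp [or_comm]
      · have h1 : α.pos (.f i) = α.l i := rfl
        have h2 : α.endPos (.f i) = α.r i + 1 := rfl
        have h3 : α.pos (.af i) = α.r i := rfl
        right; omega
    | af i =>
      have hi : α.r i = g := hu
      have hif : i ≠ α.first := by
        rintro rfl
        rw [α.r_first] at hi
        have := α.two_le_l hjf
        omega
      have h1 : α.pos (.f i) = α.l i := rfl
      have h2 : α.endPos (.f i) = α.r i + 1 := rfl
      have h3 : α.pos (.af j) = α.r j := rfl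
      have h4 := α.l_lt_r i
      refine ⟨.f i, .af j, by omega, .inr ⟨j, rfl, α.isStart_f hif, .inl (by omega)⟩, hv, ?_⟩
      rw [lead_of_not_start (not_isStart_af j), part_eq_head (α.isStart_f hif) (by omega)]
      rw [gap, tail, Finset.insert_eq, Finset.union_comm]; rfl
    | adj i =>
      have h2 : α.endPos (.adj i : Particle k a) = α.pos (.adj i) + 1 := rfl
      refine ⟨.adj i, .af j, by omega, .inr ⟨j, rfl, α.isStart_adj i, .inl (by omega)⟩, hv, ?_⟩
      rw [lead_of_not_start (not_isStart_af j), part_adj]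
      rw [gap, tail, Finset.insert_eq, Finset.union_comm]

/-- Each constraint is the leading set of some pair, and the separation required in `Cons` is what
keeps this pair from being that of a gap. The equations for constraints and gaps are therefore
compatible. -/
theorem exists_lead_of_cons {I : Finset (Particle k a)} (h : α.Cons I) :
    ∃ p q, α.pos p < α.pos q ∧ ¬ α.IsGap p q ∧ I = α.lead p q := by
  classical
  cases h with
  | @apart u v hu hv huv hb =>
    have h1 := α.pos_lt_endPos u
    refine ⟨u, v, by omega, ?_, ?_⟩
    · rintro (⟨-, h⟩ | ⟨j, rfl, -⟩)
      · exact hb (by rw [show α.endPos u = α.pos v by omega]; exact Bal.self _)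
      · exact not_isStart_af j hv
    · rw [lead, if_neg (fun h => hb h.2), part_eq_head hu (by omega), part_eq_head hv (by omega)]
  | @right u j hu hj hn h1 h2 =>
    rw [head, mem_Iv] at hn
    have h3 : α.pos (.af j) = α.r j := rfl
    have h4 := α.pos_lt_endPos u
    rcases Nat.lt_or_ge (α.pos u) (α.r j) with h | h
    · refine ⟨u, .af j, by omega, ?_, ?_⟩
      · rintro (⟨h, -⟩ | ⟨i, hi, -, h5⟩)
        · exact not_isStart_af j h
        · injection hi with hi
          subst hi
          rcases h5 with h5 | ⟨rfl, -⟩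
          · exact h1 h5
          · have h5 : α.endPos (.f j) = α.r j + 1 := rfl
            omega
      · rw [lead_of_not_start (not_isStart_af j), part_eq_head hu (by omega), Finset.insert_eq,
          Finset.union_comm]
    · have hne : α.pos u ≠ α.r j := by
        rw [← h3, Ne, α.pos_inj]; rintro rfl; exact not_isStart_af j hu
      refine ⟨.af j, u, by omega, ?_, ?_⟩
      · rintro (⟨-, h⟩ | ⟨i, rfl, h5, -⟩)
        · omega
        · exact not_isStart_af j h5
      · rw [lead, part_eq_head hu (by omega), part_eq_single (.inl (not_isStart_af j)),
          Finset.insert_eq]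
        split_ifs <;> rfl
  | @left w u hw hu h1 h2 =>
    refine ⟨w, u, by omega, ?_, ?_⟩
    · rintro (⟨-, h⟩ | ⟨i, rfl, h5, -⟩)
      · omega
      · exact not_isStart_af i hu
    · rw [lead, part_eq_head hu (by omega), Finset.insert_eq]
      have : (if α.IsStart u ∧ α.Bal (α.endPos w) (α.pos u) then {w} else α.part w u) = {w} := by
        split_ifs with h3
        · rfl
        · by_cases hws : α.IsStart w
          · rcases hws.cases with ⟨j, -, rfl⟩ | ⟨i, rfl⟩
            · apply part_eq_single
              right
              have h4 : α.pos (.f j) = α.l j := rfl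
              have h5 : α.endPos (.f j) = α.r j + 1 := rfl
              have h6 := h2.resolve_left (fun h => h3 ⟨hu, h.2⟩) j
              have h7 := α.l_lt_r j
              have h8 : α.r j ≠ α.pos u := by
                rw [show α.r j = α.pos (.af j) from rfl, Ne, α.pos_inj]
                rintro rfl
                exact not_isStart_af j hu
              omega
            · exact part_adj i u
          · exact part_eq_single (.inl hws)
      convert (congrArg (· ∪ α.head u) this.symm)
  | @pair j hj h =>
    have h1 : α.pos (.f j) = α.l j := rfl
    have h2 : α.endPos (.f j) = α.r j + 1 := rfl
    have h3 : α.pos (.af j) = α.r j := rfl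
    have h4 := α.l_lt_r j
    refine ⟨.f j, .af j, by omega, ?_, ?_⟩
    · rintro (⟨h, -⟩ | ⟨i, hi, -, h5⟩)
      · exact not_isStart_af j h
      · injection hi with hi
        subst hi
        rcases h5 with h5 | ⟨-, h5⟩
        · omega
        · omega
    · rw [lead_of_not_start (not_isStart_af j), part_eq_single (.inr (by omega))]
      rfl

/-- The vectors of the gaps are independent. -/
theorem exists_soft (α : MeliaOrdering k a) (y : ℕ → ℝ) :
    ∃ s : Finset (Particle k a) → ℝ, α.Soft s ∧
      ∀ g, 1 ≤ g → g + 1 < 2 * k + a → α.gapVec s g = y g := by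
  classical
  obtain ⟨x, hx, hv⟩ := exists_pairSum (α := α) α.lead
    (fun p q => (α.part p q ∪ α.part q p).card)
    (fun p q => if α.IsGap p q then y (α.pos q - 1) else 0) left_mem_lead right_mem_lead
    (fun p q h p' hp q' hq h' hne =>
      card_part_lt h h' (lead_subset p q hp) (lead_subset p q hq) hne)
  refine ⟨pairSum x, ⟨fun X Y Z _ _ _ h1 h2 h3 _ _ _ _ => pairSum_add x h1 h2 h3, fun I hI => ?_,
    fun I hI => ?_⟩, fun g h1 h2 => ?_⟩
  · rw [Finset.card_le_one] at hI
    refine Finset.sum_eq_zero fun p hp => Finset.sum_eq_zero fun q hq => hx p q ?_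
    rw [hI p hp q hq]; exact lt_irrefl _
  · obtain ⟨p, q, h1, h2, rfl⟩ := exists_lead_of_cons hI
    rw [hv p q h1, if_neg h2]
  · obtain ⟨p, q, h3, h4, h5, h6⟩ := exists_lead_of_gap (α := α) h1 h2
    rw [gapVec, h6, hv p q h3, if_pos h4, h5, Nat.add_sub_cancel]

end MeliaOrdering

/-! ### Graphs and their propagators -/

namespace PlaneTree

theorem leafSet_nonempty (t : PlaneTree k a) : t.leafSet.Nonempty := by
  cases t with
  | leaf p => exact ⟨p, by simp [leafSet, leaves]⟩
  | node l r =>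
    rw [leafSet_node]
    obtain ⟨p, hp⟩ := List.exists_mem_of_ne_nil _ (MeliaOrdering.leaves_ne_nil l)
    exact ⟨p, Finset.mem_union_left _ (List.mem_toFinset.2 hp)⟩

theorem leafSet_leaf (p : Particle k a) : (leaf p : PlaneTree k a).leafSet = {p} := by
  simp [leafSet, leaves]

theorem disjoint_of_nodup {l r : PlaneTree k a} (h : (node l r).leaves.Nodup) :
    Disjoint l.leafSet r.leafSet := by
  have := (List.nodup_append'.1 h).2.2
  rw [Finset.disjoint_left]
  intro p h1 h2
  exact this (List.mem_toFinset.1 h1) (List.mem_toFinset.1 h2)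

theorem subset_of_mem_channels {t : PlaneTree k a} {I : Finset (Particle k a)}
    (h : I ∈ t.channels) : I ⊆ t.leafSet ∧ I.Nonempty := by
  induction t with
  | leaf p => simp [channels] at h
  | node l r il ir =>
    rw [leafSet_node]
    rcases Finset.mem_insert.1 h with rfl | h
    · rw [← leafSet_node]; exact ⟨subset_rfl, leafSet_nonempty _⟩
    · rcases Finset.mem_union.1 h with h | h
      · exact ⟨(il h).1.trans Finset.subset_union_left, (il h).2⟩
      · exact ⟨(ir h).1.trans Finset.subset_union_right, (ir h).2⟩

theorem ne_of_mem_props {t : PlaneTree k a} (ht : t.leaves.Nodup) {I : Finset (Particle k a)}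
    (h : I ∈ t.props) : I ≠ t.leafSet := by
  cases t with
  | leaf p => simp [props] at h
  | node l r =>
    rw [leafSet_node]
    have hd := disjoint_of_nodup ht
    rintro rfl
    rcases Finset.mem_union.1 h with h | h
    · obtain ⟨p, hp⟩ := leafSet_nonempty r
      exact Finset.disjoint_left.1 hd
        ((subset_of_mem_channels h).1 (Finset.mem_union_right _ hp)) hp
    · obtain ⟨p, hp⟩ := leafSet_nonempty l
      exact Finset.disjoint_left.1 hd hp
        ((subset_of_mem_channels h).1 (Finset.mem_union_left _ hp))

theorem mem_channels_iff {t : PlaneTree k a} (ht : t.leaves.Nodup) {I : Finset (Particle k a)}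
    (hI : I ≠ t.leafSet) : I ∈ t.channels ↔ I ∈ t.props := by
  cases t with
  | leaf p => rfl
  | node l r => simp [channels, props, hI]

theorem props_subset_channels (t : PlaneTree k a) : t.props ⊆ t.channels := by
  cases t with
  | leaf p => rfl
  | node l r => exact Finset.subset_insert _ _

/-- A branch at the root is a leaf or a propagator. In either case it lies in a single branch of the
other tree. -/
theorem subset_of_props_eq {l r l' r' : PlaneTree k a}
    (hs : (node l r).leafSet = (node l' r').leafSet)
    (hp : (node l r).props = (node l' r').props) :
    l.leafSet ⊆ l'.leafSet ∨ l.leafSet ⊆ r'.leafSet := by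
  cases l with
  | leaf p =>
    have : p ∈ (node l' r').leafSet := by
      rw [← hs, leafSet_node, leafSet_leaf]; simp
    rw [leafSet_node, Finset.mem_union] at this
    rw [leafSet_leaf]
    simpa using this
  | node x y =>
    have : (node x y).leafSet ∈ (node l' r').props := by
      rw [← hp]; simp [props, channels]
    rcases Finset.mem_union.1 this with h | h
    · exact .inl (subset_of_mem_channels h).1
    · exact .inr (subset_of_mem_channels h).1

/-- Propagators inside the left branch are recognized by their particles: disjointness excludes the
right branch of the other tree. -/
theorem props_left_subset {l r l' r' : PlaneTree k a} (ht : (node l r).leaves.Nodup)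
    (ht' : (node l' r').leaves.Nodup)
    (hs : l.leafSet = l'.leafSet) (hp : (node l r).props = (node l' r').props) :
    l.props ⊆ l'.props := by
  intro I hI
  have h1 := ne_of_mem_props (List.nodup_append'.1 ht).1 hI
  have h2 := subset_of_mem_channels (props_subset_channels l hI)
  have h3 : I ∈ (node l' r').props := by
    rw [← hp]; exact Finset.mem_union_left _ (props_subset_channels l hI)
  rcases Finset.mem_union.1 h3 with h | h
  · exact (mem_channels_iff (List.nodup_append'.1 ht').1 (hs ▸ h1)).1 h
  · obtain ⟨p, hp⟩ := h2.2
    exact absurd ((subset_of_mem_channels h).1 hp)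
      (Finset.disjoint_left.1 (disjoint_of_nodup ht') (hs ▸ h2.1 hp))

theorem props_left_eq {l r l' r' : PlaneTree k a} (ht : (node l r).leaves.Nodup)
    (ht' : (node l' r').leaves.Nodup) (hs : l.leafSet = l'.leafSet)
    (hp : (node l r).props = (node l' r').props) : l.props = l'.props :=
  (props_left_subset ht ht' hs hp).antisymm (props_left_subset ht' ht hs.symm hp.symm)

theorem props_swap (l r : PlaneTree k a) : (node r l).props = (node l r).props :=
  Finset.union_comm _ _

theorem leafSet_swap (l r : PlaneTree k a) : (node r l).leafSet = (node l r).leafSet := by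
  rw [leafSet_node, leafSet_node, Finset.union_comm]

theorem eq_of_union_eq {A B A' B' : Finset (Particle k a)} (hd : Disjoint A' B')
    (h : A ∪ B = A' ∪ B') (h1 : A ⊆ A') (h2 : B ⊆ B') : A = A' ∧ B = B' := by
  constructor
  · refine h1.antisymm fun p hp => ?_
    have : p ∈ A ∪ B := h ▸ Finset.mem_union_left _ hp
    exact (Finset.mem_union.1 this).resolve_right
      fun hb => Finset.disjoint_left.1 hd hp (h2 hb)
  · refine h2.antisymm fun p hp => ?_
    have : p ∈ A ∪ B := h ▸ Finset.mem_union_right _ hp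
    exact (Finset.mem_union.1 this).resolve_left
      fun hb => Finset.disjoint_left.1 hd (h1 hb) hp

/-- The propagators determine a graph. -/
theorem exists_flips {t t' : PlaneTree k a} (ht : t.leaves.Nodup) (ht' : t'.leaves.Nodup)
    (hs : t.leafSet = t'.leafSet) (hp : t.props = t'.props) : ∃ m, Flips t t' m := by
  have hcard : ∀ (p : Particle k a) (l r : PlaneTree k a), (node l r).leaves.Nodup →
      (node l r).leafSet ≠ {p} := by
    intro p l r h e
    obtain ⟨x, hx⟩ := leafSet_nonempty l
    obtain ⟨y, hy⟩ := leafSet_nonempty r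
    rw [leafSet_node] at e
    have h1 : x ∈ ({p} : Finset _) := e ▸ Finset.mem_union_left _ hx
    have h2 : y ∈ ({p} : Finset _) := e ▸ Finset.mem_union_right _ hy
    rw [Finset.mem_singleton] at h1 h2
    subst h1 h2
    exact Finset.disjoint_left.1 (disjoint_of_nodup h) hx hy
  induction t generalizing t' with
  | leaf p =>
    cases t' with
    | leaf q =>
      rw [leafSet_leaf, leafSet_leaf, Finset.singleton_inj] at hs
      subst hs
      exact ⟨0, .leaf p⟩
    | node l r => exact absurd (hs.symm.trans (leafSet_leaf p)) (hcard p l r ht')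
  | node l r il ir =>
    cases t' with
    | leaf q => exact absurd (hs.trans (leafSet_leaf q)) (hcard q l r ht)
    | node l' r' =>
      have hnl := (List.nodup_append'.1 ht).1
      have hnr := (List.nodup_append'.1 ht).2.1
      have hnl' := (List.nodup_append'.1 ht').1
      have hnr' := (List.nodup_append'.1 ht').2.1
      have hd := disjoint_of_nodup ht
      have hd' := disjoint_of_nodup ht'
      have h1 := subset_of_props_eq hs hp
      have h2 := subset_of_props_eq ((leafSet_swap l r).trans hs) ((props_swap l r).trans hp)
      have hs' := hs
      rw [leafSet_node, leafSet_node] at hs'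
      have hkeep : l.leafSet ⊆ l'.leafSet → r.leafSet ⊆ r'.leafSet →
          ∃ m, Flips (node l r) (node l' r') m := by
        intro h3 h4
        obtain ⟨e1, e2⟩ := eq_of_union_eq hd' hs' h3 h4
        obtain ⟨i, hi⟩ := il hnl hnl' e1 (props_left_eq ht ht' e1 hp)
        obtain ⟨j, hj⟩ := ir hnr hnr' e2 (props_left_eq (List.nodup_append_comm.1 ht)
          (List.nodup_append_comm.1 ht') e2
          ((props_swap l r).trans (hp.trans (props_swap l' r').symm)))
        exact ⟨_, .keep hi hj⟩
      have hflip : l.leafSet ⊆ r'.leafSet → r.leafSet ⊆ l'.leafSet →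
          ∃ m, Flips (node l r) (node l' r') m := by
        intro h3 h4
        obtain ⟨e1, e2⟩ := eq_of_union_eq hd'.symm
          (hs'.trans (Finset.union_comm _ _)) h3 h4
        obtain ⟨i, hi⟩ := il hnl hnr' e1 (props_left_eq ht (List.nodup_append_comm.1 ht') e1
          (hp.trans (props_swap l' r').symm))
        obtain ⟨j, hj⟩ := ir hnr hnl' e2 (props_left_eq (List.nodup_append_comm.1 ht)
          ht' e2 ((props_swap l r).trans hp))
        exact ⟨_, .flip hi hj⟩
      rcases h1 with h1 | h1 <;> rcases h2 with h2 | h2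
      · obtain ⟨p, hp⟩ := leafSet_nonempty r'
        have h3 : p ∈ l.leafSet ∪ r.leafSet := hs' ▸ Finset.mem_union_right _ hp
        rcases Finset.mem_union.1 h3 with h3 | h3
        · exact absurd hp (Finset.disjoint_left.1 hd' (h1 h3))
        · exact absurd hp (Finset.disjoint_left.1 hd' (h2 h3))
      · exact hkeep h1 h2
      · exact hflip h1 h2
      · obtain ⟨p, hp⟩ := leafSet_nonempty l'
        have h3 : p ∈ l.leafSet ∪ r.leafSet := hs' ▸ Finset.mem_union_left _ hp
        rcases Finset.mem_union.1 h3 with h3 | h3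
        · exact absurd (h1 h3) (Finset.disjoint_left.1 hd' hp)
        · exact absurd (h2 h3) (Finset.disjoint_left.1 hd' hp)

theorem flips_props {t t' : PlaneTree k a} {m : ℕ} (h : Flips t t' m) : t'.props = t.props := by
  cases h with
  | leaf p => rfl
  | keep hl hr => rw [props, props, flips_channels hl, flips_channels hr]
  | flip hl hr => rw [props, props, flips_channels hl, flips_channels hr, Finset.union_comm]

variable {M M' : Type*} [AddCommGroup M] [Module ℝ M] [AddCommGroup M'] [Module ℝ M']

theorem map_branchForm (f : M →ₗ[ℝ] M') (e : Finset (Particle k a) → M) (t : PlaneTree k a) :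
    ExteriorAlgebra.map f (t.branchForm e) = t.branchForm (fun I => f (e I)) := by
  induction t with
  | leaf p => simp [branchForm]
  | node l r hl hr => simp [branchForm, hl, hr]

theorem map_graphForm (f : M →ₗ[ℝ] M') (e : Finset (Particle k a) → M) (t : PlaneTree k a) :
    ExteriorAlgebra.map f (t.graphForm e) = t.graphForm (fun I => f (e I)) := by
  cases t with
  | leaf p => simp [graphForm]
  | node l r => simp [graphForm, map_branchForm]

theorem branchForm_eq_zero {e : Finset (Particle k a) → M} {t : PlaneTree k a}
    {I : Finset (Particle k a)} (hI : I ∈ t.channels) (h : e I = 0) : t.branchForm e = 0 := by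
  induction t with
  | leaf p => simp [channels] at hI
  | node l r hl hr =>
    rw [branchForm]
    rcases Finset.mem_insert.1 hI with rfl | hI
    · simp [h]
    · rcases Finset.mem_union.1 hI with hI | hI
      · simp [hl hI]
      · simp [hr hI]

theorem graphForm_eq_zero {e : Finset (Particle k a) → M} {t : PlaneTree k a}
    {I : Finset (Particle k a)} (hI : I ∈ t.props) (h : e I = 0) : t.graphForm e = 0 := by
  cases t with
  | leaf p => simp [props] at hI
  | node l r =>
    rw [graphForm]
    rcases Finset.mem_union.1 hI with hI | hI
    · simp [branchForm_eq_zero hI h]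
    · simp [branchForm_eq_zero hI h]

/-- The tree as a branch has one factor more than the graph: the channel of all particles but the
root. -/
theorem branchForm_eq_graphForm (e : Finset (Particle k a) → M) (l r : PlaneTree k a) :
    (node l r).branchForm e =
      ExteriorAlgebra.ι ℝ (e (node l r).leafSet) * (node l r).graphForm e := by
  rw [branchForm, graphForm, mul_smul_comm]

end PlaneTree

/-! ### The differentials on `H_n^T[α]` -/

theorem charge_univ : charge (Finset.univ : Finset (Particle k a)) = 0 := by
  ext j; simp [charge]

theorem charge_compl (I : Finset (Particle k a)) : charge Iᶜ = - charge I := by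
  have h := charge_union (disjoint_compl_right (a := I))
  rw [Finset.union_compl, charge_univ] at h
  exact eq_neg_of_add_eq_zero_right h.symm

theorem isAllowed_of_charge_neg {X Y : Finset (Particle k a)} (h : charge Y = - charge X)
    (hX : IsAllowed X) : IsAllowed Y := by
  rw [isAllowed_iff] at *
  rw [h]
  rcases hX with h | ⟨j, h | h⟩
  · left; rw [h, neg_zero]
  · right; exact ⟨j, .inr (by rw [h])⟩
  · right; exact ⟨j, .inl (by rw [h, neg_neg])⟩

theorem isAllowed_compl {I : Finset (Particle k a)} : IsAllowed Iᶜ ↔ IsAllowed I := by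
  constructor
  · exact isAllowed_of_charge_neg (by rw [charge_compl, neg_neg])
  · exact isAllowed_of_charge_neg (charge_compl I)

theorem compl_eq_of {X Y : Finset (Particle k a)} (hd : Disjoint X Y)
    (h : X ∪ Y = Finset.univ) : Xᶜ = Y :=
  IsCompl.compl_eq ⟨hd, codisjoint_iff.2 h⟩

theorem isNeutral_of_not_isMatter {I : Finset (Particle k a)} (h : IsAllowed I)
    (hm : ¬ IsMatter I) : charge I = 0 := (isNeutral_iff I).1 (h.resolve_right hm)

namespace MeliaOrdering

variable {α : MeliaOrdering k a}
variable {V : Type*} [AddCommGroup V] [Module ℝ V] {s : Finset (Particle k a) → V}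

theorem card_particle (α : MeliaOrdering k a) : Fintype.card (Particle k a) = 2 * k + a := by
  have h : α.word.toFinset = Finset.univ := by ext p; simp [α.mem_word]
  rw [← Finset.card_univ, ← h, List.toFinset_card_of_nodup α.word_nodup, α.length_word]

theorem Iv_univ : α.Iv 0 (2 * k + a) = Finset.univ := by
  ext p
  have := α.pos_lt p
  simp [this]

theorem compl_Iv_zero {z : ℕ} (hz : z ≤ 2 * k + a) : (α.Iv 0 z)ᶜ = α.Iv z (2 * k + a) :=
  compl_eq_of (Iv_disjoint (.inl le_rfl)) (by rw [Iv_append (Nat.zero_le _) hz, Iv_univ])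

theorem two_le_card (α : MeliaOrdering k a) : 2 ≤ 2 * k + a := by
  have := α.pos_lt (.af α.first)
  rw [pos_af_first] at this
  exact this

theorem Iv_zero_one : α.Iv 0 1 = {α.root} := by
  have := Iv_pos (α := α) α.root
  rwa [α.pos_root] at this

theorem charge_Iv_one : charge (α.Iv 1 (2 * k + a)) = - Pi.single α.first 1 := by
  rw [← compl_Iv_zero (by have := α.two_le_card; omega), charge_compl, Iv_zero_one,
    MeliaOrdering.root, charge_f]

theorem bal_two : α.Bal 2 (2 * k + a) := by
  intro j
  have h1 : α.r j < 2 * k + a := α.pos_lt _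
  have h2 := α.l_lt_r j
  by_cases hj : j = α.first
  · subst hj; rw [l_first, r_first]; omega
  · have := α.two_le_l hj
    omega

/-- Makes the gap vectors differentials of allowed planar channels without the root. -/
theorem gapAt_eq {g : ℕ} (hg : 1 ≤ g) (hg' : g + 1 < 2 * k + a) :
    ∃ x z, 1 ≤ x ∧ x < z ∧ z ≤ 2 * k + a ∧ α.gapAt g = α.Iv x z ∧ IsAllowed (α.Iv x z) := by
  obtain ⟨v, hv⟩ := α.exists_pos hg'
  obtain ⟨u, hu⟩ := α.exists_pos (show g < 2 * k + a by omega)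
  have hgap : α.gapAt g = α.gap u v := by rw [← hu]; exact gapAt_pos (by omega)
  rw [hgap]
  by_cases hs : α.IsStart v
  · have h1 := α.pos_lt_endPos v
    refine ⟨g, α.endPos v, hg, by omega, α.endPos_le v, ?_, ?_⟩
    · rw [gap_start hs, ← Iv_append (show g ≤ g + 1 by omega) (show g + 1 ≤ α.endPos v by omega),
        ← hu, Iv_pos, hu, ← hv, Finset.insert_eq, head]
    · refine isAllowed_Iv_append (m := g + 1) (by omega) (by omega) ?_ ?_
      · rw [← hu]; exact isAllowed_Iv_single u
      · rw [← hv]; exact hs.bal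
  · have hv' : ∃ j, v = .af j := by
      by_contra hc
      push Not at hc
      refine hs ⟨?_, hc⟩
      rintro rfl
      rw [α.pos_root] at hv; omega
    obtain ⟨j, rfl⟩ := hv'
    have hj : α.r j = g + 1 := hv
    have hlj := α.l_lt_r j
    have hjf : j ≠ α.first := by
      rintro rfl
      rw [α.r_first] at hj; omega
    have hbj := α.bal_interior j
    have htail : ∃ x, 1 ≤ x ∧ x ≤ g ∧ α.tail u = α.Iv x (g + 1) ∧
        IsAllowed (α.Iv x (g + 1 + 1)) := by
      cases u with
      | f i =>
        have hi : α.l i = g := hu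
        have hij : i = j := by
          by_contra hij
          have h1 := hbj i
          have h2 : α.r i ≠ α.r j := fun h => hij (α.r_inj.1 h)
          have h3 : α.l i ≠ α.l j := fun h => hij (α.l_inj.1 h)
          have h4 := α.l_lt_r i
          omega
        subst hij
        refine ⟨g, hg, le_rfl, ?_, ?_⟩
        · rw [tail, ← hu, Iv_pos]
        · have := α.bal_pair i
          rw [hi, hj] at this
          exact isAllowed_Iv_of_bal this
      | af i =>
        have hi : α.r i = g := hu
        have h1 := α.l_lt_r i
        have hif : i ≠ α.first := by
          rintro rfl
          rw [α.r_first] at hi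
          have := α.two_le_l hjf
          omega
        have h2 := α.two_le_l hif
        refine ⟨α.l i, by omega, by omega, by rw [tail, hi], ?_⟩
        refine isAllowed_Iv_append' (m := g + 1) (by omega) (by omega) ?_ ?_
        · rw [← hv]; exact isAllowed_Iv_single _
        · have := α.bal_pair i
          rwa [hi] at this
      | adj i =>
        refine ⟨g, hg, le_rfl, ?_, ?_⟩
        · rw [tail, ← hu, Iv_pos]
        · refine isAllowed_Iv_append' (m := g + 1) (by omega) (by omega) ?_ ?_
          · rw [← hv]; exact isAllowed_Iv_single _
          · rw [← hu]
            exact (α.isStart_adj i).bal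
    obtain ⟨x, h1, h2, h3, h4⟩ := htail
    refine ⟨x, g + 1 + 1, h1, by omega, by omega, ?_, h4⟩
    rw [gap, h3, ← Iv_append (show x ≤ g + 1 by omega) (show g + 1 ≤ g + 1 + 1 by omega),
      Finset.union_comm, Finset.insert_eq]
    congr 1
    rw [← hv, Iv_pos]

theorem isPlanar_iff {I : Finset (Particle k a)} :
    α.IsPlanar I ↔ ∃ x z, x ≤ z ∧ z ≤ 2 * k + a ∧ I = α.Iv x z := by
  constructor
  · rintro ⟨u, ⟨x, y, h⟩, rfl⟩
    have hlen := congrArg List.length h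
    simp only [List.length_append, α.length_word] at hlen
    refine ⟨x.length, x.length + u.length, by omega, by omega, ?_⟩
    ext p
    rw [mem_Iv, List.mem_toFinset]
    exact idxOf_mem_infix α.word_nodup (by rw [← h, List.append_assoc]) (α.mem_word p)
  · rintro ⟨x, z, hxz, hz, rfl⟩
    refine ⟨(α.word.drop x).take (z - x), ?_, ?_⟩
    · exact (List.take_prefix _ _).isInfix.trans (List.drop_suffix _ _).isInfix
    · ext p
      have h : α.word = α.word.take x ++ ((α.word.drop x).take (z - x) ++
          (α.word.drop x).drop (z - x)) := by
        rw [List.take_append_drop, List.take_append_drop]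
      have := idxOf_mem_infix α.word_nodup h (α.mem_word p)
      rw [mem_Iv, List.mem_toFinset, this]
      have hl := α.length_word
      simp only [List.length_take, List.length_drop, hl, pos]
      omega

/-- Neutral interval, right end and neutral interval are put together as in `Soft.link_closed`. -/
theorem Soft.closed_mem_E (hs : α.Soft s) {x z : ℕ} (hx : 2 ≤ x) (hxz : x < z)
    (hz : z ≤ 2 * k + a) (hc : α.Closed x z) : s (α.Iv x z) ∈ α.E s x z := by
  rcases hc with h | ⟨j, hj, h1, h2, h3, h4⟩
  · exact hs.bal_mem_E h hx hxz hz
  have hr : s (α.Iv (α.r j) (α.r j + 1)) ∈ α.E s (α.r j) (α.r j + 1) := hs.single_mem_E (.af j)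
  have hl : s (α.Iv x (α.r j + 1)) ∈ α.E s x (α.r j + 1) := by
    rcases h1.eq_or_lt with h1 | h1
    · rwa [h1]
    · exact mem_E_append h1 (Nat.lt_succ_self _)
        (hs.link_right hj h3 hx h1 (by omega) (by omega)).symm (hs.bal_mem_E h3 hx h1 (by omega)) hr
  rcases (show α.r j + 1 ≤ z from h2).eq_or_lt with h5 | h5
  · rwa [← h5]
  · exact mem_E_append (by omega) h5 (hs.link_closed h4 (by omega) h5 hz
      (.inr ⟨j, hj, h1, Nat.lt_succ_self _, h3, Bal.self _⟩) hx (by omega) (by omega)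
      (.inr le_rfl)) hl (hs.bal_mem_E h4 (by omega) h5 hz)

theorem Soft.open_mem_E (hs : α.Soft s) {w : Particle k a} (hw : α.IsOpen w) {z : ℕ}
    (hz : z ≤ 2 * k + a) (hwz : α.pos w < z) (hb : α.Bal (α.pos w + 1) z) :
    s (α.Iv (α.pos w) z) ∈ α.E s (α.pos w) z := by
  have h1 := hs.single_mem_E w
  have h3 := hw.one_le
  rcases (show α.pos w + 1 ≤ z from hwz).eq_or_lt with h2 | h2
  · rwa [← h2]
  · exact mem_E_append (Nat.lt_succ_self _) h2 (hs.link_open hw hb (by omega) h2 hz (by omega)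
      (.inr (Bal.self _))) h1 (hs.bal_mem_E hb (by omega) h2 hz)

/-- The vector of an allowed planar channel lies in the span of the gaps. -/
theorem Soft.planar_mem_E (hs : α.Soft s) {x z : ℕ} (hx : 1 ≤ x) (hxz : x < z)
    (hz : z ≤ 2 * k + a) (ha : IsAllowed (α.Iv x z)) :
    s (α.Iv x z) ∈ α.E s 1 (2 * k + a) := by
  have hmono : ∀ {y z' : ℕ}, 1 ≤ y → z' ≤ 2 * k + a → α.E s y z' ≤ α.E s 1 (2 * k + a) :=
    fun h1 h2 => E_mono h1 h2
  rw [isAllowed_iff] at ha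
  rcases ha with h | ⟨j, h | h⟩
  · have hb := (bal_iff_charge x z).2 h
    have hx2 : 2 ≤ x := by
      by_contra hc
      rw [show x = 1 by omega] at hb hxz
      exact not_bal_one hxz hb
    exact hmono hx hz (hs.closed_mem_E hx2 hxz hz (.inl hb))
  · obtain ⟨h1, h2, h3, h4, h5⟩ := of_charge_Iv_pos h
    have hrj : α.r j < 2 * k + a := α.pos_lt _
    have hj : j ≠ α.first := by rintro rfl; rw [l_first] at h1; omega
    have hl := hs.open_mem_E (isOpen_f hj) hz h2 h5
    change s (α.Iv (α.l j) z) ∈ α.E s (α.l j) z at hl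
    rcases h1.eq_or_lt with h1 | h1
    · rw [h1]; exact hmono (by omega) hz hl
    · have hx2 : 2 ≤ x := by
        by_contra hc
        rw [show x = 1 by omega] at h4 h1
        exact not_bal_one h1 h4
      -- The neutral piece in front of `l j` is separated from the open piece behind it; the
      -- polarization of the two is the gap between them, up to gaps that may reach to `r j`.
      have hch : charge (α.Iv (α.l j) z) = Pi.single j 1 := by
        rw [← Iv_append h1.le h2.le, charge_union (Iv_disjoint (.inl le_rfl)), h4.charge,
          zero_add] at h
        exact h
      have hp := hs.polar_pos_mem hch (by omega) h4 hx2 h1 (by omega) (.inl le_rfl)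
      rw [if_pos rfl, polar, Finset.union_comm, Iv_append h1.le h2.le] at hp
      have hp := sup_le (hmono hx (by omega)) (hmono (by omega) (by omega)) hp
      have hy : α.gapVec s (α.l j - 1) ∈ α.E s 1 (2 * k + a) := gapVec_mem_E (by omega) (by omega)
      have hA := hmono hx (by omega) (hs.closed_mem_E hx2 h1 (by omega) (.inl h4))
      have := add_mem (add_mem (add_mem hp hy) hA) (hmono (by omega) hz hl)
      convert this using 1
      abel
  · obtain ⟨h1, h2, h3, h4, h5⟩ := of_charge_Iv_neg h
    by_cases hj : j = α.first
    · subst hj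
      rw [l_first] at h1
      rw [r_first] at h2 h5
      have hx1 : x = 1 := by omega
      subst hx1
      have e := pos_af_first (α := α)
      have := hs.open_mem_E isOpen_af_first hz (by rw [e]; exact hxz) (by rw [e]; exact h5)
      rw [e] at this
      exact hmono le_rfl hz this
    · have := α.two_le_l hj
      exact hmono hx hz (hs.closed_mem_E (by omega) hxz hz (.inr ⟨j, hj, h2, h3, h4, h5⟩))

/-- The vector of all particles but the root. -/
theorem Soft.total (hs : α.Soft s) (hn : 2 < 2 * k + a) :
    s (α.Iv 1 (2 * k + a)) - α.gapVec s 1 ∈ α.E s 2 (2 * k + a) := by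
  have e := pos_af_first (α := α)
  have hb := bal_two (α := α)
  have h := hs.link_open isOpen_af_first hb le_rfl hn le_rfl (by omega)
    (.inr (by rw [e]; exact Bal.self _))
  have h1 := hs.bal_mem_E hb le_rfl hn le_rfl
  have h2 : s (α.Iv 1 2) = 0 := by
    have := hs.singleton (.af α.first)
    rwa [← Iv_pos (α := α), e] at this
  rw [e] at h
  unfold Link at h
  rw [touch_of_eq (by omega) hn, E_self_succ, bot_sup_eq, polar,
    Iv_append (by omega) hn.le, h2] at h
  have := add_mem h h1
  convert this using 1
  rw [show 1 + 1 - 1 = 1 from rfl]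
  abel

open Classical in
/-- The extension of a function of the allowed channels without root to all channels. -/
def ext (α : MeliaOrdering k a) (s : Finset (Particle k a) → ℝ) : Mandelstam k a := fun I =>
  if IsAllowed I then if α.root ∈ I then s Iᶜ else s I else 0

variable {s : Finset (Particle k a) → ℝ}

theorem ext_compl (I : Finset (Particle k a)) : α.ext s Iᶜ = α.ext s I := by
  unfold ext
  by_cases h : IsAllowed I
  · rw [if_pos h, if_pos (isAllowed_compl.2 h)]
    by_cases h1 : α.root ∈ I
    · rw [if_pos h1, if_neg (by simpa using h1)]
    · rw [if_neg h1, if_pos (by simpa using h1), compl_compl]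
  · rw [if_neg h, if_neg (fun h' => h (isAllowed_compl.1 h'))]

theorem ext_of_notMem {I : Finset (Particle k a)} (h : IsAllowed I) (hr : α.root ∉ I) :
    α.ext s I = s I := by
  unfold ext; rw [if_pos h, if_neg hr]

theorem Soft.ext_three (hs : α.Soft s) {A B C : Finset (Particle k a)} (rA : α.root ∉ A)
    (rB : α.root ∉ B) (rC : α.root ∉ C) (dAB : Disjoint A B) (dAC : Disjoint A C)
    (dBC : Disjoint B C) (hA : IsAllowed A) (hB : IsAllowed B) (hC : charge C = 0)
    (hABC : IsAllowed (A ∪ B ∪ C)) :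
    α.ext s (A ∪ B) + α.ext s (B ∪ C) + α.ext s (A ∪ C) =
      α.ext s A + α.ext s B + α.ext s C + α.ext s (A ∪ B ∪ C) := by
  have hAB : IsAllowed (A ∪ B) := by
    refine isAllowed_of_charge_eq ?_ hABC
    rw [charge_union (Finset.disjoint_union_left.2 ⟨dAC, dBC⟩), hC, add_zero]
  rw [ext_of_notMem hA rA, ext_of_notMem hB rB, ext_of_notMem (isAllowed_of_zero hC) rC,
    ext_of_notMem hAB (by simp [rA, rB]), ext_of_notMem hABC (by simp [rA, rB, rC]),
    ext_of_notMem (isAllowed_union_left dBC hB hC) (by simp [rB, rC]),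
    ext_of_notMem (isAllowed_union_left dAC hA hC) (by simp [rA, rC])]
  exact hs.rel A B C rA rB rC dAB dAC dBC hA hB hAB hC

/-- The part with the root is replaced by its complement, which turns the relation into one without
the root. -/
theorem Soft.ext_root (hs : α.Soft s) {A B C D : Finset (Particle k a)}
    (h : IsFourPartition A B C D) (hr : α.root ∈ D) :
    α.ext s (A ∪ B) + α.ext s (B ∪ C) + α.ext s (A ∪ C) =
      α.ext s A + α.ext s B + α.ext s C + α.ext s D := by
  obtain ⟨-, ⟨dAB, dAC, dAD, dBC, dBD, dCD⟩, hu, ⟨hA, hB, hC, hD⟩, hm⟩ := h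
  have rA : α.root ∉ A := fun h => Finset.disjoint_left.1 dAD h hr
  have rB : α.root ∉ B := fun h => Finset.disjoint_left.1 dBD h hr
  have rC : α.root ∉ C := fun h => Finset.disjoint_left.1 dCD h hr
  have dD : Disjoint (A ∪ B ∪ C) D := by
    simp only [Finset.disjoint_union_left]; exact ⟨⟨dAD, dBD⟩, dCD⟩
  have hcD := compl_eq_of dD hu
  have hABC : IsAllowed (A ∪ B ∪ C) := by rw [← isAllowed_compl, hcD]; exact hD
  have hchD : charge D = - (charge A + charge B + charge C) := by
    rw [← hcD, charge_compl, charge_union (Finset.disjoint_union_left.2 ⟨dAC, dBC⟩),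
      charge_union dAB]
  rw [← hcD, ext_compl]
  -- If `A`, `B` and `C` were all charged, `D` would have to be neutral, as not all four parts are
  -- matter states. But three single flavours never add up to zero.
  have hn : charge A = 0 ∨ charge B = 0 ∨ charge C = 0 := by
    by_contra hc
    push Not at hc
    have h0 : ∀ {X : Finset (Particle k a)}, IsAllowed X → charge X ≠ 0 →
        IsMatter X := fun h1 h2 => by
      by_contra h3; exact h2 (isNeutral_of_not_isMatter h1 h3)
    have hD0 : charge D = 0 := by
      by_contra hD0
      exact hm ⟨h0 hA hc.1, h0 hB hc.2.1, h0 hC hc.2.2, h0 hD hD0⟩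
    rw [hD0] at hchD
    have hs0 : charge A + charge B + charge C = 0 := by rw [← neg_eq_zero]; exact hchD.symm
    have hAB : IsAllowed (A ∪ B) := isAllowed_of_charge_neg (X := C)
      (by rw [charge_union dAB]; exact eq_neg_of_add_eq_zero_left hs0) hC
    rcases charge_cases dAB hA hB hAB with h | h | ⟨j, ⟨h1, h2⟩ | ⟨h1, h2⟩⟩
    · exact hc.1 h
    · exact hc.2.1 h
    · rw [h1, h2, add_neg_cancel, zero_add] at hs0; exact hc.2.2 hs0
    · rw [h1, h2, neg_add_cancel, zero_add] at hs0; exact hc.2.2 hs0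
  rcases hn with h | h | h
  · have e : A ∪ B ∪ C = B ∪ C ∪ A := by rw [Finset.union_assoc, Finset.union_comm]
    have := hs.ext_three rB rC rA dBC dAB.symm dAC.symm hB hC h (by rw [← e]; exact hABC)
    rw [e, Finset.union_comm A B, Finset.union_comm A C]
    linarith
  · have e : A ∪ B ∪ C = A ∪ C ∪ B := Finset.union_right_comm A B C
    have := hs.ext_three rA rC rB dAC dAB dBC.symm hA hC h (by rw [← e]; exact hABC)
    rw [e, Finset.union_comm B C]
    linarith
  · exact hs.ext_three rA rB rC dAB dAC dBC hA hB h hABC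

/-- The relation is symmetric in the four parts, since complementary pairs of parts have equal
values; so the part with the root may be taken as the last one. -/
theorem Soft.ext_four (hs : α.Soft s) {A B C D : Finset (Particle k a)}
    (h : IsFourPartition A B C D) :
    α.ext s (A ∪ B) + α.ext s (B ∪ C) + α.ext s (A ∪ C) =
      α.ext s A + α.ext s B + α.ext s C + α.ext s D := by
  have h' := h
  obtain ⟨⟨nA, nB, nC, nD⟩, ⟨dAB, dAC, dAD, dBC, dBD, dCD⟩, hu, ⟨hA, hB, hC, hD⟩, hm⟩ := h'
  have e1 : (A ∪ B)ᶜ = C ∪ D := compl_eq_of (by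
    simp only [Finset.disjoint_union_left, Finset.disjoint_union_right]
    exact ⟨⟨dAC, dBC⟩, dAD, dBD⟩) (by rw [← hu, Finset.union_assoc (A ∪ B)])
  have e2 : (B ∪ C)ᶜ = A ∪ D := compl_eq_of (by
    simp only [Finset.disjoint_union_left, Finset.disjoint_union_right]
    exact ⟨⟨dAB.symm, dAC.symm⟩, dBD, dCD⟩) (by
      rw [← hu]; ext p; simp only [Finset.mem_union]; tauto)
  have e3 : (A ∪ C)ᶜ = B ∪ D := compl_eq_of (by
    simp only [Finset.disjoint_union_left, Finset.disjoint_union_right]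
    exact ⟨⟨dAB, dBC.symm⟩, dAD, dCD⟩) (by
      rw [← hu]; ext p; simp only [Finset.mem_union]; tauto)
  have f1 := ext_compl (s := s) (α := α) (A ∪ B)
  have f2 := ext_compl (s := s) (α := α) (B ∪ C)
  have f3 := ext_compl (s := s) (α := α) (A ∪ C)
  rw [e1] at f1
  rw [e2] at f2
  rw [e3] at f3
  have hmem : α.root ∈ A ∪ B ∪ C ∪ D := by rw [hu]; exact Finset.mem_univ _
  simp only [Finset.mem_union] at hmem
  rcases hmem with ((hr | hr) | hr) | hr
  · have hp : IsFourPartition B C D A := ⟨⟨nB, nC, nD, nA⟩, ⟨dBC, dBD, dAB.symm, dCD, dAC.symm,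
      dAD.symm⟩, by rw [← hu]; ext p; simp only [Finset.mem_union]; tauto, ⟨hB, hC, hD, hA⟩,
      fun h => hm ⟨h.2.2.2, h.1, h.2.1, h.2.2.1⟩⟩
    have := hs.ext_root hp hr
    linarith
  · have hp : IsFourPartition A C D B := ⟨⟨nA, nC, nD, nB⟩, ⟨dAC, dAD, dAB, dCD, dBC.symm,
      dBD.symm⟩, by rw [← hu]; ext p; simp only [Finset.mem_union]; tauto, ⟨hA, hC, hD, hB⟩,
      fun h => hm ⟨h.1, h.2.2.2, h.2.1, h.2.2.1⟩⟩
    have := hs.ext_root hp hr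
    linarith
  · have hp : IsFourPartition A B D C := ⟨⟨nA, nB, nD, nC⟩, ⟨dAB, dAD, dAC, dBD, dBC,
      dCD.symm⟩, by rw [← hu]; ext p; simp only [Finset.mem_union]; tauto, ⟨hA, hB, hD, hC⟩,
      fun h => hm ⟨h.1, h.2.1, h.2.2.2, h.2.2.1⟩⟩
    have := hs.ext_root hp hr
    linarith
  · exact hs.ext_root h hr

theorem root_notMem_of_cons {I : Finset (Particle k a)} (h : α.Cons I) : α.root ∉ I := by
  have hh : ∀ {u}, α.IsStart u → α.root ∉ α.head u := fun hu => by
    have := hu.two_le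
    exact root_notMem_Iv (by omega)
  cases h with
  | apart hu hv _ _ => rw [Finset.mem_union, not_or]; exact ⟨hh hu, hh hv⟩
  | right hu _ _ _ _ =>
    rw [Finset.mem_insert, not_or]; exact ⟨by simp [MeliaOrdering.root], hh hu⟩
  | left hw hu _ _ => rw [Finset.mem_insert, not_or]; exact ⟨hw.1.symm, hh hu⟩
  | pair hj _ => simp [MeliaOrdering.root, hj.symm]

/-- With a point of the space at hand, its direction consists of the solutions of the homogeneous
equations, and the constants b and c disappear. -/
theorem mem_direction_iff {b c : Mandelstam k a} (hne : (α.HT b c : Set (Mandelstam k a)).Nonempty)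
    {d : Mandelstam k a} : d ∈ (α.HT b c).direction ↔ (∀ I, d Iᶜ = d I) ∧
      (∀ I, I.card ≤ 1 ∨ 2 * k + a ≤ I.card + 1 → d I = 0) ∧ (∀ I, ¬ IsAllowed I → d I = 0) ∧
      (∀ A B C D, IsFourPartition A B C D →
        d (A ∪ B) + d (B ∪ C) + d (A ∪ C) = d A + d B + d C + d D) ∧
      ∀ I, α.Cons I → d I = 0 := by
  obtain ⟨x, hx⟩ := hne
  have hx' : x ∈ α.HT b c := hx
  rw [← AffineSubspace.vadd_mem_iff_mem_direction d hx']
  obtain ⟨⟨x1, x2, x3, x4⟩, x5⟩ := hx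
  constructor
  · rintro ⟨⟨y1, y2, y3, y4⟩, y5⟩
    simp only [vadd_eq_add, Pi.add_apply] at y1 y2 y3 y4 y5
    refine ⟨fun I => ?_, fun I h => ?_, fun I h => ?_, fun A B C D h => ?_, fun I h => ?_⟩
    · linarith [x1 I, y1 I]
    · linarith [x2 I h, y2 I h]
    · linarith [x3 I h, y3 I h]
    · linarith [x4 A B C D h, y4 A B C D h]
    · have hI := (mem_constraints_iff I).2 h
      have h1 := x5 I hI
      have h2 := y5 I hI
      simp only [Pi.add_apply] at h2
      linarith
  · rintro ⟨y1, y2, y3, y4, y5⟩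
    refine ⟨⟨fun I => ?_, fun I h => ?_, fun I h => ?_, fun A B C D h => ?_⟩, fun I h => ?_⟩ <;>
      simp only [vadd_eq_add, Pi.add_apply]
    · rw [x1, y1]
    · rw [x2 I h, y2 I h, add_zero]
    · rw [x3 I h, y3 I h, zero_add]
    · linarith [x4 A B C D h, y4 A B C D h]
    · rw [← x5 I h, y5 I ((mem_constraints_iff I).1 h), zero_add]

/-- Every model without total yields a tangent vector of H^T; this is the source of lower bounds for
the rank of the differentials. -/
theorem Soft.ext_mem (hs : α.Soft s) (ht : s (α.Iv 1 (2 * k + a)) = 0) {b c : Mandelstam k a}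
    (hne : (α.HT b c : Set (Mandelstam k a)).Nonempty) : α.ext s ∈ (α.HT b c).direction := by
  have hsmall : ∀ I : Finset (Particle k a), I.card ≤ 1 → α.ext s I = 0 := by
    intro I hI
    unfold ext
    split_ifs with h1 h2
    -- The set of the root alone is sent to the total, and this is where `ht` enters.
    · have : I = {α.root} := by
        refine (Finset.eq_of_subset_of_card_le (Finset.singleton_subset_iff.2 h2) ?_).symm
        simpa using hI
      rw [this, ← Iv_zero_one, compl_Iv_zero (by have := α.two_le_card; omega)]
      exact ht
    · exact hs.small I hI
    · rfl
  rw [mem_direction_iff hne]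
  refine ⟨ext_compl, fun I h => ?_, fun I h => if_neg h, fun A B C D h => hs.ext_four h,
    fun I h => ?_⟩
  · rcases h with h | h
    · exact hsmall I h
    · rw [← ext_compl]
      apply hsmall
      rw [Finset.card_compl, α.card_particle]
      omega
  · unfold ext
    rw [if_neg (root_notMem_of_cons h), hs.cons I h, ite_self]

/-- The fourth part is the complement of X ∪ Y ∪ Z, which is non-empty because it contains the root,
and the neutral `Z` keeps the parts from being all matter states. For an empty part the relation is
trivial. -/
theorem soft_of_mem_direction {b c : Mandelstam k a}
    (hne : (α.HT b c : Set (Mandelstam k a)).Nonempty) {d : Mandelstam k a}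
    (hd : d ∈ (α.HT b c).direction) : α.Soft (fun I => d I) := by
  obtain ⟨y1, y2, y3, y4, y5⟩ := (mem_direction_iff hne).1 hd
  have h0 : d ∅ = 0 := y2 ∅ (.inl (by simp))
  refine ⟨fun X Y Z rX rY rZ dXY dXZ dYZ hX hY hXY hZ => ?_, fun I h => y2 I (.inl h), y5⟩
  rcases X.eq_empty_or_nonempty with rfl | nX
  · simp only [Finset.empty_union, h0]; ring
  rcases Y.eq_empty_or_nonempty with rfl | nY
  · simp only [Finset.empty_union, Finset.union_empty, h0]; ring
  rcases Z.eq_empty_or_nonempty with rfl | nZ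
  · simp only [Finset.union_empty, h0]; ring
  have hXYZ : IsAllowed (X ∪ Y ∪ Z) :=
    isAllowed_union_left (Finset.disjoint_union_left.2 ⟨dXZ, dYZ⟩) hXY hZ
  have hd : Disjoint (X ∪ Y ∪ Z) (X ∪ Y ∪ Z)ᶜ := disjoint_compl_right
  have hd' := hd
  simp only [Finset.disjoint_union_left] at hd'
  have hr : α.root ∈ (X ∪ Y ∪ Z)ᶜ := by simp [rX, rY, rZ]
  have hp : IsFourPartition X Y Z (X ∪ Y ∪ Z)ᶜ :=
    ⟨⟨nX, nY, nZ, ⟨_, hr⟩⟩, ⟨dXY, dXZ, hd'.1.1, dYZ, hd'.1.2, hd'.2⟩, Finset.union_compl _,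
      ⟨hX, hY, isAllowed_of_zero hZ, isAllowed_compl.2 hXYZ⟩, fun h => ?_⟩
  · have := y4 _ _ _ _ hp
    rw [y1] at this
    exact this
  · obtain ⟨j, hj, -⟩ := h.2.2.1
    rw [hZ] at hj
    simp at hj

theorem soft_ds {b c : Mandelstam k a} (hne : (α.HT b c : Set (Mandelstam k a)).Nonempty) :
    α.Soft (ds (α.HT b c)) := by
  refine ⟨fun X Y Z rX rY rZ dXY dXZ dYZ hX hY hXY hZ => ?_, fun I h => ?_, fun I h => ?_⟩ <;>
    ext d
  · exact (soft_of_mem_direction hne d.2).rel X Y Z rX rY rZ dXY dXZ dYZ hX hY hXY hZ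
  · exact (soft_of_mem_direction hne d.2).small I h
  · exact (soft_of_mem_direction hne d.2).cons I h

end MeliaOrdering

/-! ### Forms of graphs -/

/-- Contracting v ∧ x = 0 with a functional that is 1 on v shows that x is a multiple of v; hence x
dies under any map that kills v. -/
theorem map_eq_zero_of_ι_mul {V V' : Type*} [AddCommGroup V] [Module ℝ V] [AddCommGroup V']
    [Module ℝ V'] {f : V →ₗ[ℝ] V'} {d : Module.Dual ℝ V} {v : V} (hd : d v = 1) (hf : f v = 0)
    {x : ExteriorAlgebra ℝ V} (h : ExteriorAlgebra.ι ℝ v * x = 0) :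
    ExteriorAlgebra.map f x = 0 := by
  have h1 : CliffordAlgebra.contractLeft d (ExteriorAlgebra.ι ℝ v * x) =
      d v • x - ExteriorAlgebra.ι ℝ v * CliffordAlgebra.contractLeft d x :=
    CliffordAlgebra.contractLeft_ι_mul d v x
  rw [h, map_zero, hd, one_smul] at h1
  rw [sub_eq_zero.1 h1.symm, map_mul, ExteriorAlgebra.map_apply_ι, hf, map_zero, zero_mul]

namespace MeliaOrdering

open PlaneTree

variable {α : MeliaOrdering k a}

section

variable {V V' : Type*} [AddCommGroup V] [Module ℝ V] [AddCommGroup V'] [Module ℝ V']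
  {s : Finset (Particle k a) → V}

theorem map_Z (f : V →ₗ[ℝ] V') (x z : ℕ) :
    ExteriorAlgebra.map f (α.Z s x z) = α.Z (fun I => f (s I)) x z := by
  unfold Z
  rw [map_list_prod, List.map_map, List.map_map, List.map_map]
  congr 2
  funext g
  simp [gapVec]

/-- A model in which the vector of all particles but the root does not vanish. -/
theorem exists_soft_total (α : MeliaOrdering k a) (hn : 2 < 2 * k + a) :
    ∃ s : Finset (Particle k a) → ℝ, α.Soft s ∧ s (α.Iv 1 (2 * k + a)) = 1 ∧
      ∀ g, 2 ≤ g → g + 1 < 2 * k + a → α.gapVec s g = 0 := by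
  obtain ⟨s, hs, hg⟩ := α.exists_soft fun g => if g = 1 then 1 else 0
  have hg2 : ∀ g, 2 ≤ g → g + 1 < 2 * k + a → α.gapVec s g = 0 := fun g h1 h2 => by
    rw [hg g (by omega) h2, if_neg (by omega)]
  refine ⟨s, hs, ?_, hg2⟩
  have h := hs.total hn
  have hE : α.E s 2 (2 * k + a) = ⊥ := by
    rw [E, Submodule.span_eq_bot]
    rintro _ ⟨g, ⟨h1, h2⟩, rfl⟩
    exact hg2 g h1 h2
  rw [hE, Submodule.mem_bot, hg 1 le_rfl (by omega), if_pos rfl, sub_eq_zero] at h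
  exact h

theorem Soft.prod {s : Finset (Particle k a) → V} {s' : Finset (Particle k a) → V'}
    (hs : α.Soft s) (hs' : α.Soft s') : α.Soft (fun I => (s I, s' I)) where
  rel X Y Z rX rY rZ dXY dXZ dYZ hX hY hXY hZ :=
    Prod.ext (hs.rel X Y Z rX rY rZ dXY dXZ dYZ hX hY hXY hZ)
      (hs'.rel X Y Z rX rY rZ dXY dXZ dYZ hX hY hXY hZ)
  small I hI := Prod.ext (hs.small I hI) (hs'.small I hI)
  cons I hI := Prod.ext (hs.cons I hI) (hs'.cons I hI)

/-- An identity for branches that holds in every model implies one for graphs when the vector of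
all particles but the root vanishes. -/
theorem Soft.graphForm_eq (hs : α.Soft s) (h0 : s (α.Iv 1 (2 * k + a)) = 0)
    (hn : 2 < 2 * k + a) (t : PlaneTree k a) (m : ℝ)
    (h : ∀ s' : Finset (Particle k a) → V × ℝ, α.Soft s' →
      ExteriorAlgebra.ι ℝ (s' (α.Iv 1 (2 * k + a))) * t.graphForm s' =
        m • α.Z s' 1 (2 * k + a - 1)) :
    t.graphForm s = m • α.Z s 2 (2 * k + a - 1) := by
  obtain ⟨u, hu, hu1, -⟩ := α.exists_soft_total hn
  set s' : Finset (Particle k a) → V × ℝ := fun I => (s I, u I)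
  have hs' : α.Soft s' := hs.prod hu
  have h1 := h s' hs'
  have h2 : ExteriorAlgebra.ι ℝ (s' (α.Iv 1 (2 * k + a))) * α.Z s' 2 (2 * k + a - 1) =
      α.Z s' 1 (2 * k + a - 1) := by
    have h3 := E_le_kills 2 _ (hs'.total hn)
    rw [mem_kills, map_sub, sub_mul, sub_eq_zero] at h3
    rw [h3]
    exact ι_mul_Z (x := 2) (by omega) (by omega)
  -- Modulo the later gaps the total is the first gap, so it completes the product of the later gaps
  -- to the full one. The total is non-zero in the second component, which permits its removal, and
  -- the first projection kills it.
  have h3 : ExteriorAlgebra.ι ℝ (s' (α.Iv 1 (2 * k + a))) *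
      (t.graphForm s' - m • α.Z s' 2 (2 * k + a - 1)) = 0 := by
    rw [mul_sub, h1, mul_smul_comm, h2, sub_self]
  have h4 := map_eq_zero_of_ι_mul (f := LinearMap.fst ℝ V ℝ) (d := LinearMap.snd ℝ V ℝ) hu1 h0 h3
  rw [map_sub, map_smul, map_graphForm, map_Z, sub_eq_zero] at h4
  exact h4

theorem Drawn.graphForm (hs : α.Soft s) (h0 : s (α.Iv 1 (2 * k + a)) = 0) {t : PlaneTree k a}
    (hd : α.Drawn t 1 (2 * k + a)) (ha : ∀ I ∈ t.channels, IsAllowed I) :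
    t.graphForm s = t.sign • α.Z s 2 (2 * k + a - 1) := by
  cases t with
  | leaf p =>
    obtain ⟨h1, h2⟩ := hd.of_leaf
    -- A single leaf means n = 2, where there are no gaps and both sides are 1.
    rw [sign_leaf, one_smul, show 2 * k + a - 1 = 1 by omega]
    simp [PlaneTree.graphForm, Z]
  | node l r =>
    obtain ⟨y, h1, h2⟩ := hd.of_node
    have h3 := h1.1
    have h4 := h2.1
    refine hs.graphForm_eq h0 (by omega) _ _ fun s' hs' => ?_
    rw [← hd.leafSet, ← branchForm_eq_graphForm]
    exact ((drawn_value hs' hd le_rfl ha).neg rfl charge_Iv_one).2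

/-- If the branch form did not vanish, the core of the comb at r₁ would have to be everything: the
particle after a shorter core would be a leaf on the top level, which `Vanish.neg` forbids. But a
complete core makes the branch planar. -/
theorem Branch.graphForm (hs : α.Soft s) (h0 : s (α.Iv 1 (2 * k + a)) = 0) {t : PlaneTree k a}
    (hb : α.Branch t) (ht : t.leafSet = α.Iv 1 (2 * k + a)) (hp : ¬ α.Planar t 1 (2 * k + a)) :
    t.graphForm s = 0 := by
  have hn := α.two_le_card
  have hlt : ∀ c, c < 2 * k + a → 1 < c → ∃ q ∈ t.leafSet, α.pos q = c := by
    intro c hc hc1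
    obtain ⟨q, hq⟩ := α.exists_pos hc
    exact ⟨q, by rw [ht, mem_Iv]; omega, hq⟩
  cases t with
  | leaf p =>
    have hmem : ∀ q, 1 ≤ α.pos q → q = p := by
      intro q hq
      have : q ∈ α.Iv 1 (2 * k + a) := by rw [mem_Iv]; exact ⟨hq, α.pos_lt q⟩
      rwa [← ht, leafSet_leaf, Finset.mem_singleton] at this
    have h1 : p = .af α.first := (hmem _ (by rw [pos_af_first])).symm
    have h2 : 2 * k + a = 2 := by
      by_contra h
      obtain ⟨q, -, hq⟩ := hlt 2 (by omega) (by omega)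
      have := hmem q (by omega)
      rw [this, h1, pos_af_first] at hq
      omega
    refine absurd ?_ hp
    have := (drawn_leaf (α := α) p).planar
    rw [h1, pos_af_first] at this
    rw [h1, h2]
    exact this
  | node l r =>
    have hn2 : 2 < 2 * k + a := by
      obtain ⟨x, hx⟩ := leafSet_nonempty l
      obtain ⟨y, hy⟩ := leafSet_nonempty r
      have hne : x ≠ y := by
        rintro rfl
        exact Finset.disjoint_left.1 (disjoint_of_nodup hb.nodup) hx hy
      have hx' : x ∈ α.Iv 1 (2 * k + a) := by
        rw [← ht, leafSet_node]; exact Finset.mem_union_left _ hx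
      have hy' : y ∈ α.Iv 1 (2 * k + a) := by
        rw [← ht, leafSet_node]; exact Finset.mem_union_right _ hy
      rw [mem_Iv] at hx' hy'
      have := mt α.pos_inj.1 hne
      omega
    rw [hs.graphForm_eq h0 hn2 _ 0 fun s' hs' => ?_, zero_smul]
    rw [← ht, ← branchForm_eq_graphForm, zero_smul]
    refine ((Branch.vanish hs' hb).neg (by rw [ht, charge_Iv_one])).resolve_right ?_
    rintro ⟨c, h1, h2, h3⟩
    have hd := h1.data isOpen_af_first
    have h4 := hd.lt
    rw [pos_af_first] at h4
    have hbal := hd.bal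
    rw [pos_af_first] at hbal
    rcases hd.le.eq_or_lt with h5 | h5
    · subst h5
      exact hp (h3 ht)
    · obtain ⟨q, hq, rfl⟩ := hlt c h5 h4
      exact h2 q hq le_rfl hbal

end

theorem map_pos_word (α : MeliaOrdering k a) : α.word.map α.pos = List.range' 0 (2 * k + a) := by
  apply List.ext_getElem
  · rw [List.length_map, α.length_word, List.length_range']
  · intro i h1 h2
    rw [List.length_map] at h1
    rw [List.getElem_map, α.pos_getElem h1, List.getElem_range', one_mul, zero_add]

theorem draws_iff {t : PlaneTree k a} : α.Draws t ↔ α.Drawn t 1 (2 * k + a) := by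
  have hn := α.two_le_card
  have hinj : Function.Injective α.pos := fun p q h => α.pos_inj.1 h
  unfold Draws Drawn
  rw [← (List.map_injective_iff.2 hinj).eq_iff, α.map_pos_word, List.map_cons, α.pos_root,
    show 2 * k + a = 2 * k + a - 1 + 1 by omega, List.range'_succ, List.cons_inj_right]
  simp only [Nat.zero_add, Nat.add_sub_cancel]
  constructor
  · intro h; exact ⟨by omega, h⟩
  · intro h; exact h.2

theorem Draws.isGraph {t : PlaneTree k a} (h : α.Draws t) : t.IsGraph α.root := by
  unfold Draws at h
  exact ⟨h ▸ α.word_nodup, fun p => h ▸ α.mem_word p⟩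

end MeliaOrdering

namespace PlaneTree

open MeliaOrdering

variable {α : MeliaOrdering k a}

theorem IsGraph.flips {root : Particle k a} {t t' : PlaneTree k a} {m : ℕ}
    (h : t.IsGraph root) (hf : Flips t t' m) : t'.IsGraph root := by
  have hp := hf.perm.cons root
  exact ⟨hp.nodup_iff.2 h.1, fun p => hp.mem_iff.2 (h.2 p)⟩

theorem IsGraph.leafSet {t : PlaneTree k a} (h : t.IsGraph α.root) :
    t.leafSet = α.Iv 1 (2 * k + a) := by
  ext p
  rw [PlaneTree.leafSet, List.mem_toFinset, mem_Iv]
  have h1 := h.2 p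
  have h2 := (List.nodup_cons.1 h.1).1
  have h3 := α.pos_lt p
  have h4 : α.pos p = 0 ↔ p = α.root := by rw [← α.pos_root, α.pos_inj]
  constructor
  · intro hp
    have : p ≠ α.root := by rintro rfl; exact h2 hp
    have := mt h4.1 this
    omega
  · intro hp
    refine (List.mem_cons.1 h1).resolve_left fun h => ?_
    have := h4.2 h
    omega

theorem IsGraph.channels_allowed {t : PlaneTree k a} (h : t.IsGraph α.root)
    (ha : ∀ I ∈ t.props, IsAllowed I) : ∀ I ∈ t.channels, IsAllowed I := by
  intro I hI
  by_cases hI' : I = t.leafSet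
  · rw [hI', h.leafSet, isAllowed_iff, charge_Iv_one]
    exact .inr ⟨_, .inr rfl⟩
  · exact ha I ((mem_channels_iff (List.nodup_cons.1 h.1).2 hI').1 hI)

theorem IsGraph.branch {t : PlaneTree k a} (h : t.IsGraph α.root)
    (ha : ∀ I ∈ t.props, IsAllowed I) : α.Branch t :=
  ⟨(List.nodup_cons.1 h.1).2, by rw [h.leafSet]; exact root_notMem_Iv le_rfl,
    h.channels_allowed ha⟩

end PlaneTree

/-! ### The volume form -/

/-- The scalar is absorbed into the first vector, which is not possible for an empty product. -/
theorem exists_ιMulti_eq {M : Type*} [AddCommGroup M] [Module ℝ M] (y : ℕ → M) (N : ℕ) {ε : ℝ}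
    (hε : ε ≠ 0) (h0 : N = 0 → ε = 1) : ∃ w : Fin N → ℝˣ,
      ε • (((List.range' 2 N).map y).map (ExteriorAlgebra.ι ℝ)).prod =
        ExteriorAlgebra.ιMulti ℝ N (fun i : Fin N => w i • y (2 + i)) := by
  refine ⟨fun i => if (i : ℕ) = 0 then Units.mk0 ε hε else 1, ?_⟩
  have hw : (∏ i : Fin N, (((if (i : ℕ) = 0 then Units.mk0 ε hε else 1 : ℝˣ)) : ℝ)) = ε := by
    cases N with
    | zero => simp [h0 rfl]
    | succ N => simp [Fin.prod_univ_succ]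
  have h1 := (ExteriorAlgebra.ιMulti ℝ N).toMultilinearMap.map_smul_univ
    (fun i : Fin N => (((if (i : ℕ) = 0 then Units.mk0 ε hε else 1 : ℝˣ)) : ℝ))
    (fun i : Fin N => y (2 + i))
  rw [hw] at h1
  refine Eq.trans ?_ h1.symm
  congr 1
  refine Eq.trans ?_ (ExteriorAlgebra.ιMulti_apply _).symm
  congr 1
  apply List.ext_getElem
  · simp
  · intro i h1 h2
    simp

namespace MeliaOrdering

open PlaneTree

variable {α : MeliaOrdering k a}

section

variable {V V' : Type*} [AddCommGroup V] [Module ℝ V] [AddCommGroup V'] [Module ℝ V']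
  {s : Finset (Particle k a) → V}

theorem Soft.map (hs : α.Soft s) (f : V →ₗ[ℝ] V') : α.Soft (fun I => f (s I)) where
  rel X Y Z rX rY rZ dXY dXZ dYZ hX hY hXY hZ := by
    simp only [← map_add]
    rw [hs.rel X Y Z rX rY rZ dXY dXZ dYZ hX hY hXY hZ]
  small I hI := by rw [hs.small I hI, map_zero]
  cons I hI := by rw [hs.cons I hI, map_zero]

/-- A multiple of the model of `exists_soft_total` is subtracted to remove the total; its gaps from
2 on vanish, so the prescribed values are not disturbed. -/
theorem exists_soft_total_zero (α : MeliaOrdering k a) (hn : 2 < 2 * k + a) (y : ℕ → ℝ) :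
    ∃ s : Finset (Particle k a) → ℝ, α.Soft s ∧ s (α.Iv 1 (2 * k + a)) = 0 ∧
      ∀ g, 2 ≤ g → g + 1 < 2 * k + a → α.gapVec s g = y g := by
  obtain ⟨u, hu, hu1, hu2⟩ := α.exists_soft_total hn
  obtain ⟨s, hs, hs2⟩ := α.exists_soft y
  set c := s (α.Iv 1 (2 * k + a))
  refine ⟨_, (hs.prod hu).map (LinearMap.fst ℝ ℝ ℝ - c • LinearMap.snd ℝ ℝ ℝ), ?_,
    fun g h1 h2 => ?_⟩
  · simp [hu1, c]
  · have h3 := hs2 g (by omega) h2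
    have h4 := hu2 g h1 h2
    unfold gapVec at *
    simp [h3, h4]

end

variable {b c : Mandelstam k a}

theorem ds_compl
    (hne : (α.HT b c : Set (Mandelstam k a)).Nonempty)
    (I : Finset (Particle k a)) : ds (α.HT b c) Iᶜ = ds (α.HT b c) I := by
  ext d
  exact ((mem_direction_iff hne).1 d.2).1 I

theorem ds_of_not_isAllowed
    (hne : (α.HT b c : Set (Mandelstam k a)).Nonempty)
    {I : Finset (Particle k a)} (h : ¬ IsAllowed I) :
    ds (α.HT b c) I = 0 := by
  ext d
  exact ((mem_direction_iff hne).1 d.2).2.2.1 I h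

/-- By complementation this is the differential of the mass of the root. -/
theorem ds_total
    (hne : (α.HT b c : Set (Mandelstam k a)).Nonempty) :
    ds (α.HT b c) (α.Iv 1 (2 * k + a)) = 0 := by
  rw [← compl_Iv_zero (by have := α.two_le_card; omega), ds_compl hne, Iv_zero_one]
  exact (soft_ds hne).singleton _

/-- As the total vanishes, `Soft.total` puts the first gap into the span of the others; n - 3 gaps
remain. -/
theorem E_ds_le
    (hne : (α.HT b c : Set (Mandelstam k a)).Nonempty) :
    α.E (ds (α.HT b c)) 1 (2 * k + a) ≤ α.E (ds (α.HT b c)) 2 (2 * k + a) := by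
  rw [E, Submodule.span_le]
  rintro _ ⟨g, ⟨h1, h2⟩, rfl⟩
  rcases (show 1 ≤ g from h1).eq_or_lt with rfl | h3
  · have := (soft_ds hne).total h2
    rwa [ds_total hne, zero_sub, neg_mem_iff] at this
  · exact gapVec_mem_E h3 h2

theorem ds_mem_E
    (hne : (α.HT b c : Set (Mandelstam k a)).Nonempty)
    {I : Finset (Particle k a)} (hI : α.IsPlanar I) :
    ds (α.HT b c) I ∈ α.E (ds (α.HT b c)) 2 (2 * k + a) := by
  have hs := soft_ds (α := α) hne
  obtain ⟨x, z, hxz, hz, rfl⟩ := isPlanar_iff.1 hI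
  by_cases ha : IsAllowed (α.Iv x z)
  swap
  · rw [ds_of_not_isAllowed hne ha]; exact zero_mem _
  have h0 : ∀ x, ds (α.HT b c) (α.Iv x x) = 0 := fun x => hs.small _ (by
    have : α.Iv x x = ∅ := by ext p; simp
    simp [this])
  apply E_ds_le hne
  rcases hxz.eq_or_lt with rfl | hxz
  · rw [h0]; exact zero_mem _
  -- An interval with the root is exchanged for its complement, which is an interval at the other
  -- end.
  rcases x.eq_zero_or_pos with rfl | hx
  · rw [← ds_compl hne, compl_Iv_zero hz]
    rw [← isAllowed_compl, compl_Iv_zero hz] at ha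
    rcases hz.eq_or_lt with rfl | hz
    · rw [h0]; exact zero_mem _
    · exact hs.planar_mem_E hxz hz le_rfl ha
  · exact hs.planar_mem_E hx hxz hz ha

theorem span_ds_planar
    (hne : (α.HT b c : Set (Mandelstam k a)).Nonempty) :
    Submodule.span ℝ (ds (α.HT b c) '' {I | α.IsPlanar I}) =
    α.E (ds (α.HT b c)) 2 (2 * k + a) := by
  apply le_antisymm
  · rw [Submodule.span_le]
    rintro _ ⟨I, hI, rfl⟩
    exact ds_mem_E hne hI
  · rw [E, Submodule.span_le]
    rintro _ ⟨g, ⟨h1, h2⟩, rfl⟩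
    obtain ⟨x, z, -, h3, h4, h5, -⟩ := gapAt_eq (α := α) (show 1 ≤ g by omega) h2
    exact Submodule.subset_span ⟨_, isPlanar_iff.2 ⟨x, z, h3.le, h4, h5⟩, rfl⟩

/-- For every gap there is a tangent vector, extended from a model, on which this gap is 1 and the
other remaining ones are 0. -/
theorem linearIndependent_gapVec
    (hne : (α.HT b c : Set (Mandelstam k a)).Nonempty) :
    LinearIndependent ℝ
    (fun i : Fin (2 * k + a - 3) => α.gapVec (ds (α.HT b c)) (2 + i)) := by
  rw [Fintype.linearIndependent_iff]
  intro w hw i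
  have hi := i.2
  obtain ⟨s, hs, ht, hg⟩ := α.exists_soft_total_zero (by omega) fun g => if g = 2 + i then 1 else 0
  have h1 := LinearMap.congr_fun hw ⟨α.ext s, hs.ext_mem ht hne⟩
  rw [LinearMap.sum_apply] at h1
  have h2 : ∀ j : Fin (2 * k + a - 3), (w j • α.gapVec (ds (α.HT b c)) (2 + j))
      ⟨α.ext s, hs.ext_mem ht hne⟩ = if j = i then w j else 0 := by
    intro j
    have hj := j.2
    obtain ⟨x, z, hx, -, -, h5, h6⟩ := gapAt_eq (α := α) (show 1 ≤ 2 + (j : ℕ) by omega)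
      (by omega)
    have h7 : α.ext s (α.gapAt (2 + j)) = α.gapVec s (2 + j) := by
      rw [gapVec, h5]; exact ext_of_notMem h6 (root_notMem_Iv hx)
    have h8 : α.gapVec (ds (α.HT b c)) (2 + j) ⟨α.ext s, hs.ext_mem ht hne⟩ =
      α.ext s (α.gapAt (2 + j)) := rfl
    rw [LinearMap.smul_apply, h8, h7, hg _ (by omega) (by omega), smul_eq_mul]
    by_cases hji : j = i
    · subst hji; simp
    · have : (j : ℕ) ≠ i := fun h => hji (Fin.ext h)
      simp [hji, this]
  rw [Finset.sum_congr rfl fun j _ => h2 j] at h1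
  simpa using h1

/-- The sign of the ordering `α` without its first particle. -/
def sign (α : MeliaOrdering k a) : ℝ := (-1) ^ totalInv α.word.tail

theorem sign_ne_zero (α : MeliaOrdering k a) : α.sign ≠ 0 := by simp [sign]

theorem Draws.sign {t : PlaneTree k a} (h : α.Draws t) : t.sign = α.sign := by
  unfold Draws at h
  rw [PlaneTree.sign, MeliaOrdering.sign, ← h, List.tail_cons]

/-- For n ≤ 3 the volume form has degree 0 and must be exactly 1. The numbering puts adjoint
particles after all pairs, so there is no inversion. -/
theorem sign_of_card_le (α : MeliaOrdering k a) (hn : 2 * k + a ≤ 3) : α.sign = 1 := by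
  have hlen : α.rest.word.length + 2 = 2 * k + a := by rw [← α.length_word]; rfl
  have hk : k = 1 := by have := α.first.2; omega
  subst hk
  have h0 : α.first = 0 := Subsingleton.elim _ _
  have htail : α.word.tail = .af α.first :: α.rest.word := rfl
  rw [sign, htail]
  rcases hw : α.rest.word with _ | ⟨p, u⟩
  · simp [totalInv, inversions]
  · rw [hw, List.length_cons] at hlen
    have hu : u = [] := List.length_eq_zero_iff.1 (by omega)
    subst hu
    have hnd := α.nodup
    rw [hw] at hnd
    cases p with
    | f j => rw [Subsingleton.elim j α.first] at hnd; simp at hnd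
    | af j => rw [Subsingleton.elim j α.first] at hnd; simp at hnd
    | adj g => simp [totalInv, inversions, Particle.code, h0]

/-- The volume form in the differentials of the planar Mandelstam variables. -/
def volumeForm (α : MeliaOrdering k a) (b c : Mandelstam k a) : Forms (α.HT b c) :=
  α.sign • α.Z (ds (α.HT b c)) 2 (2 * k + a - 1)

theorem isVolumeForm (hne : (α.HT b c : Set (Mandelstam k a)).Nonempty) :
    α.IsVolumeForm b c (α.volumeForm b c) := by
  obtain ⟨w, hw⟩ := exists_ιMulti_eq (α.gapVec (ds (α.HT b c))) (2 * k + a - 3) α.sign_ne_zero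
    fun h => α.sign_of_card_le (by omega)
  refine ⟨_, (linearIndependent_gapVec hne).units_smul w, ?_, ?_⟩
  · rw [span_ds_planar hne]
    apply le_antisymm
    · rw [Submodule.span_le]
      rintro _ ⟨i, rfl⟩
      have := i.2
      exact Submodule.smul_mem _ _ (gapVec_mem_E (by omega) (by omega))
    · rw [E, Submodule.span_le]
      rintro _ ⟨g, ⟨h1, h2⟩, rfl⟩
      -- The rescaling of the basis vectors is undone by the inverse unit.
      have h3 := Submodule.smul_mem (Submodule.span ℝ (Set.range
        (w • fun i : Fin (2 * k + a - 3) => α.gapVec (ds (α.HT b c)) (2 + i))))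
        ((w ⟨g - 2, by omega⟩)⁻¹ : ℝˣ).1 (Submodule.subset_span ⟨⟨g - 2, by omega⟩, rfl⟩)
      have e : 2 + (g - 2) = g := by omega
      simpa [e, Units.smul_def, smul_smul] using h3
  · refine Eq.trans ?_ hw
    rw [volumeForm, Z, show 2 * k + a - 1 - 2 = 2 * k + a - 3 by omega]

end MeliaOrdering

/-! ### The pullback of the scattering form -/

namespace MeliaOrdering

open PlaneTree
open scoped TensorProduct

variable {α : MeliaOrdering k a} {b c : Mandelstam k a}

theorem pullback_W (t : PlaneTree k a) :
    pullback (α.HT_le b c) (t.W (kinSpace b)) = t.graphForm (ds (α.HT b c)) :=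
  map_graphForm _ _ _

theorem neg_one_pow_smul_smul {V : Type*} [AddCommGroup V] [Module ℝ V] (m : ℕ) (v : V) :
    (-1 : ℝ) ^ m • (-1 : ℝ) ^ m • v = v := by
  rw [← smul_assoc, smul_eq_mul, ← mul_pow]; simp

section

variable {t t' : PlaneTree k a} {m : ℕ}

theorem pullback_W_of_draws
    (hne : (α.HT b c : Set (Mandelstam k a)).Nonempty)
    (ht : t.IsGraph α.root) (hf : Flips t t' m) (hd : α.Draws t')
    (ha : ∀ I ∈ t.props, IsAllowed I) :
    pullback (α.HT_le b c) (t.W (kinSpace b)) = (-1 : ℝ) ^ m • α.volumeForm b c := by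
  have h1 := Drawn.graphForm (soft_ds hne) (ds_total hne) (draws_iff.1 hd)
    ((ht.flips hf).channels_allowed (by rwa [flips_props hf]))
  rw [hd.sign, graphForm_flips _ hf (List.nodup_cons.1 ht.1).2] at h1
  rw [pullback_W, volumeForm, ← h1, neg_one_pow_smul_smul]

theorem pullback_W_of_not_draws
    (hne : (α.HT b c : Set (Mandelstam k a)).Nonempty)
    (ht : t.IsGraph α.root)
    (hp : ¬ ∃ (t' : PlaneTree k a) (m : ℕ), Flips t t' m ∧ α.Draws t') :
    pullback (α.HT_le b c) (t.W (kinSpace b)) = 0 := by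
  rw [pullback_W]
  by_cases ha : ∀ I ∈ t.props, IsAllowed I
  · refine Branch.graphForm (soft_ds hne) (ds_total hne) (ht.branch ha) ht.leafSet ?_
    rintro ⟨t', m, h1, h2⟩
    exact hp ⟨t', m, h1, draws_iff.2 h2⟩
  · push Not at ha
    obtain ⟨I, hI, hI'⟩ := ha
    exact graphForm_eq_zero hI (ds_of_not_isAllowed hne hI')

end

theorem propagators_eq_zero {g : Finset (Finset (Particle k a))} {I : Finset (Particle k a)}
    (hI : I ∈ g) (h : ¬ IsAllowed I) (x : Mandelstam k a) : propagators g x = 0 :=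
  Finset.prod_eq_zero hI (by rw [theta, if_neg h, zero_div])

/-- Equality holds graph by graph: forbidden graphs have a vanishing product of propagators,
non-planar ones a vanishing form, and for the others the chosen drawing differs from the one with
ordering α by flips. -/
theorem lTensor_scatteringForm (hne : (α.HT b c : Set (Mandelstam k a)).Nonempty) {V : Type*}
    [AddCommGroup V] [Module ℝ V] {N : PlaneTree k a → Mandelstam k a → V}
    {s : Finset (Finset (Particle k a)) → PlaneTree k a} (hN : IsNumerator α.root b N)
    (hs : IsOrderingChoice α.root s) {x : Mandelstam k a} (hx : x ∈ α.HT b c) :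
    LinearMap.lTensor V (pullback (α.HT_le b c)).toLinearMap
      (scatteringForm α.root (kinSpace b) s N x) = α.amplitude N x ⊗ₜ[ℝ] α.volumeForm b c := by
  rw [scatteringForm, amplitude, map_sum, TensorProduct.sum_tmul]
  refine Finset.sum_congr rfl fun g hg => ?_
  obtain ⟨h1, h2⟩ := hs g hg
  rw [LinearMap.lTensor_tmul, AlgHom.toLinearMap_apply]
  split_ifs with h
  · obtain ⟨h3, h4⟩ := h.choose_spec
    generalize h.choose = t at *
    by_cases ha : ∀ I ∈ g, IsAllowed I
    · have h5 := h3.isGraph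
      obtain ⟨m, hm⟩ := exists_flips (List.nodup_cons.1 h1.1).2 (List.nodup_cons.1 h5.1).2
        (h1.leafSet.trans h5.leafSet.symm) (h2.trans h4.symm)
      -- The sign of the flips in the form is the one by which the numerator changes between the two
      -- drawings, so that the choice of the ordering is immaterial.
      rw [pullback_W_of_draws hne h1 hm h3 (by rwa [h2]), hN _ _ m h1 hm x (α.HT_le b c hx),
        TensorProduct.tmul_smul, ← TensorProduct.smul_tmul', smul_comm, TensorProduct.smul_tmul',
        TensorProduct.smul_tmul', smul_comm]
    · push Not at ha
      obtain ⟨I, hI, hI'⟩ := ha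
      rw [propagators_eq_zero hI hI', zero_smul, zero_smul, TensorProduct.zero_tmul,
        TensorProduct.zero_tmul]
  · rw [pullback_W_of_not_draws hne h1, TensorProduct.tmul_zero, TensorProduct.zero_tmul]
    rintro ⟨t', m, h3, h4⟩
    exact h ⟨t', h4, (flips_props h3).trans h2⟩

end MeliaOrdering

end BiColour

end

/-! ### The theorem on the pullback of graph differentials and scattering forms -/

theorem mainTheorem1 {k a : ℕ} (α : MeliaOrdering k a) (b c : Mandelstam k a)
    (hne : (α.HT b c : Set (Mandelstam k a)).Nonempty) :
    ∃ dV : Forms (α.HT b c), α.IsVolumeForm b c dV ∧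
      (∀ t : PlaneTree k a, t.IsGraph α.root →
        (∀ (t' : PlaneTree k a) (m : ℕ), t.Flips t' m → α.Draws t' →
          (∀ I ∈ t.props, IsAllowed I) →
          pullback (α.HT_le b c) (t.W (kinSpace b)) = (-1 : ℝ) ^ m • dV) ∧
        ((¬ ∃ (t' : PlaneTree k a) (m : ℕ), t.Flips t' m ∧ α.Draws t') →
          pullback (α.HT_le b c) (t.W (kinSpace b)) = 0)) ∧
      (∀ (V : Type*) [AddCommGroup V] [Module ℝ V]
        (N : PlaneTree k a → Mandelstam k a → V) (s : Finset (Finset (Particle k a)) → PlaneTree k a),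
        PlaneTree.IsNumerator α.root b N → IsOrderingChoice α.root s →
        ∀ x ∈ α.HT b c,
          LinearMap.lTensor V (pullback (α.HT_le b c)).toLinearMap
              (scatteringForm α.root (kinSpace b) s N x) =
            α.amplitude N x ⊗ₜ[ℝ] dV) := by
  refine ⟨α.volumeForm b c, MeliaOrdering.isVolumeForm hne, fun t ht =>
    ⟨fun t' m hf hd ha => ?_, fun hp => ?_⟩, ?_⟩
  · exact MeliaOrdering.pullback_W_of_draws hne ht hf hd ha
  · exact MeliaOrdering.pullback_W_of_not_draws hne ht hp
  · intro V _ _ N s hN hs x hx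
    exact MeliaOrdering.lTensor_scatteringForm hne hN hs hx
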